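/- **Setting.** A rooted planar map is a proper embedding of a finite connected graph in the sphere, up to orientation-preserving homeomorphisms, with a distinguished oriented edge $e_*=(e_-,e_+)$ (the root); the root face $f_*$ is the face on the right of $e_*$, and the boundary $\partial\mathbf m$ consists of the edges and vertices incident to it; its perimeter $\#\partial\mathbf m$ is the degree of $f_*$. Let $\mathcal M$ be the set of rooted planar maps whose face degrees are all even (bipartite maps), including the vertex map $\dagger$ (of perimeter $0$), and let $\mathcal M_k$ be the subset of maps of perimeter $2k$. A map has a simple boundary if its boundary visits no vertex twice; $\widehat{\mathcal M}_k\subset\mathcal M_k$ denotes the set of these maps (so $\dagger\in\widehat{\mathcal M}_0$, and the map with a single edge belongs to $\widehat{\mathcal M}_1$). Let $\mathsf q=(q_k)_{k\ge1}$ be a sequence of nonnegative reals, $w_{\mathsf q}(\mathbf m)=\prod_{f\neq f_*}q_{\deg(f)/2}$ (with $w_{\mathsf q}(\dagger)=1$), $F_k=\sum_{\mathbf m\in\mathcal M_k}w_{\mathsf q}(\mathbf m)$, $\widehat F_k=\sum_{\mathbf m\in\widehat{\mathcal M}_k}w_{\mathsf q}(\mathbf m)$, $F(x)=\sum_{k\ge0}F_kx^k$,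 and let $r_{\mathsf q}$ be the radius of convergence of $F$. Let $$\mathbb P_{\mathsf q,r_{\mathsf q}}(\mathbf m)=\frac{r_{\mathsf q}^{\#\partial\mathbf m/2}\,w_{\mathsf q}(\mathbf m)}{F(r_{\mathsf q})}\ (\mathbf m\in\mathcal M),\qquad \widehat{\mathbb P}^{(k)}_{\mathsf q}(\mathbf m)=\frac{\mathbf 1_{\{\mathbf m\in\widehat{\mathcal M}_k\}}w_{\mathsf q}(\mathbf m)}{\widehat F_k}.$$ *Type.* Let $Z_{\mathsf q}$ be the sum of $\prod_{f}q_{\deg(f)/2}$ (product over all faces, $1$ for $\dagger$) over the maps of $\mathcal M$ pointed at a vertex $v_*$ with $d(e_+,v_*)=d(e_-,v_*)+1$ (with $\dagger$ included); $\mathsf q$ is admissible if $Z_{\mathsf q}<\infty$. Let $\mu(k)=Z_{\mathsf q}^{k-1}\binom{2k-1}{k-1}q_k$ for $k\ge1$ and $\mu(0)=1-\sum_{k\ge1}\binom{2k-1}{k-1}q_kZ_{\mathsf q}^{k-1}$. An admissible $\mathsf q$ is critical if $\mu$ has mean $1$. It is of type $3/2$ if it is not critical, of type $5/2$ if it is critical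 and $\mu$ has finite variance, and of type $a\in(3/2,5/2)$ if it is critical and $\mu([k,\infty))=\ell(k)k^{-(a-1/2)}$ for all $k\ge1$ with $\ell$ a positive slowly varying function. *Tree of components.* Splitting $\mathbf m\in\mathcal M$ at the pinch points of $\partial\mathbf m$ cuts it into irreducible components, which are maps with a simple boundary (an edge with both sides in the root face is a component by itself, of perimeter $2$). $\mathbf{Tree}(\mathbf m)$ is the plane tree whose white vertices (even height) are the vertices of $\partial\mathbf m$ and whose black vertices (odd height) are the irreducible components, a component being adjacent to the vertices of its boundary; it is rooted at $e_-$, the first child of the root is the component that contains $e_*$, and neighbours are ordered clockwise ($\mathbf{Tree}(\dagger)$ is a single vertex). The component $\widehat{\mathbf m}_u$ at a black vertex $u$ is rooted at its boundary edge whose origin is the parent of $u$, with the root face on its right. For a vertex $u$ of a plane tree, $k_u$ is its number of children; for a black $u$, $\deg(u)=k_u+1$. **Proposition.** Let $\mathsf q$ be a weight sequence of type $a\in[3/2,5/2]$. Then $\mathbf{Tree}(\mathbf m)$ is a finite plane tree for every $\mathbf m\in\mathcal M$, $\mathbb P_{\mathsf q,r_{\mathsf q}}$ is a probability measure, and $$\nu_\circ(k)=\frac1{F(r_{\mathsf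 q})}\Big(1-\frac1{F(r_{\mathsf q})}\Big)^k,\qquad \nu_\bullet(2k+1)=\frac{\big(r_{\mathsf q}F^2(r_{\mathsf q})\big)^{k+1}\widehat F_{k+1}}{F(r_{\mathsf q})-1},\qquad \nu_\bullet(2k)=0\qquad(k\ge0)$$ define probability measures on $\mathbb Z_+$. If $M$ has law $\mathbb P_{\mathsf q,r_{\mathsf q}}$, then $\mathbf{Tree}(M)$ is a two-type Galton–Watson tree with offspring distribution $(\nu_\circ,\nu_\bullet)$: for every finite plane tree $\mathbf t$, with sets of white and black vertices $\mathbf t_\circ$ and $\mathbf t_\bullet$, $$\mathbb P_{\mathsf q,r_{\mathsf q}}(\mathbf{Tree}(M)=\mathbf t)=\prod_{u\in\mathbf t_\circ}\nu_\circ(k_u)\prod_{u\in\mathbf t_\bullet}\nu_\bullet(k_u).$$ Moreover, for every $\mathbf t$ of positive probability, conditionally on $\mathbf{Tree}(M)=\mathbf t$ the irreducible components $(\widehat M_u)_{u\in\mathbf t_\bullet}$ are independent with respective laws $\widehat{\mathbb P}^{(\deg(u)/2)}_{\mathsf q}$. -/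

import Mathlib

open MeasureTheory Filter Topology
open scoped ENNReal NNReal

namespace BoltzmannMap

noncomputable section

open Classical

/-! ### First-return permutations -/

section FirstReturn

variable {D : Type} [Finite D]

theorem exists_return (f : Equiv.Perm D) (B : D → Prop) {x : D} (hx : B x) :
    ∃ n : ℕ, 1 ≤ n ∧ B ((f ^ n) x) :=
  ⟨orderOf f, (isOfFinOrder_of_finite f).orderOf_pos, by simpa [pow_orderOf_eq_one] using hx⟩

/-- The first visit of the forward orbit `f x, f (f x), …` to the set `B` if `x ∈ B`;
points outside `B` are left fixed. -/
def firstReturnFun (f : Equiv.Perm D) (B : D → Prop) (x : D) : D :=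
  if hx : B x then (f ^ Nat.find (exists_return f B hx)) x else x

theorem firstReturnFun_injective (f : Equiv.Perm D) (B : D → Prop) :
    Function.Injective (firstReturnFun f B) := by
  have key : ∀ {x y : D} (hx : B x) (hy : B y),
      Nat.find (exists_return f B hx) ≤ Nat.find (exists_return f B hy) →
      (f ^ Nat.find (exists_return f B hx)) x = (f ^ Nat.find (exists_return f B hy)) y →
      x = y := by
    intro x y hx hy hle h
    obtain ⟨c, hc⟩ := Nat.exists_eq_add_of_le hle
    rw [hc, pow_add, Equiv.Perm.mul_apply] at h
    have hxy : x = (f ^ c) y := (f ^ _).injective h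
    rcases Nat.eq_zero_or_pos c with h0 | h0
    · simpa [h0] using hxy
    · have h1 := (Nat.find_spec (exists_return f B hx)).1
      exact absurd ⟨h0, hxy ▸ hx⟩ (Nat.find_min (exists_return f B hy) (m := c) (by omega))
  intro x y h
  unfold firstReturnFun at h
  by_cases hx : B x <;> by_cases hy : B y
  · rw [dif_pos hx, dif_pos hy] at h
    rcases le_total (Nat.find (exists_return f B hx)) (Nat.find (exists_return f B hy)) with h' | h'
    · exact key hx hy h' h
    · exact (key hy hx h' h.symm).symm
  · rw [dif_pos hx, dif_neg hy] at h
    exact absurd (h ▸ (Nat.find_spec (exists_return f B hx)).2) hy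
  · rw [dif_neg hx, dif_pos hy] at h
    exact absurd (h ▸ (Nat.find_spec (exists_return f B hy)).2) hx
  · rwa [dif_neg hx, dif_neg hy] at h

/-- The permutation induced by `f` on `B` by first return, extended by the identity. -/
def firstReturn (f : Equiv.Perm D) (B : D → Prop) : Equiv.Perm D :=
  Equiv.ofBijective (firstReturnFun f B)
    (Finite.injective_iff_bijective.mp (firstReturnFun_injective f B))

end FirstReturn

/-! ### Rooted combinatorial maps -/

/-- One step of the action of two permutations. -/
def Step {D : Type} (σ α : Equiv.Perm D) (x y : D) : Prop := y = σ x ∨ y = α x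

/-- A rooted map with at least one edge on a compact connected oriented surface, encoded by its
darts (oriented edges): `σ` turns a dart counterclockwise around its origin, `α` reverses darts,
`root` is the oriented root edge. -/
structure CMap (D : Type) where
  σ : Equiv.Perm D
  α : Equiv.Perm D
  root : D
  involutive : ∀ d, α (α d) = d
  ne_self : ∀ d, α d ≠ d
  connected : ∀ d d', Relation.EqvGen (Step σ α) d d'

namespace CMap

variable {D : Type}

/-- Transport along a relabelling of the darts. -/
def relabel {D' : Type} (m : CMap D) (e : D ≃ D') : CMap D' where
  σ := e.permCongr m.σ
  α := e.permCongr m.α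
  root := e m.root
  involutive d := by simp [Equiv.permCongr_apply, m.involutive]
  ne_self d := by
    intro h
    have := congrArg e.symm h
    simp only [Equiv.permCongr_apply, Equiv.symm_apply_apply] at this
    exact m.ne_self _ this
  connected d d' := by
    have h : ∀ x y : D, Relation.EqvGen (Step m.σ m.α) x y →
        Relation.EqvGen (Step (e.permCongr m.σ) (e.permCongr m.α)) (e x) (e y) := by
      intro x y hxy
      induction hxy with
      | rel x y h =>
        refine Relation.EqvGen.rel _ _ ?_
        rcases h with h | h
        · left; simp [Equiv.permCongr_apply, h]
        · right; simp [Equiv.permCongr_apply, h]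
      | refl x => exact Relation.EqvGen.refl _
      | symm x y _ ih => exact Relation.EqvGen.symm _ _ ih
      | trans x y z _ _ ih1 ih2 => exact Relation.EqvGen.trans _ _ _ ih1 ih2
    simpa using h (e.symm d) (e.symm d') (m.connected _ _)

/-- Isomorphism of rooted maps (orientation-preserving, root to root). -/
def Iso {D' : Type} (m : CMap D) (m' : CMap D') : Prop :=
  ∃ e : D ≃ D', (∀ d, e (m.σ d) = m'.σ (e d)) ∧ (∀ d, e (m.α d) = m'.α (e d)) ∧
    e m.root = m'.root

theorem Iso.rfl' (m : CMap D) : m.Iso m := ⟨Equiv.refl D, by simp⟩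

theorem Iso.symm' {D' : Type} {m : CMap D} {m' : CMap D'} : m.Iso m' → m'.Iso m := by
  rintro ⟨e, h1, h2, h3⟩
  refine ⟨e.symm, fun d => ?_, fun d => ?_, ?_⟩
  · apply e.injective; simp [h1]
  · apply e.injective; simp [h2]
  · rw [← h3, e.symm_apply_apply]

theorem Iso.trans' {D' D'' : Type} {m : CMap D} {m' : CMap D'} {m'' : CMap D''} :
    m.Iso m' → m'.Iso m'' → m.Iso m'' := by
  rintro ⟨e, h1, h2, h3⟩ ⟨e', h1', h2', h3'⟩
  exact ⟨e.trans e', by simp [h1, h1'], by simp [h2, h2'], by simp [h3, h3']⟩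

/-- Vertices are the cycles of `σ`. -/
abbrev Vertex (m : CMap D) : Type := Quotient (Equiv.Perm.SameCycle.setoid m.σ)

/-- The origin of a dart. -/
def origin (m : CMap D) (d : D) : m.Vertex := Quotient.mk _ d

/-- `m.φ d` is the dart that follows `d` along the face on the right of `d`. -/
def φ (m : CMap D) : Equiv.Perm D := m.σ * m.α

/-- Faces are the cycles of `φ`; a face is incident on the right to the darts of its cycle. -/
abbrev Face (m : CMap D) : Type := Quotient (Equiv.Perm.SameCycle.setoid m.φ)

/-- The face on the right of a dart. -/
def face (m : CMap D) (d : D) : m.Face := Quotient.mk _ d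

/-- The root face, external to the map. -/
def rootFace (m : CMap D) : m.Face := m.face m.root

/-- The degree of a face: the number of its incident darts. -/
def deg (m : CMap D) (f : m.Face) : ℕ := Nat.card {d : D // m.face d = f}

/-- The number of darts of the boundary. -/
def perimeter (m : CMap D) : ℕ := m.deg m.rootFace

/-- The darts of the boundary, those with the root face on their right. -/
def IsBoundary (m : CMap D) (d : D) : Prop := m.face d = m.rootFace

/-- Euler's formula `V - E + F = 2`, where `2 E` is the number of darts. -/
def IsPlanar (m : CMap D) : Prop :=
  2 * (Nat.card m.Vertex + Nat.card m.Face) = Nat.card D + 4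

/-- All face degrees are even. -/
def IsBipartite (m : CMap D) : Prop := ∀ f : m.Face, Even (m.deg f)

/-- The boundary visits every vertex at most once. -/
def HasSimpleBoundary (m : CMap D) : Prop :=
  ∀ d d', m.IsBoundary d → m.IsBoundary d' → m.origin d = m.origin d' → d = d'

/-- The underlying graph (loops and edge multiplicities are irrelevant for distances). -/
def graph (m : CMap D) : SimpleGraph m.Vertex :=
  SimpleGraph.fromRel fun u v => ∃ d, m.origin d = u ∧ m.origin (m.α d) = v

/-- The vertices `v` such that `m` pointed at `v` is positive: the root edge goes from distance
`l` to distance `l + 1` of `v`. -/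
def positiveVertices (m : CMap D) : Set m.Vertex :=
  {v | m.graph.dist (m.origin (m.α m.root)) v = m.graph.dist (m.origin m.root) v + 1}

section Finite

variable [Finite D]

instance instFintypeFace (m : CMap D) : Fintype m.Face := Fintype.ofFinite _

/-- The Boltzmann weight of a map with a boundary: the root face receives no weight. -/
def weight (q : ℕ → ℝ≥0) (m : CMap D) : ℝ≥0∞ :=
  ∏ f : m.Face, if f = m.rootFace then 1 else (q (m.deg f / 2) : ℝ≥0∞)

/-- The Boltzmann weight where all faces are weighted. -/
def fullWeight (q : ℕ → ℝ≥0) (m : CMap D) : ℝ≥0∞ :=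
  ∏ f : m.Face, (q (m.deg f / 2) : ℝ≥0∞)

/-! ### Splitting a map at the pinch points of its boundary

At a vertex `v` the boundary darts issued from `v` correspond to the corners of the root face at
`v` (the corner lies just clockwise of the dart). Splitting all boundary vertices at these corners
cuts the map into its irreducible components. -/

/-- For a boundary dart, the next boundary dart clockwise around its origin (possibly itself);
other darts are fixed. -/
def cw (m : CMap D) : Equiv.Perm D := firstReturn m.σ⁻¹ m.IsBoundary

/-- The rotation around vertices after splitting: turn counterclockwise, but when a corner of the
root face is crossed go back to the first dart after the previous such corner. -/
def splitσ (m : CMap D) : Equiv.Perm D := m.cw * m.σ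

/-- The face permutation after splitting. The cycles of boundary darts are the contours of the
irreducible components, that is of the internal faces of the scooped-out map; since every dart of
the contour counts, an edge with both sides in the root face yields a component with contour of
length two. -/
def splitφ (m : CMap D) : Equiv.Perm D := m.splitσ * m.α

/-- Two darts are in the same irreducible component. -/
def SameComponent (m : CMap D) : D → D → Prop := Relation.EqvGen (Step m.splitσ m.α)

theorem sameComponent_splitσ (m : CMap D) (e x : D) :
    m.SameComponent e (m.splitσ x) ↔ m.SameComponent e x := by
  have hs : Step m.splitσ m.α x (m.splitσ x) := Or.inl rfl
  exact ⟨fun h => h.trans _ _ _ ((Relation.EqvGen.rel _ _ hs).symm _ _),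
    fun h => h.trans _ _ _ (Relation.EqvGen.rel _ _ hs)⟩

theorem sameComponent_α (m : CMap D) (e x : D) :
    m.SameComponent e (m.α x) ↔ m.SameComponent e x := by
  have hs : Step m.splitσ m.α x (m.α x) := Or.inr rfl
  exact ⟨fun h => h.trans _ _ _ ((Relation.EqvGen.rel _ _ hs).symm _ _),
    fun h => h.trans _ _ _ (Relation.EqvGen.rel _ _ hs)⟩

/-- The connected component of the split map that contains the dart `e`, rooted at `e`. -/
def component (m : CMap D) (e : D) : CMap {d : D // m.SameComponent e d} where
  σ := m.splitσ.subtypePerm (m.sameComponent_splitσ e)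
  α := m.α.subtypePerm (m.sameComponent_α e)
  root := ⟨e, Relation.EqvGen.refl e⟩
  involutive d := by ext; simp [m.involutive]
  ne_self d := by
    intro h
    exact m.ne_self d.1 (congrArg Subtype.val h)
  connected := by
    set σ' := m.splitσ.subtypePerm (m.sameComponent_splitσ e) with hσ
    set α' := m.α.subtypePerm (m.sameComponent_α e) with hα
    have key : ∀ x y, Relation.EqvGen (Step m.splitσ m.α) x y →
        ∀ (hx : m.SameComponent e x) (hy : m.SameComponent e y),
          Relation.EqvGen (Step σ' α') ⟨x, hx⟩ ⟨y, hy⟩ := by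
      intro x y h
      induction h with
      | rel x y h =>
        intro hx hy
        refine Relation.EqvGen.rel _ _ ?_
        rcases h with h | h
        · left; ext; simpa [hσ] using h
        · right; ext; simpa [hα] using h
      | refl x => intro hx hy; exact Relation.EqvGen.refl _
      | symm x y _ ih => intro hx hy; exact (ih hy hx).symm _ _
      | trans x y z hxy _ ih1 ih2 =>
        intro hx hz
        have hy : m.SameComponent e y := Relation.EqvGen.trans _ _ _ hx hxy
        exact (ih1 hx hy).trans _ _ _ (ih2 hy hz)
    intro d d'
    exact key d.1 d'.1 ((d.2.symm _ _).trans _ _ _ d'.2) d.2 d'.2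

/-! ### Exploration of the tree of components

White vertices are the vertices of the boundary, black vertices are the irreducible components,
and a component is adjacent to the vertices of its contour. The neighbours of a vertex of the tree
are ordered clockwise, starting after the parent. A black vertex is represented by the boundary
dart of its contour whose origin is the parent; a white vertex other than the root is represented
by the boundary dart of the contour of its parent component which it is the origin of. -/

/-- Follow a list of child labels (the first child has label `1`), starting at the black
(`true`) or white (`false`) vertex represented by a dart; `none` if some child does not exist. -/
def walk (m : CMap D) : Bool → D → List ℕ → Option D
  | _, d, [] => some d
  | true, d, j :: l =>
    if 1 ≤ j ∧ j < Function.minimalPeriod m.splitφ d then walk m false ((m.splitφ⁻¹ ^ j) d) l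
    else none
  | false, d, j :: l =>
    if 1 ≤ j ∧ j < Function.minimalPeriod m.cw d then walk m true ((m.cw ^ j) d) l
    else none

/-- The dart that represents the vertex of the tree of components with a given address. The root
is the origin of the root edge, and its first child is the component of the root edge. -/
def dartAt (m : CMap D) : List ℕ → Option D
  | [] => some m.root
  | j :: l =>
    if 1 ≤ j ∧ j ≤ Function.minimalPeriod m.cw m.root then walk m true ((m.cw ^ (j - 1)) m.root) l
    else none

/-- The vertex set of the tree of components. -/
def treeVertices (m : CMap D) : Set (List ℕ) := {u | (m.dartAt u).isSome}

theorem walk_parent (m : CMap D) (u : List ℕ) (j : ℕ) :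
    ∀ (b : Bool) (d : D), (m.walk b d (u ++ [j])).isSome → (m.walk b d u).isSome := by
  induction u with
  | nil => intro b d _; cases b <;> simp [walk]
  | cons i l ih =>
    intro b d h
    cases b <;> simp only [List.cons_append, walk] at h ⊢ <;> split_ifs at h ⊢ with hi
    · exact ih _ _ h
    · simp at h
    · exact ih _ _ h
    · simp at h

theorem walk_children (m : CMap D) (u : List ℕ) :
    ∀ (b : Bool) (d : D), ∃ k, ∀ j, (m.walk b d (u ++ [j])).isSome ↔ 1 ≤ j ∧ j ≤ k := by
  induction u with
  | nil =>
    intro b d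
    cases b
    · refine ⟨Function.minimalPeriod m.cw d - 1, fun j => ?_⟩
      simp only [List.nil_append, walk]
      split_ifs with h
      · simp; omega
      · simp; omega
    · refine ⟨Function.minimalPeriod m.splitφ d - 1, fun j => ?_⟩
      simp only [List.nil_append, walk]
      split_ifs with h
      · simp; omega
      · simp; omega
  | cons i l ih =>
    intro b d
    cases b <;> simp only [List.cons_append, walk] <;> split_ifs with hi
    · exact ih _ _
    · exact ⟨0, fun j => by simp; omega⟩
    · exact ih _ _
    · exact ⟨0, fun j => by simp; omega⟩

theorem nil_mem_treeVertices (m : CMap D) : [] ∈ m.treeVertices := by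
  simp [treeVertices, dartAt]

theorem parent_mem_treeVertices (m : CMap D) (u : List ℕ) (j : ℕ)
    (h : u ++ [j] ∈ m.treeVertices) : u ∈ m.treeVertices := by
  cases u with
  | nil => exact m.nil_mem_treeVertices
  | cons i l =>
    simp only [treeVertices, Set.mem_ofPred_eq, List.cons_append, dartAt] at h ⊢
    split_ifs at h ⊢ with hi
    · exact m.walk_parent l j _ _ h
    · simp at h

theorem children_treeVertices (m : CMap D) (u : List ℕ) :
    ∃ k, ∀ j, u ++ [j] ∈ m.treeVertices ↔ 1 ≤ j ∧ j ≤ k := by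
  cases u with
  | nil =>
    refine ⟨Function.minimalPeriod m.cw m.root, fun j => ?_⟩
    simp only [treeVertices, Set.mem_ofPred_eq, List.nil_append, dartAt]
    split_ifs with h
    · simp [walk]; omega
    · simp; omega
  | cons i l =>
    simp only [treeVertices, Set.mem_ofPred_eq, List.cons_append, dartAt]
    split_ifs with hi
    · exact m.walk_children l _ _
    · exact ⟨0, fun j => by simp; omega⟩

end Finite

end CMap

/-! ### Plane trees -/

/-- Finite plane trees as finite sets of words of positive integers. -/
structure PlaneTree where
  verts : Finset (List ℕ)
  nil_mem : [] ∈ verts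
  parent_mem : ∀ u j, u ++ [j] ∈ verts → u ∈ verts
  children : ∀ u ∈ verts, ∃ k, ∀ j, u ++ [j] ∈ verts ↔ 1 ≤ j ∧ j ≤ k

namespace PlaneTree

/-- The number of children of a vertex. -/
def numChildren (t : PlaneTree) (u : List ℕ) : ℕ :=
  Set.ncard {j : ℕ | u ++ [j] ∈ t.verts}

/-- Vertices at even height. -/
def white (t : PlaneTree) : Finset (List ℕ) := t.verts.filter fun u => Even u.length

/-- Vertices at odd height. -/
def black (t : PlaneTree) : Finset (List ℕ) := t.verts.filter fun u => Odd u.length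

/-- The degree of a vertex other than the root: its children and its parent. -/
def degree (t : PlaneTree) (u : List ℕ) : ℕ := t.numChildren u + 1

/-- The tree with a single vertex. -/
def single : PlaneTree where
  verts := {[]}
  nil_mem := by simp
  parent_mem u j h := by simp at h
  children u _ := ⟨0, fun j => by simp; omega⟩

instance : MeasurableSpace PlaneTree := ⊤

end PlaneTree

/-- The measure with prescribed point masses. -/
def pointMasses {X : Type} [MeasurableSpace X] (p : X → ℝ≥0∞) : Measure X :=
  Measure.sum fun x => p x • Measure.dirac x

/-- The law on finite trees of the alternated two-type Galton-Watson tree with white and black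
offspring laws `ρw` and `ρb`. -/
def GW (ρw ρb : ℕ → ℝ≥0∞) : Measure PlaneTree :=
  pointMasses fun t =>
    (∏ u ∈ t.white, ρw (t.numChildren u)) * ∏ u ∈ t.black, ρb (t.numChildren u)

/-! ### Maps up to isomorphism -/

instance mapSetoid : Setoid (Σ n : ℕ, CMap (Fin n)) where
  r m m' := m.2.Iso m'.2
  iseqv := ⟨fun m => CMap.Iso.rfl' m.2, CMap.Iso.symm', CMap.Iso.trans'⟩

/-- Rooted maps with at least one edge, of any genus, up to isomorphism. -/
abbrev EdgeMap : Type := Quotient mapSetoid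

/-- Rooted maps of any genus up to isomorphism, where `none` is the vertex map (one vertex, no
edge). All notions below are isomorphism invariants, evaluated on a representative. -/
abbrev RMap : Type := Option EdgeMap

/-- The isomorphism class of a map with a finite set of darts. -/
def CMap.toRMap {D : Type} [Finite D] (m : CMap D) : RMap :=
  some (Quotient.mk _ ⟨Nat.card D, m.relabel (Finite.equivFin D)⟩)

instance : MeasurableSpace RMap := ⊤

/-- A representative of an isomorphism class. -/
abbrev EdgeMap.rep (m : EdgeMap) : CMap (Fin (Quotient.out m).1) := (Quotient.out m).2

namespace RMap

/-- The perimeter; the vertex map has perimeter `0`. -/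
def perimeter : RMap → ℕ
  | none => 0
  | some m => (EdgeMap.rep m).perimeter

/-- The Boltzmann weight, without the root face; the vertex map has weight `1`. -/
def weight (q : ℕ → ℝ≥0) : RMap → ℝ≥0∞
  | none => 1
  | some m => (EdgeMap.rep m).weight q

/-- The vertex set of the tree of components. -/
def treeVertices : RMap → Set (List ℕ)
  | none => {[]}
  | some m => (EdgeMap.rep m).treeVertices

/-- The tree of components. (For a planar map the vertex set is finite; the second case is a
default value for maps of positive genus.) -/
def tree : RMap → PlaneTree
  | none => PlaneTree.single
  | some m =>
    if h : (EdgeMap.rep m).treeVertices.Finite then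
      { verts := h.toFinset
        nil_mem := by simpa using (EdgeMap.rep m).nil_mem_treeVertices
        parent_mem := fun u j hu => by
          simpa using (EdgeMap.rep m).parent_mem_treeVertices u j (by simpa using hu)
        children := fun u _ => by simpa using (EdgeMap.rep m).children_treeVertices u }
    else PlaneTree.single

/-- The irreducible component at a black vertex `u` of the tree of components, rooted at the
contour edge whose origin is the parent of `u`. -/
def component : RMap → List ℕ → RMap
  | none, _ => none
  | some m, u =>
    match (EdgeMap.rep m).dartAt u with
    | none => none
    | some e => ((EdgeMap.rep m).component e).toRMap

end RMap

/-- Rooted planar bipartite maps, including the vertex map. -/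
def maps : Set RMap :=
  {m | ∀ e : EdgeMap, m = some e → e.rep.IsPlanar ∧ e.rep.IsBipartite}

/-- Maps with a simple boundary, including the vertex map. -/
def simpleMaps : Set RMap :=
  {m | m ∈ maps ∧ ∀ e : EdgeMap, m = some e → e.rep.HasSimpleBoundary}

/-! ### Weight sequences

A weight sequence is `q : ℕ → ℝ≥0`; the value `q 0` is never used. -/

/-- The total weight of positive pointed maps (all faces weighted), the vertex map contributing
`1`. As rooted maps have no nontrivial automorphism, the pointed maps with underlying rooted map
`m` correspond to the vertices of a representative of `m`. -/
def Z (q : ℕ → ℝ≥0) : ℝ≥0∞ :=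
  1 + ∑' m : {e : EdgeMap // some e ∈ maps},
    ∑' _v : m.1.rep.positiveVertices, m.1.rep.fullWeight q

/-- Admissible weight sequences. -/
def Admissible (q : ℕ → ℝ≥0) : Prop := Z q < ∞

/-- `f_q(x) = ∑_{k ≥ 1} binom(2k-1, k-1) q_k x^(k-1)`, indexed by `k - 1`. -/
def fq (q : ℕ → ℝ≥0) (x : ℝ≥0∞) : ℝ≥0∞ :=
  ∑' i : ℕ, ((2 * i + 1).choose i : ℝ≥0∞) * (q (i + 1) : ℝ≥0∞) * x ^ i

/-- The offspring law `μ`. -/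
def mu (q : ℕ → ℝ≥0) : ℕ → ℝ≥0∞
  | 0 => 1 - fq q (Z q)
  | i + 1 => Z q ^ i * ((2 * i + 1).choose i : ℝ≥0∞) * (q (i + 1) : ℝ≥0∞)

/-- The mean of `μ`. -/
def meanMu (q : ℕ → ℝ≥0) : ℝ≥0∞ := ∑' k : ℕ, (k : ℝ≥0∞) * mu q k

def IsCritical (q : ℕ → ℝ≥0) : Prop := Admissible q ∧ meanMu q = 1

def IsSubcritical (q : ℕ → ℝ≥0) : Prop := Admissible q ∧ meanMu q ≠ 1

/-- Critical, and `μ` has a finite second moment (equivalently, finite variance). -/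
def IsGenericCritical (q : ℕ → ℝ≥0) : Prop :=
  IsCritical q ∧ ∑' k : ℕ, (k : ℝ≥0∞) ^ 2 * mu q k < ∞

/-- Positive slowly varying functions at infinity. -/
def SlowlyVarying (l : ℝ → ℝ) : Prop :=
  (∀ x, 0 < x → 0 < l x) ∧ ∀ c, 0 < c → Tendsto (fun x => l (c * x) / l x) atTop (𝓝 1)

/-- Critical, and `μ([k,∞)) = ℓ(k) k^(-α)` with `ℓ` slowly varying and `α ∈ (1,2)`. -/
def IsNonGenericCritical (q : ℕ → ℝ≥0) (α : ℝ) : Prop :=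
  IsCritical q ∧ 1 < α ∧ α < 2 ∧ ∃ l : ℝ → ℝ, SlowlyVarying l ∧
    ∀ k : ℕ, 1 ≤ k → ∑' j : ℕ, mu q (k + j) = ENNReal.ofReal (l k * (k : ℝ) ^ (-α))

/-- Weight sequences of type `a`; necessarily `a ∈ [3/2, 5/2]`. -/
def IsOfType (q : ℕ → ℝ≥0) (a : ℝ) : Prop :=
  (a = 3 / 2 ∧ IsSubcritical q) ∨ (a = 5 / 2 ∧ IsGenericCritical q) ∨
    IsNonGenericCritical q (a - 1 / 2)

/-! ### Partition functions and Boltzmann measures -/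

/-- Partition function of maps with perimeter `2k`. -/
def Fcoef (q : ℕ → ℝ≥0) (k : ℕ) : ℝ≥0∞ :=
  ∑' m : {m : RMap // m ∈ maps ∧ m.perimeter = 2 * k}, m.1.weight q

/-- Partition function of maps with a simple boundary of perimeter `2k`. -/
def FcoefHat (q : ℕ → ℝ≥0) (k : ℕ) : ℝ≥0∞ :=
  ∑' m : {m : RMap // m ∈ simpleMaps ∧ m.perimeter = 2 * k}, m.1.weight q

/-- The generating function of the `F_k`. -/
def F (q : ℕ → ℝ≥0) (x : ℝ≥0∞) : ℝ≥0∞ := ∑' k : ℕ, Fcoef q k * x ^ k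

/-- The radius of convergence of `F`, a power series with nonnegative coefficients. -/
def rad (q : ℕ → ℝ≥0) : ℝ≥0∞ := sSup {x | F q x < ∞}

/-- The free-perimeter Boltzmann measure at the radius of convergence. -/
def freeBoltzmann (q : ℕ → ℝ≥0) : Measure RMap :=
  pointMasses (maps.indicator fun m => rad q ^ (m.perimeter / 2) * m.weight q / F q (rad q))

/-- The Boltzmann measure on maps with a simple boundary of perimeter `2k`. -/
def simpleBoltzmann (q : ℕ → ℝ≥0) (k : ℕ) : Measure RMap :=
  pointMasses ({m | m ∈ simpleMaps ∧ m.perimeter = 2 * k}.indicator fun m =>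
    m.weight q / FcoefHat q k)

/-- The white offspring law. -/
def nuWhite (q : ℕ → ℝ≥0) (k : ℕ) : ℝ≥0∞ :=
  1 / F q (rad q) * (1 - 1 / F q (rad q)) ^ k

/-- The black offspring law, supported by odd integers. -/
def nuBlack (q : ℕ → ℝ≥0) (n : ℕ) : ℝ≥0∞ :=
  if Odd n then
    1 / (F q (rad q) - 1) * (rad q * F q (rad q) ^ 2) ^ (n / 2 + 1) * FcoefHat q (n / 2 + 1)
  else 0

end

end BoltzmannMap

open BoltzmannMap
open scoped ProbabilityTheory

namespace BoltzmannMap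

noncomputable section

open Classical

/-! ### Counting cycles: the genus inequality -/

section Genus

variable {D : Type}

/-! Cutting a planar map at the pinch points of its boundary is a bijection onto the pairs formed by
a finite plane tree and, at each black vertex `u`, a map with a simple boundary of perimeter `degree
u`. Under this bijection the weight is the product of the weights of the components and the
perimeter is the sum of their perimeters. The mass of a prescribed tree with prescribed components
is therefore a product over the black vertices (`tsum_bw_tree_component`), and summing over the
components gives the mass of the tree (`tsum_bw_tree`). Counting the vertices of a plane tree by
colour shows that the powers of `F` and `F - 1` in the offspring laws leave only the normalization
`1 / F` (`prod_nu`), so this mass is the Galton–Watson product. Conditional independence of the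
components is the factorization itself.

The bijection rests on one inequality, `genus_le`, obtained by rank-nullity for coboundaries over
the field with two elements; planarity is its case of equality. When a planar map is split, every
inequality in the count must be sharp (`planar_split`). Hence the components are planar, each has a
single contour, and the incidence graph of boundary vertices and contours is a tree, which the
exploration visits once per boundary dart (`dartAt_bijective`). The structure `Encodes` records the
resulting labelling of the boundary by the tree. A map is recovered from its tree and components
(`Encodes.iso_of_components`), and conversely any compatible family can be glued along any tree
(`Glue.glue`, `exists_of_tree_of_component`), planarity following from the same kind of count.

The analytic part shows that the radius of convergence `r` is positive and that `1 < F(r) < ∞`.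
Cutting a tree at its root gives `F_eq`, that is, `F = 1 + ∑ F̂_k (x F²)^k` over `k ≥ 1`; it is also
the reason why `nuBlack` has total mass one. The single-edge map contributes to the term `k = 1`, so
`1 + x F² ≤ F`; hence `F ≤ 1/x` wherever `F` is finite, and letting `x` increase to `r` gives `F(r)
≤ 1/r`. For positivity of `r`, the type enters through admissibility. If `q_j ≠ 0` for some `j ≥ 2`,
then `F_j` is finite by admissibility, and drawing a chord in the root face gives `q_j F_k ≤
F_{k+1-j}`, hence geometric growth. Otherwise all weighted faces are digons, Euler's formula leaves
only components of perimeter two, and the recursion on trees is of Catalan type. -/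

/-- The number of cycles of a permutation, fixed points included. -/
def cyc (f : Equiv.Perm D) : ℕ := Nat.card (Quotient (Equiv.Perm.SameCycle.setoid f))

/-- The number of orbits of a pair of permutations. -/
def orb (f g : Equiv.Perm D) : ℕ := Nat.card (Quotient (Relation.EqvGen.setoid (Step f g)))

/-- The values of `v` are often propositions: this propagates a property along the cycles of a
permutation that preserves it. -/
theorem sameCycle_invariant [Finite D] {Y : Type*} {f : Equiv.Perm D} {v : D → Y}
    (h : ∀ x, v (f x) = v x) {x y : D} (hxy : f.SameCycle x y) : v x = v y := by
  obtain ⟨n, rfl⟩ := hxy.exists_nat_pow_eq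
  induction n with
  | zero => rfl
  | succ n ih => rw [pow_succ', Equiv.Perm.mul_apply, h]; exact ih ⟨n, by simp⟩

theorem eqvGen_invariant {Y : Type*} {f g : Equiv.Perm D} {v : D → Y}
    (hf : ∀ x, v (f x) = v x) (hg : ∀ x, v (g x) = v x) {x y : D}
    (hxy : Relation.EqvGen (Step f g) x y) : v x = v y := by
  induction hxy with
  | rel x y h => rcases h with h | h <;> simp [h, hf, hg]
  | refl x => rfl
  | symm x y _ ih => exact ih.symm
  | trans x y z _ _ h1 h2 => exact h1.trans h2

variable (D) in
abbrev DartFun : Type := D → ZMod 2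

/-- The functions that are constant on the classes of a setoid. -/
def invariants (r : Setoid D) : Submodule (ZMod 2) (DartFun D) where
  carrier := {v | ∀ x y, r x y → v x = v y}
  add_mem' := by
    intro a b ha hb x y h
    simp [ha x y h, hb x y h]
  zero_mem' := by intro x y _; rfl
  smul_mem' := by
    intro c a ha x y h
    simp [ha x y h]

theorem finrank_invariants [Finite D] (r : Setoid D) :
    Module.finrank (ZMod 2) (invariants r) = Nat.card (Quotient r) := by
  have : Fintype (Quotient r) := Fintype.ofFinite _
  let e : (Quotient r → ZMod 2) ≃ₗ[ZMod 2] invariants r :=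
    { toFun := fun v => ⟨fun x => v (Quotient.mk r x), fun x y h => by
        exact congrArg v (Quotient.sound (s := r) h)⟩
      map_add' := fun a b => rfl
      map_smul' := fun a b => rfl
      invFun := fun v => fun c => Quotient.lift v.1 (fun x y h => v.2 x y h) c
      left_inv := fun v => by
        funext c
        induction c using Quotient.inductionOn with
        | h x => rfl
      right_inv := fun v => by ext x; rfl }
  rw [← e.finrank_eq, Module.finrank_fintype_fun_eq_card, Nat.card_eq_fintype_card]

/-- The coboundary `v ↦ v ∘ f - v` of a permutation. -/
def cobdry (f : Equiv.Perm D) : DartFun D →ₗ[ZMod 2] DartFun D :=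
  LinearMap.funLeft (ZMod 2) (ZMod 2) f - LinearMap.id

@[simp] theorem cobdry_apply (f : Equiv.Perm D) (v : DartFun D) (x : D) :
    cobdry f v x = v (f x) - v x := rfl

theorem ker_cobdry [Finite D] (f : Equiv.Perm D) :
    LinearMap.ker (cobdry f) = invariants (Equiv.Perm.SameCycle.setoid f) := by
  ext v
  rw [LinearMap.mem_ker]
  constructor
  · intro h x y hxy
    exact sameCycle_invariant (fun x => sub_eq_zero.mp (congrFun h x)) hxy
  · intro h
    funext x
    exact sub_eq_zero.mpr (h _ _ (Equiv.Perm.sameCycle_apply_left.mpr (Equiv.Perm.SameCycle.refl f x)))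

theorem finrank_range_cobdry [Finite D] (f : Equiv.Perm D) :
    Module.finrank (ZMod 2) (LinearMap.range (cobdry f)) + cyc f = Nat.card D := by
  have : Fintype D := Fintype.ofFinite _
  have h := (cobdry f).finrank_range_add_finrank_ker
  rw [ker_cobdry, finrank_invariants, Module.finrank_fintype_fun_eq_card,
    ← Nat.card_eq_fintype_card] at h
  exact h

/-- The step from `x` to `f (g x)` is made through `g x`. Thus the coboundary of a product factors
through the pair of coboundaries. -/
theorem cobdry_mul (f g : Equiv.Perm D) (v : DartFun D) :
    cobdry (f * g) v = (fun x => cobdry f v (g x)) + cobdry g v := by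
  funext x
  simp

/-- Both coboundaries of a function. -/
def pairCobdry (f g : Equiv.Perm D) :
    DartFun D →ₗ[ZMod 2] LinearMap.range (cobdry f) × LinearMap.range (cobdry g) :=
  (cobdry f).rangeRestrict.prod (cobdry g).rangeRestrict

/-- Recombination of a pair of coboundaries. -/
def recombine (f g : Equiv.Perm D) :
    LinearMap.range (cobdry f) × LinearMap.range (cobdry g) →ₗ[ZMod 2] DartFun D :=
  ((LinearMap.funLeft (ZMod 2) (ZMod 2) g) ∘ₗ (LinearMap.range (cobdry f)).subtype).coprod
    (LinearMap.range (cobdry g)).subtype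

theorem recombine_pairCobdry (f g : Equiv.Perm D) (v : DartFun D) :
    recombine f g (pairCobdry f g v) = cobdry (f * g) v := by
  rw [cobdry_mul]; rfl

theorem ker_pairCobdry (f g : Equiv.Perm D) :
    LinearMap.ker (pairCobdry f g) = invariants (Relation.EqvGen.setoid (Step f g)) := by
  ext v
  rw [LinearMap.mem_ker]
  constructor
  · intro h x y hxy
    have h1 : cobdry f v = 0 := congrArg (fun z => (z.1 : DartFun D)) h
    have h2 : cobdry g v = 0 := congrArg (fun z => (z.2 : DartFun D)) h
    exact eqvGen_invariant (fun x => sub_eq_zero.mp (congrFun h1 x))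
      (fun x => sub_eq_zero.mp (congrFun h2 x)) hxy
  · intro h
    refine Prod.ext (Subtype.ext (funext fun x => ?_)) (Subtype.ext (funext fun x => ?_))
    · exact sub_eq_zero.mpr (h x _ (Relation.EqvGen.rel (r := Step f g) _ _ (Or.inl rfl))).symm
    · exact sub_eq_zero.mpr (h x _ (Relation.EqvGen.rel (r := Step f g) _ _ (Or.inr rfl))).symm

theorem finrank_range_pairCobdry [Finite D] (f g : Equiv.Perm D) :
    Module.finrank (ZMod 2) (LinearMap.range (pairCobdry f g)) + orb f g = Nat.card D := by
  have : Fintype D := Fintype.ofFinite _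
  have h := (pairCobdry f g).finrank_range_add_finrank_ker
  rw [ker_pairCobdry, finrank_invariants, Module.finrank_fintype_fun_eq_card,
    ← Nat.card_eq_fintype_card] at h
  exact h

/-- A linear form that vanishes on the range takes the same value on the indicators of `x`, `f x`
and `g x`, because these differ by coboundaries. So the annihilator of the range embeds in the
functions invariant under both permutations, whose dimension is `orb f g`. -/
theorem card_le_finrank_range_recombine [Finite D] (f g : Equiv.Perm D) :
    Nat.card D ≤ Module.finrank (ZMod 2) (LinearMap.range (recombine f g)) + orb f g := by
  have : Fintype D := Fintype.ofFinite _
  set W := LinearMap.range (recombine f g) with hW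
  have hg : ∀ v, cobdry g v ∈ W := fun v =>
    ⟨(0, ⟨cobdry g v, v, rfl⟩), by simp [recombine]⟩
  -- The range contains `cobdry f v` composed with `g`, and the correction is the `g`-coboundary of
  -- `cobdry f v`.
  have hf : ∀ v, cobdry f v ∈ W := by
    intro v
    have h1 : (fun x => cobdry f v (g x)) ∈ W :=
      ⟨(⟨cobdry f v, v, rfl⟩, 0), by simp [recombine]; rfl⟩
    have h2 := W.sub_mem h1 (hg (cobdry f v))
    convert h2 using 1
    funext x
    simp
  have hann : Module.finrank (ZMod 2) W.dualAnnihilator ≤ orb f g := by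
    rw [orb, ← finrank_invariants]
    let T : W.dualAnnihilator →ₗ[ZMod 2] invariants (Relation.EqvGen.setoid (Step f g)) :=
      LinearMap.codRestrict _
        { toFun := fun l x => l.1 (Pi.single x 1)
          map_add' := fun a b => rfl
          map_smul' := fun a b => rfl }
        (by
          intro l x y hxy
          have key : ∀ k : Equiv.Perm D, (∀ v, cobdry k v ∈ W) →
              ∀ x, l.1 (Pi.single (k x) 1) = l.1 (Pi.single x 1) := by
            intro k hk x
            have h := (Submodule.mem_dualAnnihilator l.1).mp l.2 _ (hk (Pi.single (k x) 1))
            have e : cobdry k (Pi.single (k x) 1) = Pi.single x 1 - Pi.single (k x) 1 := by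
              funext y
              simp only [cobdry_apply, Pi.sub_apply, Pi.single_apply, k.injective.eq_iff]
            rw [e, map_sub, sub_eq_zero] at h
            exact h.symm
          exact eqvGen_invariant (v := fun x => l.1 (Pi.single x 1)) (key f hf) (key g hg) hxy)
    refine LinearMap.finrank_le_finrank_of_injective (f := T) ?_
    intro a b hab
    apply Subtype.ext
    apply LinearMap.pi_ext'
    intro x
    ext
    have h := congrFun (congrArg Subtype.val hab) x
    simpa using (show a.1 (Pi.single x 1) = b.1 (Pi.single x 1) from h)
  have h := Subspace.finrank_add_finrank_dualAnnihilator_eq W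
  rw [Module.finrank_fintype_fun_eq_card, ← Nat.card_eq_fintype_card] at h
  omega

theorem finrank_range_eq_add {K U V W : Type*} [Field K] [AddCommGroup U] [Module K U]
    [AddCommGroup V] [Module K V] [AddCommGroup W] [Module K W] [FiniteDimensional K V]
    (b : U →ₗ[K] V) (d : V →ₗ[K] W) :
    Module.finrank K (LinearMap.range b) = Module.finrank K (LinearMap.range (d ∘ₗ b)) +
      Module.finrank K ↥(LinearMap.ker d ⊓ LinearMap.range b) := by
  have h3 := LinearMap.finrank_range_add_finrank_ker (d ∘ₗ (LinearMap.range b).subtype)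
  rw [← h3, LinearMap.ker_comp, ← Submodule.finrank_map_subtype_eq (LinearMap.range b),
    Submodule.map_comap_subtype, inf_comm, LinearMap.range_comp, Submodule.range_subtype,
    LinearMap.range_comp]

/-- The first bound is from above, on all pairs of coboundaries that recombine to zero; the second
is from below, on those that come from a function. The second space lies in the first, which is the
genus inequality; when the two bounds meet, the spaces coincide. -/
theorem genus_aux [Finite D] (f g : Equiv.Perm D) :
    Module.finrank (ZMod 2) (LinearMap.ker (recombine f g)) + cyc f + cyc g ≤
      Nat.card D + orb f g ∧
    Nat.card D ≤ orb f g + (Nat.card D - cyc (f * g)) + Module.finrank (ZMod 2)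
      ↥(LinearMap.ker (recombine f g) ⊓ LinearMap.range (pairCobdry f g)) := by
  have : Fintype D := Fintype.ofFinite _
  have h1 := (recombine f g).finrank_range_add_finrank_ker
  rw [Module.finrank_prod] at h1
  have h2 := card_le_finrank_range_recombine f g
  have hf := finrank_range_cobdry f
  have hg := finrank_range_cobdry g
  have hfg := finrank_range_cobdry (f * g)
  have hp := finrank_range_pairCobdry f g
  refine ⟨by omega, ?_⟩
  have h3 := finrank_range_eq_add (pairCobdry f g) (recombine f g)
  have hr : recombine f g ∘ₗ pairCobdry f g = cobdry (f * g) :=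
    LinearMap.ext fun v => recombine_pairCobdry f g v
  rw [hr] at h3
  omega

/-- The genus of a pair of permutations is nonnegative. -/
theorem genus_le [Finite D] (f g : Equiv.Perm D) :
    cyc f + cyc g + cyc (f * g) ≤ Nat.card D + 2 * orb f g := by
  obtain ⟨h1, h2⟩ := genus_aux f g
  have h3 := Submodule.finrank_mono
    (inf_le_left : LinearMap.ker (recombine f g) ⊓ LinearMap.range (pairCobdry f g) ≤ _)
  have := finrank_range_cobdry (f * g)
  omega

/-- In genus zero, a pair of coboundaries that recombines to zero comes from a function. -/
theorem ker_recombine_le_range [Finite D] (f g : Equiv.Perm D)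
    (h : cyc f + cyc g + cyc (f * g) = Nat.card D + 2 * orb f g) :
    LinearMap.ker (recombine f g) ≤ LinearMap.range (pairCobdry f g) := by
  obtain ⟨h1, h2⟩ := genus_aux f g
  have h3 := finrank_range_cobdry (f * g)
  have := Submodule.eq_of_le_of_finrank_le
    (inf_le_left : LinearMap.ker (recombine f g) ⊓ LinearMap.range (pairCobdry f g) ≤ _)
    (by omega)
  exact inf_eq_left.mp this

/-- Ranks of coboundaries are subadditive, since those of `f * g` are recombinations. This bounds
from below the number of vertices of a glued map. -/
theorem cyc_add_cyc_le [Finite D] (f g : Equiv.Perm D) :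
    cyc f + cyc g ≤ cyc (f * g) + Nat.card D := by
  have h : LinearMap.range (cobdry (f * g)) ≤ LinearMap.range (recombine f g) := by
    rintro _ ⟨v, rfl⟩
    exact ⟨pairCobdry f g v, recombine_pairCobdry f g v⟩
  have h1 := Submodule.finrank_mono h
  have h2 := (recombine f g).finrank_range_le
  rw [Module.finrank_prod] at h2
  have := finrank_range_cobdry f
  have := finrank_range_cobdry g
  have := finrank_range_cobdry (f * g)
  omega

theorem cyc_inv (f : Equiv.Perm D) : cyc f⁻¹ = cyc f := by
  unfold cyc
  congr 2
  ext x y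
  exact Equiv.Perm.sameCycle_inv

theorem orb_eq_one [Nonempty D] (f g : Equiv.Perm D)
    (h : ∀ x y, Relation.EqvGen (Step f g) x y) : orb f g = 1 := by
  unfold orb
  have : Subsingleton (Quotient (Relation.EqvGen.setoid (Step f g))) :=
    ⟨fun a b => Quotient.inductionOn₂ a b fun x y => Quotient.sound (h x y)⟩
  have : Nonempty (Quotient (Relation.EqvGen.setoid (Step f g))) := ‹Nonempty D›.map (Quotient.mk _)
  exact Nat.card_of_subsingleton (Classical.arbitrary _)

/-- Upper bounds on numbers of cycles will come from the genus inequality, lower bounds from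
exhibiting an invariant with many values. -/
theorem card_le_cyc [Finite D] {Y : Type*} (f : Equiv.Perm D) (v : D → Y)
    (h : ∀ x, v (f x) = v x) (hs : Function.Surjective v) : Nat.card Y ≤ cyc f := by
  refine Nat.card_le_card_of_surjective
    (Quotient.lift v fun x y hxy => sameCycle_invariant h hxy) ?_
  intro y
  obtain ⟨x, rfl⟩ := hs y
  exact ⟨Quotient.mk _ x, rfl⟩

theorem card_eq_two_mul_cyc [Finite D] (f : Equiv.Perm D) (h : ∀ x, f (f x) = x)
    (hn : ∀ x, f x ≠ x) : Nat.card D = 2 * cyc f := by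
  have : Fintype (Quotient (Equiv.Perm.SameCycle.setoid f)) := Fintype.ofFinite _
  have : Fintype D := Fintype.ofFinite _
  have hs : ∀ x y, f.SameCycle x y ↔ y = x ∨ y = f x := by
    intro x y
    constructor
    · rintro hxy
      obtain ⟨n, rfl⟩ := hxy.exists_nat_pow_eq
      clear hxy
      induction n with
      | zero => simp
      | succ n ih =>
        rw [pow_succ', Equiv.Perm.mul_apply]
        rcases ih with ih | ih <;> simp [ih, h]
    · rintro (rfl | rfl)
      · exact Equiv.Perm.SameCycle.refl _ _
      · exact Equiv.Perm.sameCycle_apply_right.mpr (Equiv.Perm.SameCycle.refl _ _)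
  rw [cyc, Nat.card_eq_fintype_card, Nat.card_eq_fintype_card, ← Finset.card_univ,
    ← Finset.card_univ, mul_comm]
  rw [Finset.card_eq_sum_card_fiberwise (f := Quotient.mk (Equiv.Perm.SameCycle.setoid f))
    (t := Finset.univ) (by intro x _; simp)]
  rw [Finset.sum_const_nat (m := 2)]
  intro c _
  induction c using Quotient.inductionOn with
  | h x =>
    have : (Finset.univ.filter fun y => (Quotient.mk (Equiv.Perm.SameCycle.setoid f) y) =
        Quotient.mk _ x) = {x, f x} := by
      ext y
      simp only [Finset.mem_filter, Finset.mem_univ, true_and, Finset.mem_insert,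
        Finset.mem_singleton]
      rw [← hs, Quotient.eq]
      exact Equiv.Perm.sameCycle_comm
    rw [this, Finset.card_pair (hn x).symm]

/-- Splitting the classes of a setoid along a saturated subset. -/
theorem card_quotient_eq_add [Finite D] (r : Setoid D) (S : D → Prop)
    (hS : ∀ x y, r x y → (S x ↔ S y)) :
    Nat.card (Quotient r) = Nat.card (Quotient (r.comap (Subtype.val : {x // S x} → D))) +
      Nat.card (Quotient (r.comap (Subtype.val : {x // ¬ S x} → D))) := by
  rw [← Nat.card_sum]
  refine (Nat.card_congr (Equiv.ofBijective (fun z : _ ⊕ _ => Sum.elim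
    (Quotient.map' (s₁ := r.comap (Subtype.val : {x // S x} → D)) (s₂ := r) Subtype.val
      (fun _ _ h => h))
    (Quotient.map' (s₁ := r.comap (Subtype.val : {x // ¬ S x} → D)) (s₂ := r) Subtype.val
      (fun _ _ h => h)) z) ⟨?_, ?_⟩)).symm
  · rintro (a | a) (b | b) h <;>
      induction a using Quotient.inductionOn <;> induction b using Quotient.inductionOn <;>
      rename_i a b <;> have h' : r a.1 b.1 := Quotient.exact h
    · exact congrArg Sum.inl (Quotient.sound h')
    · exact absurd ((hS _ _ h').mp a.2) b.2
    · exact absurd ((hS _ _ h').mpr b.2) a.2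
    · exact congrArg Sum.inr (Quotient.sound h')
  · intro c
    induction c using Quotient.inductionOn with
    | h x =>
      by_cases hx : S x
      · exact ⟨Sum.inl (Quotient.mk _ ⟨x, hx⟩), rfl⟩
      · exact ⟨Sum.inr (Quotient.mk _ ⟨x, hx⟩), rfl⟩

theorem cyc_subtypePerm (f : Equiv.Perm D) (S : D → Prop) (h : ∀ x, S (f x) ↔ S x) :
    cyc (f.subtypePerm h) =
      Nat.card (Quotient ((Equiv.Perm.SameCycle.setoid f).comap
        (Subtype.val : {x // S x} → D))) := by
  unfold cyc
  congr 2
  ext x y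
  exact Equiv.Perm.sameCycle_subtypePerm

theorem cyc_eq_add [Finite D] (f : Equiv.Perm D) (S : D → Prop) (h : ∀ x, S (f x) ↔ S x) :
    cyc f = cyc (f.subtypePerm h) +
      cyc (f.subtypePerm (p := fun x => ¬ S x) (fun x => not_congr (h x))) := by
  rw [cyc_subtypePerm, cyc_subtypePerm]
  refine card_quotient_eq_add _ S fun x y hxy => ?_
  have := sameCycle_invariant (v := S) (fun x => propext (h x)) hxy
  rw [this]

theorem eqvGen_subtypePerm (f g : Equiv.Perm D) (S : D → Prop) (hf : ∀ x, S (f x) ↔ S x)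
    (hg : ∀ x, S (g x) ↔ S x) (x y : {x // S x}) :
    Relation.EqvGen (Step (f.subtypePerm hf) (g.subtypePerm hg)) x y ↔
      Relation.EqvGen (Step f g) x.1 y.1 := by
  constructor
  · intro h
    induction h with
    | rel x y h =>
      refine Relation.EqvGen.rel _ _ ?_
      rcases h with h | h
      · left; simp [h]
      · right; simp [h]
    | refl x => exact Relation.EqvGen.refl _
    | symm x y _ ih => exact ih.symm
    | trans x y z _ _ h1 h2 => exact h1.trans _ _ _ h2
  · have key : ∀ x y, Relation.EqvGen (Step f g) x y → ∀ (hx : S x) (hy : S y),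
        Relation.EqvGen (Step (f.subtypePerm hf) (g.subtypePerm hg)) ⟨x, hx⟩ ⟨y, hy⟩ := by
      intro x y h
      induction h with
      | rel x y h =>
        intro hx hy
        refine Relation.EqvGen.rel _ _ ?_
        rcases h with h | h
        · left; ext; simpa using h
        · right; ext; simpa using h
      | refl x => intro hx hy; exact Relation.EqvGen.refl _
      | symm x y _ ih => intro hx hy; exact (ih hy hx).symm _ _
      | trans x y z hxy _ ih1 ih2 =>
        intro hx hz
        have hy : S y := by
          have := eqvGen_invariant (v := S) (fun x => propext (hf x)) (fun x => propext (hg x)) hxy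
          rwa [← this]
        exact (ih1 hx hy).trans _ _ _ (ih2 hy hz)
    exact fun h => key _ _ h x.2 y.2

/-- Together with `cyc_eq_add`, this makes both sides of the genus inequality additive over
invariant subsets, so that equality for the whole forces equality for each piece. -/
theorem orb_eq_add [Finite D] (f g : Equiv.Perm D) (S : D → Prop) (hf : ∀ x, S (f x) ↔ S x)
    (hg : ∀ x, S (g x) ↔ S x) :
    orb f g = orb (f.subtypePerm hf) (g.subtypePerm hg) +
      orb (f.subtypePerm (p := fun x => ¬ S x) (fun x => not_congr (hf x)))
        (g.subtypePerm (p := fun x => ¬ S x) (fun x => not_congr (hg x))) := by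
  have key : ∀ (S : D → Prop) (hf : ∀ x, S (f x) ↔ S x) (hg : ∀ x, S (g x) ↔ S x),
      orb (f.subtypePerm hf) (g.subtypePerm hg) =
      Nat.card (Quotient ((Relation.EqvGen.setoid (Step f g)).comap
        (Subtype.val : {x // S x} → D))) := by
    intro S hf hg
    unfold orb
    congr 2
    ext x y
    exact eqvGen_subtypePerm f g S hf hg x y
  rw [key, key]
  refine card_quotient_eq_add _ S fun x y hxy => ?_
  have := eqvGen_invariant (v := S) (fun x => propext (hf x)) (fun x => propext (hg x)) hxy
  rw [this]

end Genus

/-! ### First returns and splitting -/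

section FirstReturnLemmas

variable {D : Type} [Finite D]

theorem firstReturn_of_not {f : Equiv.Perm D} {B : D → Prop} {x : D} (hx : ¬ B x) :
    firstReturn f B x = x := by
  simp [firstReturn, firstReturnFun, hx]

theorem firstReturn_spec (f : Equiv.Perm D) {B : D → Prop} {x : D} (hx : B x) :
    ∃ n : ℕ, 1 ≤ n ∧ firstReturn f B x = (f ^ n) x ∧ B ((f ^ n) x) ∧
      ∀ i, 1 ≤ i → i < n → ¬ B ((f ^ i) x) := by
  refine ⟨Nat.find (exists_return f B hx), (Nat.find_spec (exists_return f B hx)).1, ?_,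
    (Nat.find_spec (exists_return f B hx)).2, fun i h1 h2 h3 =>
      Nat.find_min (exists_return f B hx) h2 ⟨h1, h3⟩⟩
  simp [firstReturn, firstReturnFun, hx]

theorem firstReturn_eq {f : Equiv.Perm D} {B : D → Prop} {x : D} (hx : B x) {n : ℕ} (hn : 1 ≤ n)
    (hB : B ((f ^ n) x)) (h : ∀ i, 1 ≤ i → i < n → ¬ B ((f ^ i) x)) :
    firstReturn f B x = (f ^ n) x := by
  obtain ⟨k, hk, e, hkB, hmin⟩ := firstReturn_spec f hx
  rcases lt_trichotomy k n with hlt | rfl | hlt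
  · exact absurd hkB (h k hk hlt)
  · exact e
  · exact absurd hB (hmin n hn hlt)

theorem firstReturn_mem_iff (f : Equiv.Perm D) {B : D → Prop} (x : D) :
    B (firstReturn f B x) ↔ B x := by
  by_cases hx : B x
  · obtain ⟨n, _, e, hB, _⟩ := firstReturn_spec f hx
    rw [e]; exact iff_of_true hB hx
  · rw [firstReturn_of_not hx]

theorem sameCycle_firstReturn (f : Equiv.Perm D) (B : D → Prop) (x : D) :
    f.SameCycle x (firstReturn f B x) := by
  by_cases hx : B x
  · obtain ⟨n, _, e, _, _⟩ := firstReturn_spec f hx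
    rw [e]; exact ⟨n, by simp⟩
  · rw [firstReturn_of_not hx]

/-- The permutation `f` cut at the points of `B`. -/
theorem eq_of_sameCycle_cut {f : Equiv.Perm D} {B : D → Prop} {x y : D} (hx : B x) (hy : B y)
    (h : (firstReturn f⁻¹ B * f).SameCycle x y) : x = y := by
  set g := firstReturn f⁻¹ B * f with hg
  obtain ⟨n, hn, -, hB, hmin⟩ := firstReturn_spec f hx
  have key : ∀ i, i < n → (g ^ i) x = (f ^ i) x := by
    intro i
    induction i with
    | zero => intro _; rfl
    | succ i ih =>
      intro hi
      rw [pow_succ', Equiv.Perm.mul_apply, ih (by omega), pow_succ', Equiv.Perm.mul_apply,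
        firstReturn_of_not]
      · rfl
      rw [← Equiv.Perm.mul_apply, ← pow_succ']
      exact hmin _ (by omega) hi
  have inv : ∀ i, i ≤ n → (f⁻¹ ^ i) ((f ^ n) x) = (f ^ (n - i)) x := by
    intro i hi
    conv_lhs => rw [← Nat.add_sub_cancel' hi, pow_add, Equiv.Perm.mul_apply]
    rw [inv_pow]; exact Equiv.symm_apply_apply _ _
  -- On arrival at the next point of `B`, the backward first return leads to the previous one, which
  -- is `x`. The cycle of `x` is thus an arc of the old cycle with a single point of `B`.
  have ret : (g ^ n) x = x := by
    obtain ⟨k, rfl⟩ : ∃ k, n = k + 1 := ⟨n - 1, by omega⟩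
    rw [pow_succ', Equiv.Perm.mul_apply, key k (by omega), hg, Equiv.Perm.mul_apply,
      ← Equiv.Perm.mul_apply f, ← pow_succ', firstReturn_eq hB (n := k + 1) (by omega)]
    · rw [inv _ le_rfl]; simp
    · rw [inv _ le_rfl]; simpa using hx
    · intro i h1 h2
      rw [inv _ h2.le]
      exact hmin _ (by omega) (by omega)
  obtain ⟨k, rfl⟩ := h.exists_nat_pow_eq
  have hk : (g ^ k) x = (g ^ (k % n)) x := by
    conv_lhs => rw [← Nat.mod_add_div k n, pow_add, Equiv.Perm.mul_apply, pow_mul]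
    congr 1
    exact Function.IsFixedPt.perm_pow ret _
  have hlt : k % n < n := Nat.mod_lt _ (by omega)
  rw [hk] at hy ⊢
  rcases Nat.eq_zero_or_pos (k % n) with h0 | h0
  · rw [h0]; rfl
  · rw [key _ hlt] at hy
    exact absurd hy (hmin _ h0 hlt)

theorem sameCycle_of_sameCycle_cut {f : Equiv.Perm D} {B : D → Prop} {x y : D}
    (h : (firstReturn f⁻¹ B * f).SameCycle x y) : f.SameCycle x y := by
  have := sameCycle_invariant (v := fun z => f.SameCycle x z) (fun z => by
    rw [Equiv.Perm.mul_apply]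
    have h1 := Equiv.Perm.sameCycle_inv.mp (sameCycle_firstReturn f⁻¹ B (f z))
    refine propext ⟨fun h2 => ?_, fun h2 => ?_⟩
    · exact Equiv.Perm.sameCycle_apply_right.mp (h2.trans h1.symm)
    · exact (Equiv.Perm.sameCycle_apply_right.mpr h2).trans h1) h
  exact this.mp (Equiv.Perm.SameCycle.refl _ _)

/-- The cycles of `f` that miss `B` survive the cut, and each point of `B` acquires a cycle of its
own; the cycles of `f` that meet `B` are counted by the cycles of the first return on `B`. -/
theorem cyc_add_card_le_cut (f : Equiv.Perm D) (B : D → Prop) :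
    cyc f + Nat.card {x // B x} ≤ cyc (firstReturn f⁻¹ B * f) +
      cyc ((firstReturn f⁻¹ B).subtypePerm (firstReturn_mem_iff f⁻¹)) := by
  set g := firstReturn f⁻¹ B * f with hg
  set w := (firstReturn f⁻¹ B).subtypePerm (firstReturn_mem_iff (B := B) f⁻¹) with hw
  let Q := Quotient (Equiv.Perm.SameCycle.setoid f)
  let tch : Q → Prop := fun c => ∃ x, B x ∧ Quotient.mk _ x = c
  have h1 : Nat.card Q = Nat.card {c : Q // ¬ tch c} + Nat.card {c : Q // tch c} := by
    have := Fintype.ofFinite Q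
    rw [Nat.card_eq_fintype_card, Nat.card_eq_fintype_card, Nat.card_eq_fintype_card, add_comm]
    exact (Fintype.card_subtype_compl tch ▸ by
      have := Fintype.card_subtype_le tch
      omega)
  have h2 : Nat.card {c : Q // tch c} ≤ cyc w := by
    refine Nat.card_le_card_of_injective
      (fun c : {c : Q // tch c} => Quotient.mk (Equiv.Perm.SameCycle.setoid w)
        (⟨c.2.choose, c.2.choose_spec.1⟩ : {x // B x})) ?_
    intro c c' h
    have h' : w.SameCycle _ _ := Quotient.exact h
    rw [hw, Equiv.Perm.sameCycle_subtypePerm] at h'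
    apply Subtype.ext
    rw [← c.2.choose_spec.2, ← c'.2.choose_spec.2]
    refine Quotient.sound (s := Equiv.Perm.SameCycle.setoid f) ?_
    have := sameCycle_invariant (v := fun z => f.SameCycle c.2.choose z) (fun z => by
      have h1 := Equiv.Perm.sameCycle_inv.mp (sameCycle_firstReturn f⁻¹ B z)
      exact propext ⟨fun h2 => h2.trans h1.symm, fun h2 => h2.trans h1⟩) h'
    exact this.mp (Equiv.Perm.SameCycle.refl _ _)
  have h3 : Nat.card {c : Q // ¬ tch c} + Nat.card {x // B x} ≤ cyc g := by
    rw [← Nat.card_sum]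
    refine Nat.card_le_card_of_injective (fun z => Sum.elim
      (fun c : {c : Q // ¬ tch c} => Quotient.mk (Equiv.Perm.SameCycle.setoid g) c.1.out)
      (fun x : {x // B x} => Quotient.mk (Equiv.Perm.SameCycle.setoid g) x.1) z) ?_
    rintro (a | a) (b | b) h <;> have h' : g.SameCycle _ _ := Quotient.exact h
    · congr 1
      apply Subtype.ext
      rw [← Quotient.out_eq a.1, ← Quotient.out_eq b.1]
      exact Quotient.sound (s := Equiv.Perm.SameCycle.setoid f) (sameCycle_of_sameCycle_cut h')
    · refine absurd ⟨b.1, b.2, ?_⟩ a.2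
      rw [← Quotient.out_eq a.1]
      exact Quotient.sound (s := Equiv.Perm.SameCycle.setoid f)
        (sameCycle_of_sameCycle_cut h').symm
    · refine absurd ⟨a.1, a.2, ?_⟩ b.2
      rw [← Quotient.out_eq b.1]
      exact Quotient.sound (s := Equiv.Perm.SameCycle.setoid f) (sameCycle_of_sameCycle_cut h')
    · congr 1
      exact Subtype.ext (eq_of_sameCycle_cut a.2 b.2 h')
  have h4 : cyc f = Nat.card Q := rfl
  omega

theorem card_sameCycle (f : Equiv.Perm D) (x : D) :
    Nat.card {y // f.SameCycle x y} = Function.minimalPeriod f x := by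
  have hpos : 0 < Function.minimalPeriod f x :=
    Function.IsPeriodicPt.minimalPeriod_pos (isOfFinOrder_of_finite f).orderOf_pos (by
      rw [Function.IsPeriodicPt, Function.IsFixedPt, ← Equiv.Perm.coe_pow, pow_orderOf_eq_one]; rfl)
  rw [← Nat.card_fin (Function.minimalPeriod f x)]
  refine (Nat.card_congr (Equiv.ofBijective (fun i : Fin (Function.minimalPeriod f x) =>
    (⟨(f ^ (i : ℕ)) x, ⟨(i : ℕ), by simp⟩⟩ : {y // f.SameCycle x y})) ⟨?_, ?_⟩)).symm
  · intro i j h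
    have h' : (f ^ (i : ℕ)) x = (f ^ (j : ℕ)) x := congrArg Subtype.val h
    rw [Equiv.Perm.coe_pow, Equiv.Perm.coe_pow] at h'
    exact Fin.ext (Function.iterate_injOn_Iio_minimalPeriod i.2 j.2 h')
  · rintro ⟨y, hy⟩
    obtain ⟨n, rfl⟩ := hy.exists_nat_pow_eq
    refine ⟨⟨n % Function.minimalPeriod f x, Nat.mod_lt _ hpos⟩, Subtype.ext ?_⟩
    simp only [Equiv.Perm.coe_pow]
    rw [Function.iterate_mod_minimalPeriod_eq]

end FirstReturnLemmas

/-! ### Splitting a planar map: Euler count, planarity and simplicity of the components -/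

namespace CMap

variable {D : Type}

theorem face_eq_face (m : CMap D) (d d' : D) : m.face d = m.face d' ↔ m.φ.SameCycle d d' :=
  Quotient.eq

theorem origin_eq_origin (m : CMap D) (d d' : D) :
    m.origin d = m.origin d' ↔ m.σ.SameCycle d d' := Quotient.eq

theorem isBoundary_iff (m : CMap D) (d : D) : m.IsBoundary d ↔ m.φ.SameCycle d m.root :=
  m.face_eq_face d m.root

theorem isBoundary_root (m : CMap D) : m.IsBoundary m.root := rfl

theorem isBoundary_φ (m : CMap D) (d : D) : m.IsBoundary (m.φ d) ↔ m.IsBoundary d := by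
  rw [isBoundary_iff, isBoundary_iff, Equiv.Perm.sameCycle_apply_left]

theorem card_eq_cyc_α [Finite D] (m : CMap D) : Nat.card D = 2 * cyc m.α :=
  card_eq_two_mul_cyc m.α m.involutive m.ne_self

theorem orb_eq_one (m : CMap D) : orb m.σ m.α = 1 :=
  have : Nonempty D := ⟨m.root⟩
  BoltzmannMap.orb_eq_one _ _ m.connected

theorem isPlanar_iff [Finite D] (m : CMap D) :
    m.IsPlanar ↔ cyc m.σ + cyc m.α + cyc m.φ = Nat.card D + 2 := by
  have h1 := m.card_eq_cyc_α
  have h2 : m.IsPlanar ↔ 2 * (cyc m.σ + cyc m.φ) = Nat.card D + 4 := Iff.rfl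
  rw [h2]
  omega

theorem euler_le [Finite D] (m : CMap D) :
    cyc m.σ + cyc m.α + cyc m.φ ≤ Nat.card D + 2 := by
  have := genus_le m.σ m.α
  rw [m.orb_eq_one] at this
  exact this

theorem card_eq_sum_deg [Finite D] (m : CMap D) : Nat.card D = ∑ f : m.Face, m.deg f := by
  have : Fintype D := Fintype.ofFinite _
  rw [Nat.card_eq_fintype_card, ← Finset.card_univ,
    Finset.card_eq_sum_card_fiberwise (f := m.face) (t := Finset.univ) (by intro x _; simp)]
  refine Finset.sum_congr rfl fun f _ => ?_
  rw [deg, Nat.card_eq_fintype_card, Fintype.card_subtype]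

/-- The face permutation on the boundary. -/
def bdryφ (m : CMap D) : Equiv.Perm {d // m.IsBoundary d} := m.φ.subtypePerm m.isBoundary_φ

theorem sameCycle_bdryφ (m : CMap D) (x y : {d // m.IsBoundary d}) : m.bdryφ.SameCycle x y := by
  rw [bdryφ, Equiv.Perm.sameCycle_subtypePerm]
  exact ((m.isBoundary_iff _).mp x.2).trans ((m.isBoundary_iff _).mp y.2).symm

theorem cyc_bdryφ (m : CMap D) : cyc m.bdryφ = 1 := by
  unfold cyc
  have : Subsingleton (Quotient (Equiv.Perm.SameCycle.setoid m.bdryφ)) :=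
    ⟨fun a b => Quotient.inductionOn₂ a b fun x y => Quotient.sound (m.sameCycle_bdryφ x y)⟩
  have : Nonempty (Quotient (Equiv.Perm.SameCycle.setoid m.bdryφ)) :=
    ⟨Quotient.mk _ ⟨m.root, m.isBoundary_root⟩⟩
  exact Nat.card_of_subsingleton (Classical.arbitrary _)

variable [Finite D]

theorem isBoundary_cw (m : CMap D) (d : D) : m.IsBoundary (m.cw d) ↔ m.IsBoundary d :=
  firstReturn_mem_iff _ d

theorem cw_of_not (m : CMap D) {d : D} (h : ¬ m.IsBoundary d) : m.cw d = d :=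
  firstReturn_of_not h

theorem splitφ_apply (m : CMap D) (d : D) : m.splitφ d = m.cw (m.φ d) := rfl

theorem isBoundary_splitφ (m : CMap D) (d : D) : m.IsBoundary (m.splitφ d) ↔ m.IsBoundary d := by
  rw [splitφ_apply, isBoundary_cw, isBoundary_φ]

theorem splitφ_of_not (m : CMap D) {d : D} (h : ¬ m.IsBoundary d) : m.splitφ d = m.φ d := by
  rw [splitφ_apply, cw_of_not]
  rwa [isBoundary_φ]

/-- The rotation of the boundary darts around the vertices. -/
def bdryCw (m : CMap D) : Equiv.Perm {d // m.IsBoundary d} := m.cw.subtypePerm m.isBoundary_cw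

/-- The contours of the irreducible components. -/
def bdrySplit (m : CMap D) : Equiv.Perm {d // m.IsBoundary d} :=
  m.splitφ.subtypePerm m.isBoundary_splitφ

theorem bdrySplit_eq (m : CMap D) : m.bdrySplit = m.bdryCw * m.bdryφ := rfl

theorem eqvGen_of_sameCycle {f g : Equiv.Perm D} {x y : D} (h : g.SameCycle x y) :
    Relation.EqvGen (Step f g) x y := by
  have := sameCycle_invariant (v := fun z => Relation.EqvGen (Step f g) x z) (fun z => by
    have h1 : Relation.EqvGen (Step f g) z (g z) := Relation.EqvGen.rel _ _ (Or.inr rfl)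
    exact propext ⟨fun h2 => h2.trans _ _ _ (h1.symm _ _), fun h2 => h2.trans _ _ _ h1⟩) h
  exact this.mp (Relation.EqvGen.refl _)

theorem orb_bdry (m : CMap D) : orb m.bdryCw m.bdryφ = 1 :=
  have : Nonempty {d // m.IsBoundary d} := ⟨⟨m.root, m.isBoundary_root⟩⟩
  BoltzmannMap.orb_eq_one _ _ fun x y => eqvGen_of_sameCycle (m.sameCycle_bdryφ x y)

theorem sameComponent_of_sameCycle (m : CMap D) {x y : D} (h : m.splitφ.SameCycle x y) :
    m.SameComponent x y := by
  have := sameCycle_invariant (v := fun z => m.SameComponent x z) (fun z => by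
    refine propext ?_
    rw [splitφ, Equiv.Perm.mul_apply, sameComponent_splitσ, sameComponent_α]) h
  exact this.mp (Relation.EqvGen.refl _)

/-- The property is carried from the root to every dart by `σ` and `α`. The split rotation differs
from `σ` only when `σ x` is a boundary dart; then `splitσ x` is also one, and it lies in the
component of `x`. -/
theorem exists_isBoundary_sameComponent (m : CMap D) (d : D) :
    ∃ b, m.IsBoundary b ∧ m.SameComponent b d := by
  have key := eqvGen_invariant (v := fun d => ∃ b, m.IsBoundary b ∧ m.SameComponent b d)
    (f := m.σ) (g := m.α) (fun x => ?_) (fun x => ?_) (m.connected m.root d)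
  · exact key.mp ⟨m.root, m.isBoundary_root, Relation.EqvGen.refl _⟩
  · refine propext ?_
    by_cases hx : m.IsBoundary (m.σ x)
    · refine iff_of_true ⟨_, hx, Relation.EqvGen.refl _⟩
        ⟨m.splitσ x, (m.isBoundary_cw _).mpr hx, ?_⟩
      exact (m.sameComponent_splitσ _ _).mp (Relation.EqvGen.refl _)
    · have : m.splitσ x = m.σ x := m.cw_of_not hx
      simp only [← this, sameComponent_splitσ]
  · refine propext ?_
    simp only [sameComponent_α]

/-- Internal faces are untouched by the splitting, and the root face is replaced by the contours. -/
theorem cyc_splitφ (m : CMap D) : cyc m.splitφ + 1 = cyc m.φ + cyc m.bdrySplit := by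
  have h1 := cyc_eq_add m.splitφ m.IsBoundary m.isBoundary_splitφ
  have h2 := cyc_eq_add m.φ m.IsBoundary m.isBoundary_φ
  have h3 : m.splitφ.subtypePerm (p := fun x => ¬ m.IsBoundary x)
      (fun x => not_congr (m.isBoundary_splitφ x)) =
      m.φ.subtypePerm (p := fun x => ¬ m.IsBoundary x) (fun x => not_congr (m.isBoundary_φ x)) := by
    ext x
    exact m.splitφ_of_not x.2
  have h4 := m.cyc_bdryφ
  rw [h3] at h1
  unfold bdryφ at h4
  unfold bdrySplit
  omega

/-- The counting behind the tree of components. -/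
theorem planar_split (m : CMap D) (hm : m.IsPlanar) :
    (cyc m.bdryCw + cyc m.bdrySplit = Nat.card {d // m.IsBoundary d} + 1) ∧
    (∀ b b', m.IsBoundary b → m.IsBoundary b' → m.SameComponent b b' →
      m.splitφ.SameCycle b b') ∧
    cyc m.splitσ + cyc m.α + cyc m.splitφ = Nat.card D + 2 * orb m.splitσ m.α := by
  rw [isPlanar_iff] at hm
  have h1 : cyc m.σ + Nat.card {d // m.IsBoundary d} ≤ cyc m.splitσ + cyc m.bdryCw :=
    cyc_add_card_le_cut m.σ m.IsBoundary
  have h2 := m.cyc_splitφ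
  have h3 : cyc m.splitσ + cyc m.α + cyc m.splitφ ≤ Nat.card D + 2 * orb m.splitσ m.α :=
    genus_le m.splitσ m.α
  have h4 := genus_le m.bdryCw m.bdryφ
  rw [← bdrySplit_eq, cyc_bdryφ, orb_bdry] at h4
  let T : Quotient (Equiv.Perm.SameCycle.setoid m.bdrySplit) →
      Quotient (Relation.EqvGen.setoid (Step m.splitσ m.α)) :=
    Quotient.map' (fun x => x.1) (fun x y h =>
      m.sameComponent_of_sameCycle (Equiv.Perm.sameCycle_subtypePerm.mp h))
  have hT : Function.Surjective T := by
    intro c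
    induction c using Quotient.inductionOn with
    | h d =>
      obtain ⟨b, hb, hbd⟩ := m.exists_isBoundary_sameComponent d
      exact ⟨Quotient.mk _ ⟨b, hb⟩, Quotient.sound (s := Relation.EqvGen.setoid _) hbd⟩
  have h5 : orb m.splitσ m.α ≤ cyc m.bdrySplit := Nat.card_le_card_of_surjective T hT
  -- Chaining Euler's formula with `h1` to `h5` gives `Nat.card D + 2 ≤ Nat.card D + 2`, so all of
  -- them are equalities. Equality in `h4` says that the incidence graph is a tree, in `h5` that
  -- each component has one contour, in `h3` that the split map has genus zero.
  refine ⟨by omega, ?_, by omega⟩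
  have hTi : Function.Injective T := (hT.bijective_of_nat_card_le (by
    change cyc m.bdrySplit ≤ orb m.splitσ m.α
    omega)).1
  intro b b' hb hb' h
  have h6 := @hTi (Quotient.mk _ ⟨b, hb⟩) (Quotient.mk _ ⟨b', hb'⟩)
    (Quotient.sound (s := Relation.EqvGen.setoid _) h)
  exact Equiv.Perm.sameCycle_subtypePerm.mp (Quotient.exact h6)

/-- The split map attains equality in the genus inequality. This equality is the sum of the
inequality for the component and the one for its complement, so both are sharp. -/
theorem component_isPlanar (m : CMap D) (hm : m.IsPlanar) (e : D) : (m.component e).IsPlanar := by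
  rw [isPlanar_iff]
  obtain ⟨-, -, h⟩ := m.planar_split hm
  have hφ : ∀ x, m.SameComponent e (m.splitφ x) ↔ m.SameComponent e x := fun x => by
    rw [splitφ, Equiv.Perm.mul_apply, sameComponent_splitσ, sameComponent_α]
  have h1 := cyc_eq_add m.splitσ _ (m.sameComponent_splitσ e)
  have h2 := cyc_eq_add m.α _ (m.sameComponent_α e)
  have h3 := cyc_eq_add m.splitφ _ hφ
  have h4 := orb_eq_add m.splitσ m.α _ (m.sameComponent_splitσ e) (m.sameComponent_α e)
  have h5 := (m.component e).orb_eq_one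
  have h6 := (m.component e).euler_le
  have h7 := genus_le
    (m.splitσ.subtypePerm (p := fun x => ¬ m.SameComponent e x)
      (fun x => not_congr (m.sameComponent_splitσ e x)))
    (m.α.subtypePerm (p := fun x => ¬ m.SameComponent e x)
      (fun x => not_congr (m.sameComponent_α e x)))
  have h8 : m.splitσ.subtypePerm (p := fun x => ¬ m.SameComponent e x)
      (fun x => not_congr (m.sameComponent_splitσ e x)) *
      m.α.subtypePerm (p := fun x => ¬ m.SameComponent e x)
      (fun x => not_congr (m.sameComponent_α e x)) =
      m.splitφ.subtypePerm (p := fun x => ¬ m.SameComponent e x)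
      (fun x => not_congr (hφ x)) := rfl
  have h9 : (m.component e).φ = m.splitφ.subtypePerm hφ := rfl
  have h10 : Nat.card D = Nat.card {d // m.SameComponent e d} +
      Nat.card {d // ¬ m.SameComponent e d} := by
    rw [← Nat.card_sum]
    exact Nat.card_congr (Equiv.sumCompl _).symm
  rw [h8] at h7
  rw [h9] at h6 ⊢
  change orb (m.splitσ.subtypePerm (m.sameComponent_splitσ e))
    (m.α.subtypePerm (m.sameComponent_α e)) = 1 at h5
  change cyc (m.splitσ.subtypePerm (m.sameComponent_splitσ e)) +
    cyc (m.α.subtypePerm (m.sameComponent_α e)) + _ ≤ _ at h6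
  change cyc (m.splitσ.subtypePerm (m.sameComponent_splitσ e)) +
    cyc (m.α.subtypePerm (m.sameComponent_α e)) + _ = _
  omega

theorem component_φ_sameCycle (m : CMap D) (e : D) (x y : {d // m.SameComponent e d}) :
    (m.component e).φ.SameCycle x y ↔ m.splitφ.SameCycle x.1 y.1 :=
  Equiv.Perm.sameCycle_subtypePerm (f := m.splitφ) (h := fun x => by
    rw [splitφ, Equiv.Perm.mul_apply, sameComponent_splitσ, sameComponent_α])

/-- Planarity excludes a component with several contours; the root face of the component therefore
takes all its boundary darts. -/
theorem component_isBoundary (m : CMap D) (hm : m.IsPlanar) {e : D} (he : m.IsBoundary e)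
    (x : {d // m.SameComponent e d}) : (m.component e).IsBoundary x ↔ m.IsBoundary x.1 := by
  rw [isBoundary_iff, component_φ_sameCycle]
  change m.splitφ.SameCycle x.1 e ↔ _
  constructor
  · intro h
    exact (iff_of_eq (sameCycle_invariant (v := m.IsBoundary)
      (fun z => propext (m.isBoundary_splitφ z)) h)).mpr he
  · intro h
    exact ((m.planar_split hm).2.1 _ _ he h x.2).symm

theorem component_hasSimpleBoundary (m : CMap D) (hm : m.IsPlanar) {e : D} (he : m.IsBoundary e) :
    (m.component e).HasSimpleBoundary := by
  intro d d' hd hd' h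
  rw [component_isBoundary m hm he] at hd hd'
  rw [origin_eq_origin] at h
  have h' : m.splitσ.SameCycle d.1 d'.1 :=
    (Equiv.Perm.sameCycle_subtypePerm (h := m.sameComponent_splitσ e)).mp h
  exact Subtype.ext (eq_of_sameCycle_cut hd hd' h')

theorem component_perimeter (m : CMap D) (e : D) :
    (m.component e).perimeter = Function.minimalPeriod m.splitφ e := by
  rw [← card_sameCycle]
  refine Nat.card_congr ⟨fun x => ⟨x.1.1, ?_⟩,
    fun y => ⟨⟨y.1, m.sameComponent_of_sameCycle y.2⟩, ?_⟩, fun x => rfl, fun y => rfl⟩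
  · exact ((component_φ_sameCycle m e _ _).mp (Quotient.exact x.2)).symm
  · exact Quotient.sound (s := Equiv.Perm.SameCycle.setoid _)
      ((component_φ_sameCycle m e _ _).mpr y.2.symm)

theorem sameCycle_splitφ_iff (m : CMap D) {x : D} (hx : ¬ m.IsBoundary x) (y : D) :
    m.splitφ.SameCycle x y ↔ m.φ.SameCycle x y := by
  have h1 : m.splitφ.subtypePerm (p := fun x => ¬ m.IsBoundary x)
      (fun x => not_congr (m.isBoundary_splitφ x)) =
      m.φ.subtypePerm (p := fun x => ¬ m.IsBoundary x)
        (fun x => not_congr (m.isBoundary_φ x)) := by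
    ext x
    exact m.splitφ_of_not x.2
  by_cases hy : m.IsBoundary y
  · refine iff_of_false (fun h => hx ?_) (fun h => hx ?_)
    · exact (iff_of_eq (sameCycle_invariant (v := m.IsBoundary)
        (fun z => propext (m.isBoundary_splitφ z)) h)).mpr hy
    · exact (iff_of_eq (sameCycle_invariant (v := m.IsBoundary)
        (fun z => propext (m.isBoundary_φ z)) h)).mpr hy
  · have h2 := Equiv.Perm.sameCycle_subtypePerm (p := fun x => ¬ m.IsBoundary x)
      (f := m.splitφ) (h := fun x => not_congr (m.isBoundary_splitφ x))
      (x := ⟨x, hx⟩) (y := ⟨y, hy⟩)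
    have h3 := Equiv.Perm.sameCycle_subtypePerm (p := fun x => ¬ m.IsBoundary x)
      (f := m.φ) (h := fun x => not_congr (m.isBoundary_φ x))
      (x := ⟨x, hx⟩) (y := ⟨y, hy⟩)
    rw [h1] at h2
    exact h2.symm.trans h3

/-- Internal faces of the component are faces of the map, hence even. The degree of the root face is
then even because the degrees add up to the number of darts, which is twice the number of edges. -/
theorem component_isBipartite (m : CMap D) (hm : m.IsPlanar) (hb : m.IsBipartite) {e : D}
    (he : m.IsBoundary e) : (m.component e).IsBipartite := by
  have key : ∀ f : (m.component e).Face, f ≠ (m.component e).rootFace →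
      Even ((m.component e).deg f) := by
    intro f
    induction f using Quotient.inductionOn with
    | h x =>
      intro hx
      have hx' : ¬ m.IsBoundary x.1 := fun h => hx ((component_isBoundary m hm he x).mpr h)
      have hs := m.sameCycle_splitφ_iff hx'
      have : (m.component e).deg (Quotient.mk _ x) = m.deg (m.face x.1) := by
        refine Nat.card_congr ⟨fun y => ⟨y.1.1, ?_⟩, fun y => ⟨⟨y.1, ?_⟩, ?_⟩, fun x => rfl,
          fun y => rfl⟩
        · exact (m.face_eq_face _ _).mpr ((hs _).mp ((component_φ_sameCycle m e _ _).mp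
            (Quotient.exact y.2)).symm).symm
        · exact x.2.trans _ _ _ (m.sameComponent_of_sameCycle
            ((hs _).mpr ((m.face_eq_face _ _).mp y.2).symm))
        · exact Quotient.sound (s := Equiv.Perm.SameCycle.setoid _)
            ((component_φ_sameCycle m e _ _).mpr
              ((hs _).mpr ((m.face_eq_face _ _).mp y.2).symm).symm)
      rw [this]
      exact hb _
  intro f
  by_cases hf : f = (m.component e).rootFace
  · subst hf
    have h1 := (m.component e).card_eq_sum_deg
    rw [(m.component e).card_eq_cyc_α,
      ← Finset.add_sum_erase _ _ (Finset.mem_univ (m.component e).rootFace)] at h1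
    have h2 : Even (∑ f ∈ Finset.univ.erase (m.component e).rootFace, (m.component e).deg f) :=
      Finset.even_sum _ fun f hf => key f (Finset.ne_of_mem_erase hf)
    have h3 : Even (2 * cyc (m.component e).α) := even_two_mul _
    rw [h1] at h3
    exact (Nat.even_add.mp h3).mpr h2
  · exact key f hf

end CMap

/-! ### Levels in a pair of permutations of genus zero with a single face -/

section Levels

variable {X : Type}

/-- The vertices of the bipartite graph whose edges are the elements of `X`. -/
abbrev CycleVertex (rot : Bool → Equiv.Perm X) : Type :=
  Σ c : Bool, Quotient (Equiv.Perm.SameCycle.setoid (rot c))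

def cycleVertex (rot : Bool → Equiv.Perm X) (c : Bool) (x : X) : CycleVertex rot :=
  ⟨c, Quotient.mk _ x⟩

theorem cycleVertex_eq {rot : Bool → Equiv.Perm X} {c : Bool} {x y : X} :
    cycleVertex rot c x = cycleVertex rot c y ↔ (rot c).SameCycle x y := by
  simp only [cycleVertex, Sigma.mk.injEq, heq_eq_eq, true_and]
  exact Quotient.eq

/-- The bipartite graph of incidence of the cycles of two permutations. -/
def cycleGraph (rot : Bool → Equiv.Perm X) : SimpleGraph (CycleVertex rot) :=
  SimpleGraph.fromRel fun u v => ∃ x, u = cycleVertex rot false x ∧ v = cycleVertex rot true x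

theorem cycleGraph_adj (rot : Bool → Equiv.Perm X) (c : Bool) (x : X) :
    (cycleGraph rot).Adj (cycleVertex rot c x) (cycleVertex rot (!c) x) := by
  rw [cycleGraph, SimpleGraph.fromRel_adj]
  cases c
  · exact ⟨by simp [cycleVertex], Or.inl ⟨x, rfl, rfl⟩⟩
  · exact ⟨by simp [cycleVertex], Or.inr ⟨x, rfl, rfl⟩⟩

theorem exists_of_cycleGraph_adj {rot : Bool → Equiv.Perm X} {u v : CycleVertex rot}
    (h : (cycleGraph rot).Adj u v) :
    ∃ c x, u = cycleVertex rot c x ∧ v = cycleVertex rot (!c) x := by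
  rw [cycleGraph, SimpleGraph.fromRel_adj] at h
  obtain ⟨-, ⟨x, h1, h2⟩ | ⟨x, h1, h2⟩⟩ := h
  · exact ⟨false, x, h1, h2⟩
  · exact ⟨true, x, h2, h1⟩

theorem cycleGraph_connected (rot : Bool → Equiv.Perm X) (r : X)
    (h : ∀ x y, Relation.EqvGen (Step (rot false) (rot true)) x y) :
    (cycleGraph rot).Connected := by
  have key : ∀ x, (cycleGraph rot).Reachable (cycleVertex rot false r) (cycleVertex rot false x) := by
    intro x
    have := eqvGen_invariant (v := fun x => (cycleGraph rot).Reachable (cycleVertex rot false r)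
      (cycleVertex rot false x)) (fun x => ?_) (fun x => ?_) (h r x)
    · exact this.mp (SimpleGraph.Reachable.refl _)
    · have : cycleVertex rot false (rot false x) = cycleVertex rot false x :=
        cycleVertex_eq.mpr (Equiv.Perm.sameCycle_apply_left.mpr (Equiv.Perm.SameCycle.refl _ _))
      simp only [this]
    · have h1 : cycleVertex rot true (rot true x) = cycleVertex rot true x :=
        cycleVertex_eq.mpr (Equiv.Perm.sameCycle_apply_left.mpr (Equiv.Perm.SameCycle.refl _ _))
      have h2 := (cycleGraph_adj rot false x).reachable
      have h3 := (cycleGraph_adj rot false (rot true x)).reachable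
      simp only [Bool.not_false, h1] at h2 h3
      exact propext ⟨fun h => h.trans (h3.trans h2.symm), fun h => h.trans (h2.trans h3.symm)⟩
  have key2 : ∀ v, (cycleGraph rot).Reachable (cycleVertex rot false r) v := by
    rintro ⟨c, q⟩
    induction q using Quotient.inductionOn with
    | h x =>
      cases c
      · exact key x
      · exact (key x).trans (cycleGraph_adj rot false x).reachable
  exact { preconnected := fun u v => (key2 u).symm.trans (key2 v)
          nonempty := ⟨cycleVertex rot false r⟩ }

/-- The distance in the graph of cycles. -/
def level (rot : Bool → Equiv.Perm X) (r : X) (c : Bool) (x : X) : ℕ :=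
  (cycleGraph rot).dist (cycleVertex rot false r) (cycleVertex rot c x)

/-- The witness is the first edge of a geodesic towards the root. -/
theorem exists_parent (rot : Bool → Equiv.Perm X) (r : X)
    (h : ∀ x y, Relation.EqvGen (Step (rot false) (rot true)) x y) (v : CycleVertex rot)
    (hv : v ≠ cycleVertex rot false r) :
    ∃ c x, v = cycleVertex rot c x ∧ level rot r c x = level rot r (!c) x + 1 := by
  have hc := cycleGraph_connected rot r h
  obtain ⟨p, hp⟩ := hc.exists_walk_length_eq_dist v (cycleVertex rot false r)
  cases p with
  | nil => exact absurd rfl hv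
  | cons hadj q =>
    obtain ⟨c, x, rfl, rfl⟩ := exists_of_cycleGraph_adj hadj
    refine ⟨c, x, rfl, ?_⟩
    have h1 := SimpleGraph.dist_le q
    rw [SimpleGraph.Walk.length_cons] at hp
    have h2 := hc.dist_triangle (u := cycleVertex rot c x) (v := cycleVertex rot (!c) x)
      (w := cycleVertex rot false r)
    have h3 : (cycleGraph rot).dist (cycleVertex rot c x) (cycleVertex rot (!c) x) = 1 :=
      SimpleGraph.dist_eq_one_iff_adj.mpr (cycleGraph_adj rot c x)
    rw [level, level, SimpleGraph.dist_comm, SimpleGraph.dist_comm (v := cycleVertex rot (!c) x)]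
    omega

/-- The graph of cycles is connected with one more vertex than there are elements of `X`, so it is a
tree. Concretely, sending a cycle other than the root to an edge towards its parent is injective,
hence bijective by counting: every edge is the parent edge of exactly one cycle. -/
theorem level_tree [Finite X] (rot : Bool → Equiv.Perm X) (r : X)
    (h : ∀ x y, Relation.EqvGen (Step (rot false) (rot true)) x y)
    (hcard : cyc (rot false) + cyc (rot true) = Nat.card X + 1) :
    (∀ x, ∃ c, level rot r c x = level rot r (!c) x + 1) ∧
    (∀ c x y, level rot r c x = level rot r (!c) x + 1 → level rot r c y = level rot r (!c) y + 1 →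
      (rot c).SameCycle x y → x = y) := by
  have : Nonempty X := ⟨r⟩
  choose! pc px hp1 hp2 using exists_parent rot r h
  -- One edge cannot lead to the parent from both ends, as each end would have to be farther from
  -- the root than the other.
  have hinj : Function.Injective
      (fun v : {v : CycleVertex rot // v ≠ cycleVertex rot false r} => px v.1) := by
    rintro ⟨v, hv⟩ ⟨v', hv'⟩ he
    change px v = px v' at he
    have e1 := hp1 v hv
    have e2 := hp1 v' hv'
    have f1 := hp2 v hv
    have f2 := hp2 v' hv'
    rw [← he] at e2 f2
    have : pc v = pc v' := by
      by_contra hne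
      have : pc v' = !pc v := Bool.eq_not_iff.mpr (Ne.symm hne)
      rw [this] at f2
      simp only [Bool.not_not] at f2
      omega
    exact Subtype.ext (e1.trans (by rw [this]; exact e2.symm))
  have hcv : Nat.card (CycleVertex rot) = Nat.card X + 1 := by
    have := fun c => Fintype.ofFinite (Quotient (Equiv.Perm.SameCycle.setoid (rot c)))
    rw [Nat.card_sigma, Fintype.sum_bool, ← hcard, add_comm]
    rfl
  have hcard' : Nat.card {v : CycleVertex rot // v ≠ cycleVertex rot false r} = Nat.card X := by
    have := Fintype.ofFinite (CycleVertex rot)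
    rw [Nat.card_eq_fintype_card] at hcv ⊢
    have h1 := Fintype.card_subtype_compl (fun v => v = cycleVertex rot false r)
    rw [Fintype.card_subtype_eq] at h1
    have h2 : Fintype.card {v : CycleVertex rot // v ≠ cycleVertex rot false r} =
      Fintype.card {v : CycleVertex rot // ¬ v = cycleVertex rot false r} := rfl
    omega
  have hbij := hinj.bijective_of_nat_card_le hcard'.ge
  refine ⟨fun x => ?_, fun c x y hx hy hxy => ?_⟩
  · obtain ⟨v, rfl⟩ := hbij.2 x
    exact ⟨_, hp2 v.1 v.2⟩
  · have key : ∀ x, level rot r c x = level rot r (!c) x + 1 →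
        ∃ hv : cycleVertex rot c x ≠ cycleVertex rot false r, px (cycleVertex rot c x) = x := by
      intro x hx
      have hv : cycleVertex rot c x ≠ cycleVertex rot false r := by
        intro he
        have : level rot r c x = 0 := by rw [level, he, SimpleGraph.dist_self]
        omega
      refine ⟨hv, ?_⟩
      obtain ⟨⟨v, hv'⟩, e⟩ := hbij.2 x
      change px v = x at e
      have e1 := hp1 v hv'
      have e2 := hp2 v hv'
      rw [e] at e1 e2
      have : pc v = c := by
        by_contra hne
        have : pc v = !c := Bool.eq_not_iff.mpr hne
        rw [this] at e2
        simp only [Bool.not_not] at e2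
        omega
      rw [this] at e1
      rw [← e1, e]
    obtain ⟨_, e1⟩ := key x hx
    obtain ⟨_, e2⟩ := key y hy
    rw [← e1, ← e2, cycleVertex_eq.mpr hxy]

end Levels

theorem minimalPeriod_inv {D : Type} [Finite D] (f : Equiv.Perm D) (x : D) :
    Function.minimalPeriod (f⁻¹ : Equiv.Perm D) x = Function.minimalPeriod f x := by
  rw [← card_sameCycle, ← card_sameCycle]
  exact Nat.card_congr (Equiv.subtypeEquivRight fun y => Equiv.Perm.sameCycle_inv)

theorem minimalPeriod_perm_pos {D : Type} [Finite D] (f : Equiv.Perm D) (x : D) :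
    0 < Function.minimalPeriod f x := by
  rw [← card_sameCycle]
  have : Nonempty {y // f.SameCycle x y} := ⟨⟨x, Equiv.Perm.SameCycle.refl _ _⟩⟩
  exact Nat.card_pos

theorem pow_minimalPeriod_apply {D : Type} (f : Equiv.Perm D) (x : D) :
    (f ^ Function.minimalPeriod f x) x = x := by
  rw [Equiv.Perm.coe_pow]
  exact Function.iterate_minimalPeriod

theorem pow_apply_ne {D : Type} (f : Equiv.Perm D) (x : D) {j : ℕ} (h : 1 ≤ j)
    (h' : j < Function.minimalPeriod f x) : (f ^ j) x ≠ x := by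
  intro e
  rw [Equiv.Perm.coe_pow] at e
  have : Function.minimalPeriod f x ≤ j := Function.IsPeriodicPt.minimalPeriod_le (by omega) e
  omega

theorem pow_apply_inj {D : Type} (f : Equiv.Perm D) (x : D) {i j : ℕ}
    (h : i < Function.minimalPeriod f x) (h' : j < Function.minimalPeriod f x)
    (e : (f ^ i) x = (f ^ j) x) : i = j := by
  rw [Equiv.Perm.coe_pow, Equiv.Perm.coe_pow] at e
  exact Function.iterate_injOn_Iio_minimalPeriod h h' e

theorem exists_pow_lt_minimalPeriod {D : Type} [Finite D] {f : Equiv.Perm D} {x y : D}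
    (h : f.SameCycle x y) : ∃ j < Function.minimalPeriod f x, (f ^ j) x = y := by
  obtain ⟨n, rfl⟩ := h.exists_nat_pow_eq
  refine ⟨n % Function.minimalPeriod f x, Nat.mod_lt _ (minimalPeriod_perm_pos f x), ?_⟩
  rw [Equiv.Perm.coe_pow, Equiv.Perm.coe_pow, Function.iterate_mod_minimalPeriod_eq]

theorem minimalPeriod_eq_of {D : Type} (f : Equiv.Perm D) (x : D) {n : ℕ} (hn : 1 ≤ n)
    (h : (f ^ n) x = x) (h' : ∀ j, 1 ≤ j → j < n → (f ^ j) x ≠ x) :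
    Function.minimalPeriod f x = n := by
  rw [Equiv.Perm.coe_pow] at h
  have h1 : Function.minimalPeriod f x ≤ n := Function.IsPeriodicPt.minimalPeriod_le (by omega) h
  have h2 : 0 < Function.minimalPeriod f x := Function.IsPeriodicPt.minimalPeriod_pos (by omega) h
  by_contra hne
  exact h' _ h2 (by omega) (pow_minimalPeriod_apply f x)

/-! ### The exploration of the tree of components -/

namespace CMap

variable {D : Type} [Finite D]

/-- The rotations used by the exploration: around vertices and, clockwise, around components. -/
def rot (m : CMap D) : Bool → Equiv.Perm D
  | false => m.cw
  | true => m.splitφ⁻¹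

theorem isBoundary_rot (m : CMap D) (c : Bool) (d : D) :
    m.IsBoundary (m.rot c d) ↔ m.IsBoundary d := by
  cases c
  · exact m.isBoundary_cw d
  · rw [← isBoundary_splitφ]
    exact iff_of_eq (congrArg m.IsBoundary (Equiv.apply_symm_apply m.splitφ d))

theorem isBoundary_rot_pow (m : CMap D) (c : Bool) (j : ℕ) (d : D) :
    m.IsBoundary ((m.rot c ^ j) d) ↔ m.IsBoundary d := by
  induction j with
  | zero => rfl
  | succ j ih => rw [pow_succ', Equiv.Perm.mul_apply, isBoundary_rot, ih]

/-- Common form of the two recursive clauses of `walk`, so that both colours are treated at once. -/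
def explore (m : CMap D) (c : Bool) (d : D) (j : ℕ) : Option D :=
  if 1 ≤ j ∧ j < Function.minimalPeriod (m.rot c) d then some ((m.rot c ^ j) d) else none

/-- The colour of a word: `true` for black. -/
def wordColor (u : List ℕ) : Bool := decide (Odd u.length)

@[simp] theorem wordColor_append (u : List ℕ) (j : ℕ) : wordColor (u ++ [j]) = !wordColor u := by
  simp only [wordColor, List.length_append, List.length_cons, List.length_nil, zero_add]
  by_cases h : Odd u.length
  · simp [h, Nat.odd_add_one]
  · simp [h, Nat.odd_add_one]

@[simp] theorem wordColor_cons (u : List ℕ) (j : ℕ) : wordColor (j :: u) = !wordColor u := by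
  simp only [wordColor, List.length_cons]
  by_cases h : Odd u.length
  · simp [h, Nat.odd_add_one]
  · simp [h, Nat.odd_add_one]

@[simp] theorem wordColor_nil : wordColor [] = false := by simp [wordColor]

theorem walk_append (m : CMap D) (l : List ℕ) (j : ℕ) : ∀ (b : Bool) (d : D),
    m.walk b d (l ++ [j]) =
      (m.walk b d l).bind fun e => m.explore (b ^^ wordColor l) e j := by
  induction l with
  | nil =>
    intro b d
    cases b
    · simp [walk, explore, rot]
    · simp only [List.nil_append, walk, Option.bind_some, explore, rot, wordColor_nil,
        Bool.xor_false, minimalPeriod_inv]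
  | cons i l ih =>
    intro b d
    cases b <;> simp only [List.cons_append, walk] <;> split_ifs with h
    · rw [ih]; simp
    · simp
    · rw [ih]; simp
    · simp

/-- The definition reads addresses from the first letter, whereas inductions on the tree go from
parent to child. The root is apart: it has no parent edge, so its labels are shifted by one. -/
theorem dartAt_append (m : CMap D) (u : List ℕ) (hu : u ≠ []) (j : ℕ) :
    m.dartAt (u ++ [j]) = (m.dartAt u).bind fun e => m.explore (wordColor u) e j := by
  obtain ⟨i, l, rfl⟩ := List.exists_cons_of_ne_nil hu
  simp only [List.cons_append, dartAt]
  split_ifs with h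
  · rw [walk_append]; simp
  · simp

theorem dartAt_singleton (m : CMap D) (j : ℕ) :
    m.dartAt [j] = if 1 ≤ j ∧ j ≤ Function.minimalPeriod m.cw m.root then
      some ((m.cw ^ (j - 1)) m.root) else none := by
  simp [dartAt, walk]

/-- The rotations restricted to the boundary. -/
def bdryRot (m : CMap D) (c : Bool) : Equiv.Perm {d // m.IsBoundary d} :=
  (m.rot c).subtypePerm (m.isBoundary_rot c)

/-- One step of `φ` is a step of `splitφ` followed by the inverse of `cw`, and `φ` is transitive on
the boundary. -/
theorem bdryRot_transitive (m : CMap D) (x y : {d // m.IsBoundary d}) :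
    Relation.EqvGen (Step (m.bdryRot false) (m.bdryRot true)) x y := by
  have := sameCycle_invariant
    (v := fun z => Relation.EqvGen (Step (m.bdryRot false) (m.bdryRot true)) x z)
    (fun z => ?_) (m.sameCycle_bdryφ x y)
  · exact this.mp (Relation.EqvGen.refl _)
  · have h1 : Relation.EqvGen (Step (m.bdryRot false) (m.bdryRot true)) (m.bdryφ z)
        (m.bdrySplit z) := Relation.EqvGen.rel _ _ (Or.inl rfl)
    have h2 : Relation.EqvGen (Step (m.bdryRot false) (m.bdryRot true)) (m.bdrySplit z) z :=
      Relation.EqvGen.rel _ _ (Or.inr (by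
        apply Subtype.ext
        exact (Equiv.symm_apply_apply m.splitφ z.1).symm))
    have h3 := h1.trans _ _ _ h2
    exact propext ⟨fun h => h.trans _ _ _ h3, fun h => h.trans _ _ _ (h3.symm _ _)⟩

/-- Boundary darts are the edges of the incidence tree, and `lev c x` is the height of the end of
colour `c` of the edge `x`. The listed properties are all that the exploration needs from that tree.
-/
theorem exists_levels (m : CMap D) (hm : m.IsPlanar) :
    ∃ lev : Bool → D → ℕ,
      (∀ c x y, m.IsBoundary x → m.IsBoundary y → (m.rot c).SameCycle x y → lev c x = lev c y) ∧
      (∀ x, m.IsBoundary x → ∃ c, lev c x = lev (!c) x + 1) ∧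
      (∀ c x y, m.IsBoundary x → m.IsBoundary y → lev c x = lev (!c) x + 1 →
        lev c y = lev (!c) y + 1 → (m.rot c).SameCycle x y → x = y) ∧
      (∀ c x, m.IsBoundary x → lev c x = 0 → c = false ∧ m.cw.SameCycle m.root x) ∧
      (∀ c x, m.IsBoundary x → lev c x ≠ 0 →
        ∃ y, m.IsBoundary y ∧ (m.rot c).SameCycle y x ∧ lev c y = lev (!c) y + 1) ∧
      lev false m.root = 0 := by
  set R := m.bdryRot with hR
  have hsc : ∀ c (x y : {d // m.IsBoundary d}), (R c).SameCycle x y ↔ (m.rot c).SameCycle x.1 y.1 :=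
    fun c x y => Equiv.Perm.sameCycle_subtypePerm
  let r : {d // m.IsBoundary d} := ⟨m.root, m.isBoundary_root⟩
  have ht := m.bdryRot_transitive
  have hcard : cyc (R false) + cyc (R true) = Nat.card {d // m.IsBoundary d} + 1 := by
    rw [← (m.planar_split hm).1, ← cyc_inv m.bdrySplit]
    rfl
  obtain ⟨h1, h2⟩ := level_tree R r ht hcard
  -- The value off the boundary is arbitrary: the root dart is on the boundary, and every other
  -- assertion concerns boundary darts only.
  refine ⟨fun c d => if h : m.IsBoundary d then level R r c ⟨d, h⟩ else 0, ?_, ?_, ?_, ?_, ?_, ?_⟩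
  · intro c x y hx hy hxy
    simp only [dif_pos hx, dif_pos hy, level]
    rw [cycleVertex_eq.mpr ((hsc c ⟨x, hx⟩ ⟨y, hy⟩).mpr hxy)]
  · intro x hx
    simp only [dif_pos hx]
    exact h1 _
  · intro c x y hx hy
    simp only [dif_pos hx, dif_pos hy]
    intro e1 e2 hxy
    exact congrArg Subtype.val (h2 c _ _ e1 e2 ((hsc c ⟨x, hx⟩ ⟨y, hy⟩).mpr hxy))
  · intro c x hx
    simp only [dif_pos hx, level]
    intro h0
    rw [(cycleGraph_connected R r ht).dist_eq_zero_iff] at h0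
    have hc : false = c := congrArg Sigma.fst h0
    subst hc
    rw [cycleVertex_eq, hsc] at h0
    exact ⟨rfl, h0⟩
  · intro c x hx
    simp only [dif_pos hx]
    intro h0
    obtain ⟨c', y, e1, e2⟩ := exists_parent R r ht (cycleVertex R c ⟨x, hx⟩) (by
      intro he
      exact h0 (by rw [level, he, SimpleGraph.dist_self]))
    have hc : c = c' := congrArg Sigma.fst e1
    subst hc
    rw [cycleVertex_eq, hsc] at e1
    refine ⟨y.1, y.2, e1.symm, ?_⟩
    simp only [dif_pos y.2]
    exact e2
  · simp only [dif_pos m.isBoundary_root]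
    rw [level, SimpleGraph.dist_self]

/-- The darts of the exploration are the boundary darts, each visited once. -/
theorem dartAt_bijective (m : CMap D) (hm : m.IsPlanar) :
    (∀ u d, m.dartAt u = some d → m.IsBoundary d) ∧
    (∀ u v d, u ≠ [] → v ≠ [] → m.dartAt u = some d → m.dartAt v = some d → u = v) ∧
    (∀ d, m.IsBoundary d → ∃ u, u ≠ [] ∧ m.dartAt u = some d) := by
  obtain ⟨lev, l0, l1, l2, l3, l4, l5⟩ := m.exists_levels hm
  have hroot : ∀ j, m.IsBoundary ((m.cw ^ j) m.root) := fun j =>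
    (m.isBoundary_rot_pow false j _).mpr m.isBoundary_root
  -- Invariant of the exploration: the dart at `u` is the parent edge of a vertex at height
  -- `u.length`, of the colour of `u`.
  have main : ∀ u d, u ≠ [] → m.dartAt u = some d → m.IsBoundary d ∧
      lev (wordColor u) d = u.length ∧ lev (!wordColor u) d + 1 = u.length := by
    intro u
    induction u using List.reverseRecOn with
    | nil => intro d h; exact absurd rfl h
    | append_singleton u j ih =>
      intro d _ hd
      by_cases hu : u = []
      · subst hu
        rw [List.nil_append, dartAt_singleton] at hd
        split_ifs at hd with hj
        cases hd
        have h0 : lev false ((m.cw ^ (j - 1)) m.root) = 0 := by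
          rw [← l5]
          exact (l0 false _ _ m.isBoundary_root (hroot _)
            (Equiv.Perm.sameCycle_pow_right.mpr (Equiv.Perm.SameCycle.refl _ _))).symm
        refine ⟨hroot _, ?_, by simp [h0]⟩
        obtain ⟨c, hc⟩ := l1 _ (hroot (j - 1))
        cases c
        · omega
        · simp only [Bool.not_true] at hc
          simp [hc, h0]
      · rw [dartAt_append _ _ hu] at hd
        cases he : m.dartAt u with
        | none => rw [he] at hd; simp at hd
        | some e =>
          obtain ⟨hb, hl1, hl2⟩ := ih e hu he
          rw [he, Option.bind_some, explore] at hd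
          split_ifs at hd with hj
          cases hd
          have hb' := (m.isBoundary_rot_pow (wordColor u) j e).mpr hb
          have hsc : (m.rot (wordColor u)).SameCycle e ((m.rot (wordColor u) ^ j) e) :=
            Equiv.Perm.sameCycle_pow_right.mpr (Equiv.Perm.SameCycle.refl _ _)
          have hl := l0 _ _ _ hb hb' hsc
          have hne := pow_apply_ne _ _ hj.1 hj.2
          rw [wordColor_append, Bool.not_not, List.length_append]
          refine ⟨hb', ?_, by simp [← hl, hl1]⟩
          -- If the rotated dart led back up from the same vertex, uniqueness of the parent edge
          -- would identify it with `e`, although `j` is smaller than the period.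
          obtain ⟨c, hc⟩ := l1 _ hb'
          by_cases hcc : c = wordColor u
          · subst hcc
            exact absurd (l2 _ _ _ hb' hb hc (by omega) hsc.symm) hne
          · have : c = !wordColor u := Bool.eq_not_iff.mpr hcc
            subst this
            rw [hc, Bool.not_not, ← hl, hl1]; rfl
  -- The height of an address is read from the levels of the two ends of its dart.
  have len : ∀ u v d, u ≠ [] → v ≠ [] → m.dartAt u = some d → m.dartAt v = some d →
      u.length = v.length := by
    intro u v d hu hv h1 h2
    obtain ⟨_, a1, a2⟩ := main u d hu h1
    obtain ⟨_, b1, b2⟩ := main v d hv h2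
    by_cases hc : wordColor u = wordColor v
    · rw [← a1, ← b1, hc]
    · have : wordColor v = !wordColor u := Bool.eq_not_iff.mpr (Ne.symm hc)
      rw [this] at b1 b2
      rw [Bool.not_not] at b2
      omega
  refine ⟨?_, ?_, ?_⟩
  · intro u d h
    by_cases hu : u = []
    · subst hu
      simp only [dartAt, Option.some.injEq] at h
      rw [← h]; exact m.isBoundary_root
    · exact (main u d hu h).1
  · intro u
    induction u using List.reverseRecOn with
    | nil => intro v d h; exact absurd rfl h
    | append_singleton u i ih =>
      intro v
      induction v using List.reverseRecOn with
      | nil => intro d _ h; exact absurd rfl h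
      | append_singleton v j _ =>
        intro d _ _ h1 h2
        have hlen := len _ _ d (by simp) (by simp) h1 h2
        have hlen' : u.length = v.length := by simpa using hlen
        by_cases hu : u = []
        · subst hu
          have hv : v = [] := List.eq_nil_of_length_eq_zero (by simpa using hlen'.symm)
          subst hv
          rw [List.nil_append, dartAt_singleton] at h1 h2
          split_ifs at h1 h2 with hi hj
          rw [← h2, Option.some.injEq] at h1
          have := pow_apply_inj _ _ (by omega) (by omega) h1
          have : i = j := by omega
          rw [this]
        · have hv : v ≠ [] := by
            rintro rfl
            exact hu (List.eq_nil_of_length_eq_zero (by simpa using hlen'))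
          rw [dartAt_append _ _ hu] at h1
          rw [dartAt_append _ _ hv] at h2
          have hcol : wordColor v = wordColor u := by simp [wordColor, hlen']
          cases hx : m.dartAt u with
          | none => rw [hx] at h1; simp at h1
          | some x =>
            cases hy : m.dartAt v with
            | none => rw [hy] at h2; simp at h2
            | some y =>
              rw [hx, Option.bind_some, explore] at h1
              rw [hy, Option.bind_some, explore, hcol] at h2
              split_ifs at h1 h2 with hi hj
              rw [Option.some.injEq] at h1 h2
              obtain ⟨xb, x1, x2⟩ := main u x hu hx
              obtain ⟨yb, y1, y2⟩ := main v y hv hy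
              rw [hcol] at y1 y2
              have hxy : (m.rot (wordColor u)).SameCycle x y := by
                have a1 : (m.rot (wordColor u)).SameCycle x d :=
                  h1 ▸ Equiv.Perm.sameCycle_pow_right.mpr (Equiv.Perm.SameCycle.refl _ _)
                have a2 : (m.rot (wordColor u)).SameCycle y d :=
                  h2 ▸ Equiv.Perm.sameCycle_pow_right.mpr (Equiv.Perm.SameCycle.refl _ _)
                exact a1.trans a2.symm
              have e := l2 _ _ _ xb yb (by omega) (by omega) hxy
              subst e
              have huv := ih v x hu hv hx hy
              subst huv
              rw [← h2] at h1
              rw [pow_apply_inj _ _ hi.2 hj.2 h1]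
  -- Surjectivity by induction on the level `n` of the upper end of `d`: the parent edge of that end
  -- is reached first, and `d` is obtained from it by rotation.
  · suffices H : ∀ n c d, m.IsBoundary d → lev c d = n → lev (!c) d = lev c d + 1 →
        ∃ u, u ≠ [] ∧ m.dartAt u = some d ∧ wordColor u = !c by
      intro d hd
      obtain ⟨c, hc⟩ := l1 d hd
      obtain ⟨u, h1, h2, -⟩ := H _ (!c) d hd rfl (by rw [Bool.not_not]; exact hc)
      exact ⟨u, h1, h2⟩
    intro n
    induction n with
    | zero =>
      intro c d hd h0 _
      obtain ⟨rfl, hs⟩ := l3 c d hd h0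
      obtain ⟨j, hj, e⟩ := exists_pow_lt_minimalPeriod hs
      refine ⟨[j + 1], by simp, ?_, by simp⟩
      rw [dartAt_singleton, if_pos ⟨by omega, by omega⟩, Nat.add_sub_cancel, e]
    | succ n ih =>
      intro c d hd hn hc
      obtain ⟨y, hy, hs, hl⟩ := l4 c d hd (by omega)
      have hly := l0 c _ _ hy hd hs
      obtain ⟨u, hu, hdu, hcu⟩ := ih (!c) y hy (by omega) (by rw [Bool.not_not]; omega)
      rw [Bool.not_not] at hcu
      obtain ⟨j, hj, e⟩ := exists_pow_lt_minimalPeriod hs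
      have hj0 : 1 ≤ j := by
        rcases Nat.eq_zero_or_pos j with h0 | h0
        · subst h0
          have : y = d := e
          subst this
          omega
        · exact h0
      refine ⟨u ++ [j], by simp, ?_, by simp [hcu]⟩
      rw [dartAt_append _ _ hu, hdu, Option.bind_some, hcu, explore, if_pos ⟨hj0, hj⟩, e]

theorem treeVertices_finite (m : CMap D) (hm : m.IsPlanar) : m.treeVertices.Finite := by
  have h2 := (m.dartAt_bijective hm).2.1
  have : (m.treeVertices \ {[]}).Finite := by
    refine Set.Finite.of_injOn (f := fun u => (m.dartAt u).getD m.root) (t := Set.univ)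
      (Set.mapsTo_univ _ _) ?_ Set.finite_univ
    rintro u ⟨hu, hu'⟩ v ⟨hv, hv'⟩ h
    obtain ⟨d, hd⟩ := Option.isSome_iff_exists.mp hu
    obtain ⟨e, he⟩ := Option.isSome_iff_exists.mp hv
    simp only [hd, he, Option.getD_some] at h
    subst h
    exact h2 u v d hu' hv' hd he
  exact (this.union (Set.finite_singleton [])).subset (by
    intro u hu
    by_cases h : u = [] <;> simp [h, hu])

end CMap

open BoltzmannMap.CMap (wordColor wordColor_append wordColor_nil wordColor_cons)

/-! ### Rotations of a plane tree -/

namespace PlaneTree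

theorem ext_verts {t t' : PlaneTree} (h : t.verts = t'.verts) : t = t' := by
  cases t; cases t'; simpa using h

theorem append_mem_iff (t : PlaneTree) (u : List ℕ) (j : ℕ) :
    u ++ [j] ∈ t.verts ↔ 1 ≤ j ∧ j ≤ t.numChildren u := by
  have key : ∀ k, (∀ j, u ++ [j] ∈ t.verts ↔ 1 ≤ j ∧ j ≤ k) → t.numChildren u = k := by
    intro k hk
    have : {j : ℕ | u ++ [j] ∈ t.verts} = Set.Icc 1 k := by
      ext j; exact hk j
    rw [numChildren, this, Set.ncard_Icc_nat, Nat.add_sub_cancel]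
  by_cases hu : u ∈ t.verts
  · obtain ⟨k, hk⟩ := t.children u hu
    rw [key k hk]; exact hk j
  · have h0 : ∀ j, u ++ [j] ∈ t.verts ↔ 1 ≤ j ∧ j ≤ 0 := fun j =>
      iff_of_false (fun h => hu (t.parent_mem u j h)) (by omega)
    rw [key 0 h0]; exact h0 j

theorem numChildren_eq {t : PlaneTree} {u : List ℕ} {k : ℕ}
    (h : ∀ j, u ++ [j] ∈ t.verts ↔ 1 ≤ j ∧ j ≤ k) : t.numChildren u = k := by
  have h1 := t.append_mem_iff u
  by_contra hne
  rcases Nat.lt_or_gt_of_ne hne with hlt | hlt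
  · have := (h1 k).mp ((h k).mpr (by omega)); omega
  · have := (h _).mp ((h1 (t.numChildren u)).mpr (by omega)); omega

/-- The vertices other than the root; they stand for the edges to their parents. -/
abbrev Nonroot (t : PlaneTree) : Type := {u : List ℕ // u ∈ t.verts ∧ u ≠ []}

/-- Turn an edge of the tree clockwise around its endpoint of colour `c`. -/
def rotWord (t : PlaneTree) (c : Bool) (v : List ℕ) : List ℕ :=
  if wordColor v = c then (if 1 ≤ t.numChildren v then v ++ [1] else v)
  else if v.getLastD 0 < t.numChildren v.dropLast then v.dropLast ++ [v.getLastD 0 + 1]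
  else if v.dropLast = [] then [1] else v.dropLast

theorem rotWord_self (t : PlaneTree) (v : List ℕ) :
    t.rotWord (wordColor v) v = if 1 ≤ t.numChildren v then v ++ [1] else v := by
  simp [rotWord]

/-- After the last child comes the edge to the parent of `u`. The root has none, so there the
rotation returns to the first child. -/
theorem rotWord_append (t : PlaneTree) (u : List ℕ) (j : ℕ) :
    t.rotWord (wordColor u) (u ++ [j]) =
      if j < t.numChildren u then u ++ [j + 1] else if u = [] then [1] else u := by
  have : ¬ (wordColor (u ++ [j]) = wordColor u) := by simp
  rw [rotWord, if_neg this]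
  simp

theorem exists_append (v : List ℕ) (hv : v ≠ []) : ∃ u j, v = u ++ [j] :=
  ⟨v.dropLast, v.getLast hv, (List.dropLast_append_getLast hv).symm⟩

/-- The endpoint of colour `c` of an edge. -/
def center (c : Bool) (v : List ℕ) : List ℕ := if wordColor v = c then v else v.dropLast

theorem center_self (v : List ℕ) : center (wordColor v) v = v := by simp [center]

theorem center_append (u : List ℕ) (j : ℕ) : center (wordColor u) (u ++ [j]) = u := by
  have : ¬ (wordColor (u ++ [j]) = wordColor u) := by simp
  rw [center, if_neg this]; simp

theorem color_cases (c : Bool) (v : List ℕ) (hv : v ≠ []) :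
    wordColor v = c ∨ ∃ u j, v = u ++ [j] ∧ wordColor u = c := by
  by_cases h : wordColor v = c
  · exact Or.inl h
  · obtain ⟨u, j, rfl⟩ := exists_append v hv
    refine Or.inr ⟨u, j, rfl, ?_⟩
    rw [wordColor_append] at h
    cases h1 : wordColor u <;> cases c <;> simp_all

theorem rotWord_mem (t : PlaneTree) (c : Bool) {v : List ℕ} (hv : v ∈ t.verts) (hv' : v ≠ []) :
    t.rotWord c v ∈ t.verts ∧ t.rotWord c v ≠ [] := by
  rcases color_cases c v hv' with rfl | ⟨u, j, rfl, rfl⟩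
  · rw [rotWord_self]
    split_ifs with h
    · exact ⟨(t.append_mem_iff _ _).mpr ⟨le_rfl, h⟩, by simp⟩
    · exact ⟨hv, hv'⟩
  · rw [rotWord_append]
    have hj := (t.append_mem_iff _ _).mp hv
    split_ifs with h h'
    · exact ⟨(t.append_mem_iff _ _).mpr ⟨by omega, h⟩, by simp⟩
    · subst h'
      exact ⟨(t.append_mem_iff [] 1).mpr ⟨le_rfl, by omega⟩, by simp⟩
    · exact ⟨t.parent_mem _ _ hv, h'⟩

theorem center_rotWord (t : PlaneTree) (c : Bool) {v : List ℕ} (hv' : v ≠ []) :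
    center c (t.rotWord c v) = center c v := by
  rcases color_cases c v hv' with rfl | ⟨u, j, rfl, rfl⟩
  · rw [rotWord_self]
    split_ifs with h
    · rw [center_append, center_self]
    · rfl
  · rw [rotWord_append, center_append]
    split_ifs with h h'
    · rw [center_append]
    · subst h'
      exact center_append [] 1
    · rw [center_self]

theorem rotWord_surjective (t : PlaneTree) (c : Bool) {v : List ℕ} (hv : v ∈ t.verts)
    (hv' : v ≠ []) : ∃ u ∈ t.verts, u ≠ [] ∧ t.rotWord c u = v := by
  rcases color_cases c v hv' with rfl | ⟨u, j, rfl, rfl⟩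
  · by_cases h : 1 ≤ t.numChildren v
    · refine ⟨v ++ [t.numChildren v], (t.append_mem_iff _ _).mpr ⟨h, le_rfl⟩, by simp, ?_⟩
      rw [rotWord_append, if_neg (lt_irrefl _), if_neg hv']
    · exact ⟨v, hv, hv', by rw [rotWord_self, if_neg h]⟩
  · have hj := (t.append_mem_iff _ _).mp hv
    rcases Nat.lt_or_ge 1 j with h | h
    · refine ⟨u ++ [j - 1], (t.append_mem_iff _ _).mpr (by omega), by simp, ?_⟩
      rw [rotWord_append, if_pos (by omega), Nat.sub_add_cancel (by omega)]
    · have h1 : j = 1 := by omega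
      subst h1
      by_cases hu : u = []
      · subst hu
        refine ⟨[] ++ [t.numChildren []], (t.append_mem_iff _ _).mpr ⟨hj.2, le_rfl⟩, by simp, ?_⟩
        rw [rotWord_append, if_neg (lt_irrefl _), if_pos rfl]; rfl
      · exact ⟨u, t.parent_mem _ _ hv, hu, by rw [rotWord_self, if_pos hj.2]⟩

instance finite_nonroot (t : PlaneTree) : Finite t.Nonroot :=
  Finite.of_injective (fun u : t.Nonroot => (⟨u.1, u.2.1⟩ : t.verts))
    (fun _ _ h => Subtype.ext (congrArg (fun x => x.1) h))

/-- The rotation around the endpoints of colour `c`, as a permutation of the edges. -/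
def rotPerm (t : PlaneTree) (c : Bool) : Equiv.Perm t.Nonroot :=
  Equiv.ofBijective (fun u => ⟨t.rotWord c u.1, t.rotWord_mem c u.2.1 u.2.2⟩)
    (Finite.surjective_iff_bijective.mp (fun v => by
      obtain ⟨u, h1, h2, h3⟩ := t.rotWord_surjective c v.2.1 v.2.2
      exact ⟨⟨u, h1, h2⟩, Subtype.ext h3⟩))

theorem rotPerm_apply (t : PlaneTree) (c : Bool) (u : t.Nonroot) :
    (t.rotPerm c u).1 = t.rotWord c u.1 := rfl

theorem card_nonroot (t : PlaneTree) : Nat.card t.Nonroot + 1 = t.verts.card := by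
  have : Fintype t.Nonroot := Fintype.ofFinite _
  rw [Nat.card_eq_fintype_card, ← Finset.card_erase_add_one t.nil_mem,
    Fintype.card_of_subtype (t.verts.erase [])]
  intro u
  simp [and_comm]

theorem card_white_add_card_black (t : PlaneTree) :
    t.white.card + t.black.card = t.verts.card := by
  rw [white, black, ← Finset.card_filter_add_card_filter_not (s := t.verts)
    (fun u => Even u.length)]
  simp only [Nat.not_even_iff_odd]

theorem mem_white {t : PlaneTree} {u : List ℕ} :
    u ∈ t.white ↔ u ∈ t.verts ∧ wordColor u = false := by
  simp [white, wordColor]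

theorem mem_black {t : PlaneTree} {u : List ℕ} :
    u ∈ t.black ↔ u ∈ t.verts ∧ wordColor u = true := by
  simp [black, wordColor]

/-- The endpoint of colour `c` is invariant under the rotation and takes every vertex of that colour
as a value; an edge must exist for the root to be an endpoint. -/
theorem card_colored_le_cyc (t : PlaneTree) (ht : [1] ∈ t.verts) (c : Bool) (s : Finset (List ℕ))
    (hs : ∀ u, u ∈ s ↔ u ∈ t.verts ∧ wordColor u = c) : s.card ≤ cyc (t.rotPerm c) := by
  have e : s.card = Nat.card s := by simp
  rw [e]
  refine card_le_cyc (Y := s) (t.rotPerm c) (fun v => ⟨center c v.1, (hs _).mpr ?_⟩) ?_ ?_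
  · rcases color_cases c v.1 v.2.2 with h | ⟨u, j, h, rfl⟩
    · rw [← h, center_self]; exact ⟨v.2.1, rfl⟩
    · rw [h, center_append]; exact ⟨t.parent_mem _ _ (h ▸ v.2.1), rfl⟩
  · intro v
    exact Subtype.ext (t.center_rotWord c v.2.2)
  · rintro ⟨u, hu⟩
    obtain ⟨hu1, rfl⟩ := (hs u).mp hu
    by_cases h : u = []
    · subst h
      exact ⟨⟨[1], ht, by simp⟩, Subtype.ext (center_append [] 1)⟩
    · exact ⟨⟨u, hu1, h⟩, Subtype.ext (center_self u)⟩

/-- The contour of a plane tree is a single cycle. -/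
theorem contour_sameCycle (t : PlaneTree) (ht : [1] ∈ t.verts) (x y : t.Nonroot) :
    ((t.rotPerm false)⁻¹ * (t.rotPerm true)⁻¹).SameCycle x y := by
  have h1 := t.card_colored_le_cyc ht false t.white (fun u => mem_white)
  have h2 := t.card_colored_le_cyc ht true t.black (fun u => mem_black)
  have h3 := genus_le (t.rotPerm false)⁻¹ (t.rotPerm true)⁻¹
  have h4 := t.card_nonroot
  have h5 := t.card_white_add_card_black
  rw [cyc_inv, cyc_inv] at h3
  have hne : Nonempty t.Nonroot := ⟨x⟩
  have horb : orb (t.rotPerm false)⁻¹ (t.rotPerm true)⁻¹ = 1 := by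
    refine orb_eq_one _ _ ?_
    let r : t.Nonroot := ⟨[1], ht, by simp⟩
    have hrel : ∀ c (v : t.Nonroot), Relation.EqvGen
        (Step (t.rotPerm false)⁻¹ (t.rotPerm true)⁻¹) v (t.rotPerm c v) := by
      intro c v
      refine Relation.EqvGen.symm _ _ (Relation.EqvGen.rel _ _ ?_)
      cases c
      · exact Or.inl (Equiv.symm_apply_apply _ _).symm
      · exact Or.inr (Equiv.symm_apply_apply _ _).symm
    have key : ∀ n (v : List ℕ) (hv : v ∈ t.verts ∧ v ≠ []), v.length + v.getLastD 0 = n →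
        Relation.EqvGen (Step (t.rotPerm false)⁻¹ (t.rotPerm true)⁻¹) r ⟨v, hv⟩ := by
      -- Induction on the height, then on the rank among siblings: an edge is joined to the previous
      -- sibling, or to the parent edge when it is a first child.
      suffices H : ∀ l j (v : List ℕ) (hv : v ∈ t.verts ∧ v ≠ []), v.length = l → v.getLastD 0 = j →
          Relation.EqvGen (Step (t.rotPerm false)⁻¹ (t.rotPerm true)⁻¹) r ⟨v, hv⟩ from
        fun n v hv _ => H _ _ v hv rfl rfl
      intro l
      induction l with
      | zero => intro j v hv h0; exact absurd (List.eq_nil_of_length_eq_zero h0) hv.2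
      | succ l ihl =>
        intro j
        induction j with
        | zero =>
          intro v hv _ h0
          obtain ⟨u, j, rfl⟩ := exists_append v hv.2
          have := (t.append_mem_iff u j).mp hv.1
          simp at h0
          omega
        | succ j ihj =>
          intro v hv hl hj
          obtain ⟨u, j', rfl⟩ := exists_append v hv.2
          have hj' : j' = j + 1 := by simpa using hj
          subst hj'
          have hm := (t.append_mem_iff u _).mp hv.1
          rcases Nat.eq_zero_or_pos j with h0 | h0
          · subst h0
            by_cases hu : u = []
            · subst hu
              exact Relation.EqvGen.refl _
            · have hum := t.parent_mem _ _ hv.1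
              have h6 := ihl _ u ⟨hum, hu⟩ (by simpa using hl) rfl
              have h7 := hrel (wordColor u) ⟨u, hum, hu⟩
              have h8 : t.rotPerm (wordColor u) ⟨u, hum, hu⟩ = ⟨u ++ [0 + 1], hv⟩ := by
                apply Subtype.ext
                rw [rotPerm_apply, rotWord_self, if_pos (by omega)]
              rw [h8] at h7
              exact h6.trans _ _ _ h7
          · have hum : u ++ [j] ∈ t.verts ∧ u ++ [j] ≠ [] :=
              ⟨(t.append_mem_iff u j).mpr (by omega), by simp⟩
            have h6 := ihj (u ++ [j]) hum (by simpa using hl) (by simp)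
            have h7 := hrel (wordColor u) ⟨u ++ [j], hum⟩
            have h8 : t.rotPerm (wordColor u) ⟨u ++ [j], hum⟩ = ⟨u ++ [j + 1], hv⟩ := by
              apply Subtype.ext
              rw [rotPerm_apply, rotWord_append, if_pos (by omega)]
            rw [h8] at h7
            exact h6.trans _ _ _ h7
    intro v v'
    exact ((key _ v.1 v.2 rfl).symm).trans _ _ _ (key _ v'.1 v'.2 rfl)
  rw [horb] at h3
  -- A tree has one more vertex than edges, so the two rotations already have at least `Nat.card
  -- t.Nonroot + 1` cycles; the genus inequality leaves room for one more.
  have h6 : cyc ((t.rotPerm false)⁻¹ * (t.rotPerm true)⁻¹) ≤ 1 := by omega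
  have h7 := Finite.card_le_one_iff_subsingleton.mp h6
  exact Quotient.exact (h7.elim (Quotient.mk _ x) (Quotient.mk _ y))

end PlaneTree

/-! ### Encoding the boundary of a map by a plane tree -/

namespace CMap

variable {D : Type} [Finite D]

/-- The nonroot vertices of the plane tree `t` label the boundary darts of `m`, compatibly with
the rotations. -/
structure Encodes (m : CMap D) (t : PlaneTree) (i : List ℕ → D) : Prop where
  one_mem : [1] ∈ t.verts
  root : i [1] = m.root
  inj : ∀ u v, u ∈ t.verts → u ≠ [] → v ∈ t.verts → v ≠ [] → i u = i v → u = v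
  surj : ∀ d, m.IsBoundary d ↔ ∃ u, u ∈ t.verts ∧ u ≠ [] ∧ i u = d
  rot : ∀ c u, u ∈ t.verts → u ≠ [] → m.rot c (i u) = i (t.rotWord c u)

namespace Encodes

variable {m : CMap D} {t : PlaneTree} {i : List ℕ → D}

theorem rot_pow (h : m.Encodes t i) {u : List ℕ} (hu : u ∈ t.verts) (hu' : u ≠ []) {j : ℕ}
    (hj : 1 ≤ j) (hj' : j ≤ t.numChildren u) :
    (m.rot (wordColor u) ^ j) (i u) = i (u ++ [j]) := by
  induction j, hj using Nat.le_induction with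
  | base =>
    rw [pow_one, h.rot _ u hu hu', PlaneTree.rotWord_self, if_pos hj']
  | succ j hj ih =>
    rw [pow_succ', Equiv.Perm.mul_apply, ih (by omega), h.rot _ _ _ (by simp),
      PlaneTree.rotWord_append, if_pos (by omega)]
    exact (t.append_mem_iff _ _).mpr ⟨hj, by omega⟩

theorem minimalPeriod_rot (h : m.Encodes t i) {u : List ℕ} (hu : u ∈ t.verts) (hu' : u ≠ []) :
    Function.minimalPeriod (m.rot (wordColor u)) (i u) = t.numChildren u + 1 := by
  refine minimalPeriod_eq_of _ _ (by omega) ?_ ?_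
  · rcases Nat.eq_zero_or_pos (t.numChildren u) with h0 | h0
    · rw [h0, zero_add, pow_one, h.rot _ u hu hu', PlaneTree.rotWord_self, if_neg (by omega)]
    · rw [pow_succ', Equiv.Perm.mul_apply, h.rot_pow hu hu' h0 le_rfl, h.rot _ _ _ (by simp),
        PlaneTree.rotWord_append, if_neg (lt_irrefl _), if_neg hu']
      exact (t.append_mem_iff _ _).mpr ⟨h0, le_rfl⟩
  · intro j hj hj' e
    rw [h.rot_pow hu hu' hj (by omega)] at e
    have := h.inj _ _ ((t.append_mem_iff _ _).mpr ⟨hj, by omega⟩) (by simp) hu hu' e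
    simp at this

theorem cw_pow_root (h : m.Encodes t i) {j : ℕ} (hj : j < t.numChildren []) :
    (m.cw ^ j) m.root = i [j + 1] := by
  induction j with
  | zero => rw [pow_zero, ← h.root]; rfl
  | succ j ih =>
    rw [pow_succ', Equiv.Perm.mul_apply, ih (by omega)]
    have hm : [j + 1] ∈ t.verts := (t.append_mem_iff [] _).mpr ⟨by omega, by omega⟩
    have := h.rot false [j + 1] hm (by simp)
    have h2 := t.rotWord_append [] (j + 1)
    rw [wordColor_nil, if_pos hj] at h2
    exact this.trans (congrArg i h2)

theorem minimalPeriod_cw_root (h : m.Encodes t i) :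
    Function.minimalPeriod m.cw m.root = t.numChildren [] := by
  have h0 : 1 ≤ t.numChildren [] := ((t.append_mem_iff [] 1).mp h.one_mem).2
  refine minimalPeriod_eq_of _ _ h0 ?_ ?_
  · obtain ⟨k, hk⟩ : ∃ k, t.numChildren [] = k + 1 := ⟨_, (Nat.sub_add_cancel h0).symm⟩
    rw [hk, pow_succ', Equiv.Perm.mul_apply, h.cw_pow_root (by omega)]
    have hm : [k + 1] ∈ t.verts := (t.append_mem_iff [] _).mpr ⟨by omega, by omega⟩
    have := h.rot false [k + 1] hm (by simp)
    have h2 := t.rotWord_append [] (k + 1)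
    rw [wordColor_nil, if_neg (by omega), if_pos rfl] at h2
    exact this.trans ((congrArg i h2).trans h.root)
  · intro j hj hj' e
    rw [h.cw_pow_root hj', ← h.root] at e
    have := h.inj _ _ ((t.append_mem_iff [] _).mpr ⟨by omega, by omega⟩) (by simp) h.one_mem
      (by simp) e
    simp at this
    omega

/-- The period of the rotation at `i u` is the number of children plus one, so the exploration of
the map meets the same choices as a walk in `t`. This identifies the tree of a glued map. -/
theorem dartAt_eq (h : m.Encodes t i) (u : List ℕ) (hu : u ≠ []) :
    m.dartAt u = if u ∈ t.verts then some (i u) else none := by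
  induction u using List.reverseRecOn with
  | nil => exact absurd rfl hu
  | append_singleton u j ih =>
    by_cases hu0 : u = []
    · subst hu0
      rw [List.nil_append, dartAt_singleton, h.minimalPeriod_cw_root]
      have hm := t.append_mem_iff [] j
      rw [List.nil_append] at hm
      split_ifs with h1 h2 h2
      · rw [h.cw_pow_root (by omega), Nat.sub_add_cancel h1.1]
      · exact absurd (hm.mpr h1) h2
      · exact absurd (hm.mp h2) h1
      · rfl
    · rw [dartAt_append _ _ hu0, ih hu0]
      have hm := t.append_mem_iff u j
      by_cases hu1 : u ∈ t.verts
      · rw [if_pos hu1, Option.bind_some, explore, h.minimalPeriod_rot hu1 hu0]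
        split_ifs with h1 h2 h2
        · rw [h.rot_pow hu1 hu0 h1.1 (by omega)]
        · exact absurd (hm.mpr (by omega)) h2
        · exact absurd (by have := hm.mp h2; omega) h1
        · rfl
      · rw [if_neg hu1, if_neg (fun h2 => hu1 (t.parent_mem _ _ h2))]; rfl

theorem treeVertices_eq (h : m.Encodes t i) : m.treeVertices = t.verts := by
  ext u
  simp only [treeVertices, Set.mem_ofPred_eq]
  by_cases hu : u = []
  · subst hu
    simp [dartAt, t.nil_mem]
  · rw [h.dartAt_eq u hu]
    split_ifs with h1 <;> simp [h1]

end Encodes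

/-- The tree of components of a map for which it is finite. -/
def toTree (m : CMap D) (h : m.treeVertices.Finite) : PlaneTree where
  verts := h.toFinset
  nil_mem := by simpa using m.nil_mem_treeVertices
  parent_mem := fun u j hu => by simpa using m.parent_mem_treeVertices u j (by simpa using hu)
  children := fun u _ => by simpa using m.children_treeVertices u

/-- Every planar map is encoded by its own exploration. The default value of `getD` is taken only at
addresses outside the tree, which an encoding ignores. -/
theorem encodes_toTree (m : CMap D) (hm : m.IsPlanar) (h : m.treeVertices.Finite) :
    m.Encodes (m.toTree h) (fun u => (m.dartAt u).getD m.root) := by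
  obtain ⟨h1, h2, h3⟩ := m.dartAt_bijective hm
  set t := m.toTree h with ht
  have mem : ∀ u, u ∈ t.verts ↔ (m.dartAt u).isSome := by
    intro u
    simp only [ht, toTree, Set.Finite.mem_toFinset]
    rfl
  have mem' : ∀ u, u ∈ t.verts → ∃ d, m.dartAt u = some d := fun u hu =>
    Option.isSome_iff_exists.mp ((mem u).mp hu)
  have hpos := minimalPeriod_perm_pos m.cw m.root
  have hk0 : t.numChildren [] = Function.minimalPeriod m.cw m.root := by
    refine PlaneTree.numChildren_eq fun j => ?_
    rw [mem, List.nil_append, dartAt_singleton]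
    split_ifs with hj
    · exact iff_of_true rfl hj
    · exact iff_of_false (by simp) hj
  have hk : ∀ u d, u ≠ [] → m.dartAt u = some d →
      t.numChildren u = Function.minimalPeriod (m.rot (wordColor u)) d - 1 := by
    intro u d hu hd
    refine PlaneTree.numChildren_eq fun j => ?_
    rw [mem, dartAt_append _ _ hu, hd, Option.bind_some, explore]
    split_ifs with hj
    · exact iff_of_true rfl (by omega)
    · exact iff_of_false (by simp) (by omega)
  have hroot : m.dartAt [1] = some m.root := by
    rw [dartAt_singleton, if_pos ⟨le_rfl, hpos⟩]; rfl
  refine ⟨(mem _).mpr (by rw [hroot]; rfl), by simp [hroot], ?_, ?_, ?_⟩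
  · intro u v hu hu' hv hv' e
    obtain ⟨d, hd⟩ := mem' u hu
    obtain ⟨d', hd'⟩ := mem' v hv
    simp only [hd, hd', Option.getD_some] at e
    subst e
    exact h2 u v d hu' hv' hd hd'
  · intro d
    constructor
    · intro hd
      obtain ⟨u, hu, e⟩ := h3 d hd
      exact ⟨u, (mem u).mpr (by rw [e]; rfl), hu, by simp [e]⟩
    · rintro ⟨u, hu, hu', e⟩
      obtain ⟨d', hd⟩ := mem' u hu
      simp only [hd, Option.getD_some] at e
      subst e
      exact h1 u _ hd
  · intro c u hu hu'
    obtain ⟨d, hd⟩ := mem' u hu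
    rcases PlaneTree.color_cases c u hu' with rfl | ⟨v, j, rfl, rfl⟩
    · rw [PlaneTree.rotWord_self, hk u d hu' hd]
      simp only [hd, Option.getD_some]
      split_ifs with h0
      · rw [dartAt_append _ _ hu', hd, Option.bind_some, explore, if_pos (by omega), pow_one,
          Option.getD_some]
      · simp only [hd, Option.getD_some]
        have h4 := minimalPeriod_perm_pos (m.rot (wordColor u)) d
        have h5 := pow_minimalPeriod_apply (m.rot (wordColor u)) d
        have h6 : Function.minimalPeriod (m.rot (wordColor u)) d = 1 := by omega
        rwa [h6, pow_one] at h5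
    · simp only [hd, Option.getD_some]
      rw [PlaneTree.rotWord_append]
      -- Around the root the cycle closes up at `[1]`; around any other vertex it closes up at the
      -- parent edge `v`.
      by_cases hv : v = []
      · subst hv
        rw [hk0]
        rw [List.nil_append, dartAt_singleton] at hd
        split_ifs at hd with hj
        rw [Option.some.injEq] at hd
        have e : m.rot (wordColor []) d = (m.cw ^ j) m.root := by
          rw [← hd, wordColor_nil]
          change m.cw ((m.cw ^ (j - 1)) m.root) = _
          rw [← Equiv.Perm.mul_apply, ← pow_succ', Nat.sub_add_cancel hj.1]
        rw [e, if_pos rfl]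
        split_ifs with h0
        · rw [List.nil_append, dartAt_singleton, if_pos (by omega)]; rfl
        · rw [hroot]
          have h6 : j = Function.minimalPeriod m.cw m.root := by omega
          rw [h6, pow_minimalPeriod_apply]; rfl
      · obtain ⟨e, he⟩ := mem' v (t.parent_mem _ _ hu)
        rw [hk v e hv he, if_neg hv]
        rw [dartAt_append _ _ hv, he, Option.bind_some, explore] at hd
        split_ifs at hd with hj
        rw [Option.some.injEq] at hd
        rw [← hd, ← Equiv.Perm.mul_apply, ← pow_succ']
        split_ifs with h0
        · rw [dartAt_append _ _ hv, he, Option.bind_some, explore, if_pos (by omega)]; rfl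
        · rw [he]
          have h6 : j + 1 = Function.minimalPeriod (m.rot (wordColor v)) e := by omega
          rw [h6, pow_minimalPeriod_apply]; rfl

end CMap

/-! ### A map is determined by its tree and its components -/

namespace CMap

variable {D D' : Type} [Finite D] [Finite D']

theorem sameCycle_rot_true (m : CMap D) (x y : D) :
    (m.rot true).SameCycle x y ↔ m.splitφ.SameCycle x y := Equiv.Perm.sameCycle_inv

namespace Encodes

variable {m : CMap D} {t : PlaneTree} {i : List ℕ → D}

theorem isBoundary (h : m.Encodes t i) {u : List ℕ} (hu : u ∈ t.verts) (hu' : u ≠ []) :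
    m.IsBoundary (i u) := (h.surj _).mpr ⟨u, hu, hu', rfl⟩

theorem ne_nil_of_black {u : List ℕ} (hu : u ∈ t.black) : u ≠ [] := by
  rintro rfl
  simpa using (PlaneTree.mem_black.mp hu).2

/-- A boundary dart of the component has a label; if this is a white vertex, its black parent labels
another dart of the same contour. -/
theorem exists_black (h : m.Encodes t i) (d : D) :
    ∃ u : t.black, m.SameComponent (i u) d := by
  obtain ⟨b, hb, hbd⟩ := m.exists_isBoundary_sameComponent d
  obtain ⟨v, hv, hv', rfl⟩ := (h.surj b).mp hb
  rcases PlaneTree.color_cases true v hv' with hc | ⟨u, j, rfl, hc⟩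
  · exact ⟨⟨v, PlaneTree.mem_black.mpr ⟨hv, hc⟩⟩, hbd⟩
  · have hu := t.parent_mem _ _ hv
    have hub : u ∈ t.black := PlaneTree.mem_black.mpr ⟨hu, hc⟩
    have hj := (t.append_mem_iff _ _).mp hv
    refine ⟨⟨u, hub⟩, Relation.EqvGen.trans _ _ _ ?_ hbd⟩
    refine m.sameComponent_of_sameCycle ((m.sameCycle_rot_true _ _).mp ?_)
    rw [← h.rot_pow hu (ne_nil_of_black hub) hj.1 hj.2, hc]
    exact Equiv.Perm.sameCycle_pow_right.mpr (Equiv.Perm.SameCycle.refl _ _)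

/-- By planarity the two darts are on one contour. Turning along it from `i u` meets the labels of
the children of `u`, which are white, before coming back. -/
theorem black_unique (h : m.Encodes t i) (hm : m.IsPlanar) {d : D} {u v : t.black}
    (hu : m.SameComponent (i u) d) (hv : m.SameComponent (i v) d) : u = v := by
  obtain ⟨u, hub⟩ := u
  obtain ⟨v, hvb⟩ := v
  obtain ⟨hu1, hu2⟩ := PlaneTree.mem_black.mp hub
  obtain ⟨hv1, hv2⟩ := PlaneTree.mem_black.mp hvb
  have hu' := ne_nil_of_black hub
  have hv' := ne_nil_of_black hvb
  have hs := (m.planar_split hm).2.1 _ _ (h.isBoundary hu1 hu') (h.isBoundary hv1 hv')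
    (hu.trans _ _ _ (hv.symm _ _))
  rw [← sameCycle_rot_true] at hs
  obtain ⟨j, hj, e⟩ := exists_pow_lt_minimalPeriod hs
  have hp := h.minimalPeriod_rot hu1 hu'
  rw [hu2] at hp
  rcases Nat.eq_zero_or_pos j with h0 | h0
  · subst h0
    exact Subtype.ext (h.inj _ _ hu1 hu' hv1 hv' e)
  · have e' := h.rot_pow hu1 hu' h0 (by omega)
    rw [hu2, e] at e'
    have := h.inj _ _ hv1 hv' ((t.append_mem_iff _ _).mpr ⟨h0, by omega⟩) (by simp) e'
    subst this
    rw [wordColor_append, hu2] at hv2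
    simp at hv2

/-- Maps with the same tree of components and isomorphic components are isomorphic. -/
theorem iso_of_components (h : m.Encodes t i) (hm : m.IsPlanar) {m' : CMap D'}
    {i' : List ℕ → D'} (h' : m'.Encodes t i') (hm' : m'.IsPlanar)
    (hc : ∀ u : t.black, (m.component (i u)).Iso (m'.component (i' u))) : m.Iso m' := by
  choose e e1 e2 e3 using hc
  choose c hcd using h.exists_black
  let E : D → D' := fun d => (e (c d) ⟨d, hcd d⟩).1
  -- The map assembled from the isomorphisms of components does not depend on the chosen black
  -- vertex, since there is only one.
  have hE : ∀ (u : t.black) (d : D) (hd : m.SameComponent (i u) d), E d = (e u ⟨d, hd⟩).1 := by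
    intro u d hd
    have := h.black_unique hm (hcd d) hd
    subst this
    rfl
  have hEσ : ∀ d, E (m.splitσ d) = m'.splitσ (E d) := by
    intro d
    rw [hE (c d) _ ((m.sameComponent_splitσ _ _).mpr (hcd d))]
    exact congrArg Subtype.val (e1 (c d) ⟨d, hcd d⟩)
  have hEα : ∀ d, E (m.α d) = m'.α (E d) := by
    intro d
    rw [hE (c d) _ ((m.sameComponent_α _ _).mpr (hcd d))]
    exact congrArg Subtype.val (e2 (c d) ⟨d, hcd d⟩)
  have hEφ : ∀ d, E ((m.rot true) d) = m'.rot true (E d) := by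
    intro d
    have h1 : ∀ d, E (m.splitφ d) = m'.splitφ (E d) := fun d => by
      change E (m.splitσ (m.α d)) = m'.splitσ (m'.α (E d))
      rw [hEσ, hEα]
    apply m'.splitφ.injective
    rw [← h1]
    exact (congrArg E (Equiv.apply_symm_apply m.splitφ d)).trans
      (Equiv.apply_symm_apply m'.splitφ (E d)).symm
  have hEφj : ∀ j d, E ((m.rot true ^ j) d) = (m'.rot true ^ j) (E d) := by
    intro j d
    induction j with
    | zero => rfl
    | succ j ih => rw [pow_succ', Equiv.Perm.mul_apply, hEφ, ih, pow_succ', Equiv.Perm.mul_apply]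
  have hEb : ∀ u : t.black, E (i u) = i' u := by
    intro u
    rw [hE u _ (Relation.EqvGen.refl _)]
    exact congrArg Subtype.val (e3 u)
  have hEi : ∀ v, v ∈ t.verts → v ≠ [] → E (i v) = i' v := by
    intro v hv hv'
    rcases PlaneTree.color_cases true v hv' with hc | ⟨u, j, rfl, hc⟩
    · exact hEb ⟨v, PlaneTree.mem_black.mpr ⟨hv, hc⟩⟩
    · have hu := t.parent_mem _ _ hv
      have hub : u ∈ t.black := PlaneTree.mem_black.mpr ⟨hu, hc⟩
      have hj := (t.append_mem_iff _ _).mp hv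
      have a1 := h.rot_pow hu (ne_nil_of_black hub) hj.1 hj.2
      have a2 := h'.rot_pow hu (ne_nil_of_black hub) hj.1 hj.2
      rw [hc] at a1 a2
      rw [← a1, ← a2, hEφj, hEb ⟨u, hub⟩]
  have hbij : Function.Bijective E := by
    constructor
    · intro x y hxy
      have hx := (e (c x) ⟨x, hcd x⟩).2
      have hy := (e (c y) ⟨y, hcd y⟩).2
      have hxy' : (e (c x) ⟨x, hcd x⟩).1 = (e (c y) ⟨y, hcd y⟩).1 := hxy
      rw [← hxy'] at hy
      have hcc := h'.black_unique hm' hx hy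
      have h2 := hE (c x) y (hcc ▸ hcd y)
      have h3 : (e (c x) ⟨x, hcd x⟩).1 = (e (c x) ⟨y, hcc ▸ hcd y⟩).1 := hxy.trans h2
      exact congrArg Subtype.val ((e (c x)).injective (Subtype.ext h3))
    · intro y
      obtain ⟨u, hu⟩ := h'.exists_black y
      obtain ⟨⟨x, hx⟩, hx'⟩ := (e u).surjective ⟨y, hu⟩
      refine ⟨x, ?_⟩
      rw [hE u x hx, hx']
  -- The components do not determine the turn around pinch points; on the boundary it is read from
  -- the tree, and elsewhere it is trivial.
  have hEcw : ∀ d, E (m.cw d) = m'.cw (E d) := by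
    intro d
    by_cases hd : m.IsBoundary d
    · obtain ⟨v, hv, hv', rfl⟩ := (h.surj d).mp hd
      obtain ⟨hr1, hr2⟩ := t.rotWord_mem false hv hv'
      have a1 : m.cw (i v) = _ := h.rot false v hv hv'
      have a2 : m'.cw (i' v) = _ := h'.rot false v hv hv'
      rw [a1, hEi _ hr1 hr2, hEi v hv hv', a2]
    · rw [m.cw_of_not hd, m'.cw_of_not]
      intro hd'
      obtain ⟨v, hv, hv', e⟩ := (h'.surj _).mp hd'
      rw [← hEi v hv hv'] at e
      exact hd (hbij.1 e ▸ h.isBoundary hv hv')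
  refine ⟨Equiv.ofBijective E hbij, fun d => ?_, hEα, ?_⟩
  -- Composed with `cw`, the rotation becomes the split rotation, with which `E` already commutes.
  · apply m'.cw.injective
    change m'.cw (E (m.σ d)) = m'.splitσ (E d)
    rw [← hEcw, ← hEσ]
    rfl
  · change E m.root = m'.root
    rw [← h.root, ← h'.root]
    exact hEi _ h.one_mem (by simp)

end Encodes

/-! ### Gluing components along a plane tree -/

theorem minimalPeriod_φ_root (m : CMap D) : Function.minimalPeriod m.φ m.root = m.perimeter := by
  rw [← card_sameCycle]
  refine Nat.card_congr (Equiv.subtypeEquivRight fun y => ?_)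
  rw [Equiv.Perm.sameCycle_comm]
  exact (m.isBoundary_iff y).symm

end CMap

/-- From `b`, the permutation `S⁻¹ * w` enters the `S`-cycle of `w b` and then follows it backwards,
as `w` is the identity off `B`. The first point of `B` met is `w b`, the only one on that cycle.
Hence splitting undoes gluing. -/
theorem firstReturn_of_cut {D : Type} [Finite D] {S w : Equiv.Perm D} {B : D → Prop}
    (hwB : ∀ x, B (w x) ↔ B x) (hw : ∀ x, ¬ B x → w x = x)
    (hS : ∀ x y, B x → B y → S.SameCycle x y → x = y) : firstReturn (w⁻¹ * S)⁻¹ B = w := by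
  ext b
  by_cases hb : B b
  · have hy : B (w b) := (hwB b).mpr hb
    set n := Function.minimalPeriod (S⁻¹ : Equiv.Perm D) (w b) with hn
    have hpos : 0 < n := minimalPeriod_perm_pos _ _
    have hmem : ∀ i, 1 ≤ i → i < n → ¬ B ((S⁻¹ ^ i) (w b)) := by
      intro i h1 h2 h3
      have : S.SameCycle (w b) ((S⁻¹ ^ i) (w b)) :=
        Equiv.Perm.sameCycle_inv.mp
          (Equiv.Perm.sameCycle_pow_right.mpr (Equiv.Perm.SameCycle.refl _ _))
      exact pow_apply_ne _ _ h1 h2 (hS _ _ hy h3 this).symm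
    have key : ∀ i, 1 ≤ i → i ≤ n → (((w⁻¹ * S)⁻¹) ^ i) b = (S⁻¹ ^ i) (w b) := by
      intro i h1
      induction i, h1 using Nat.le_induction with
      | base => intro _; simp [mul_inv_rev]
      | succ i h1 ih =>
        intro h2
        rw [pow_succ', Equiv.Perm.mul_apply, ih (by omega), pow_succ', Equiv.Perm.mul_apply,
          mul_inv_rev, inv_inv, Equiv.Perm.mul_apply, hw _ (hmem i h1 (by omega))]
    have hret : (((w⁻¹ * S)⁻¹) ^ n) b = w b := by
      rw [key n hpos le_rfl, hn, pow_minimalPeriod_apply]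
    rw [firstReturn_eq hb hpos, hret]
    · rw [hret]; exact hy
    · intro i h1 h2
      rw [key i h1 h2.le]
      exact hmem i h1 h2
  · rw [firstReturn_of_not hb, hw b hb]

section SigmaPerm

variable {U : Type} {E : U → Type}

theorem sigmaPerm_pow_apply (f : ∀ u, Equiv.Perm (E u)) (n : ℕ) (u : U) (d : E u) :
    (Equiv.Perm.sigmaCongrRight f ^ n) ⟨u, d⟩ = ⟨u, (f u ^ n) d⟩ := by
  induction n with
  | zero => rfl
  | succ n ih => rw [pow_succ', Equiv.Perm.mul_apply, ih, pow_succ', Equiv.Perm.mul_apply]; rfl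

variable [Finite U] [∀ u, Finite (E u)]

theorem sameCycle_sigma (f : ∀ u, Equiv.Perm (E u)) (u : U) (d d' : E u) :
    (Equiv.Perm.sigmaCongrRight f).SameCycle ⟨u, d⟩ ⟨u, d'⟩ ↔ (f u).SameCycle d d' := by
  constructor
  · intro h
    obtain ⟨n, hn⟩ := h.exists_nat_pow_eq
    rw [sigmaPerm_pow_apply] at hn
    have hn' : (f u ^ n) d = d' := eq_of_heq (Sigma.mk.inj hn).2
    exact ⟨n, by rw [← hn']; rfl⟩
  · intro h
    obtain ⟨n, rfl⟩ := h.exists_nat_pow_eq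
    rw [← sigmaPerm_pow_apply]
    exact Equiv.Perm.sameCycle_pow_right.mpr (Equiv.Perm.SameCycle.refl _ _)

theorem fst_eq_of_sameCycle_sigma (f : ∀ u, Equiv.Perm (E u)) {x y : Σ u, E u}
    (h : (Equiv.Perm.sigmaCongrRight f).SameCycle x y) : x.1 = y.1 :=
  sameCycle_invariant (v := fun x : Σ u, E u => x.1) (fun _ => rfl) h

theorem cyc_sigma [Fintype U] (f : ∀ u, Equiv.Perm (E u)) :
    cyc (Equiv.Perm.sigmaCongrRight f) = ∑ u, cyc (f u) := by
  unfold cyc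
  rw [← Nat.card_sigma]
  refine (Nat.card_congr (Equiv.ofBijective
    (fun z : Σ u, Quotient (Equiv.Perm.SameCycle.setoid (f u)) =>
      Quotient.map' (s₁ := Equiv.Perm.SameCycle.setoid (f z.1))
        (s₂ := Equiv.Perm.SameCycle.setoid (Equiv.Perm.sigmaCongrRight f))
        (fun d => (⟨z.1, d⟩ : Σ u, E u))
        (fun a b h => (sameCycle_sigma f z.1 a b).mpr h) z.2) ⟨?_, ?_⟩)).symm
  · rintro ⟨u, a⟩ ⟨v, b⟩ h
    induction a using Quotient.inductionOn with
    | h a =>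
      induction b using Quotient.inductionOn with
      | h b =>
        have h' : (Equiv.Perm.sigmaCongrRight f).SameCycle ⟨u, a⟩ ⟨v, b⟩ := Quotient.exact h
        have huv : u = v := fst_eq_of_sameCycle_sigma f h'
        subst huv
        rw [sameCycle_sigma] at h'
        congr 1
        exact Quotient.sound h'
  · intro c
    induction c using Quotient.inductionOn with
    | h x => exact ⟨⟨x.1, Quotient.mk _ x.2⟩, rfl⟩

end SigmaPerm

namespace Glue

variable {t : PlaneTree} {E : t.black → Type} (c : ∀ u, CMap (E u))

/-- The boundary darts of the components. -/
def Bdry (x : Σ u, E u) : Prop := (c x.1).IsBoundary x.2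

/-- The rotation in the disjoint union of the components. -/
def vertPerm : Equiv.Perm (Σ u, E u) := Equiv.Perm.sigmaCongrRight fun u => (c u).σ

def edgePerm : Equiv.Perm (Σ u, E u) := Equiv.Perm.sigmaCongrRight fun u => (c u).α

def facePerm : Equiv.Perm (Σ u, E u) := Equiv.Perm.sigmaCongrRight fun u => (c u).φ

theorem bdry_facePerm (x : Σ u, E u) : Bdry c (facePerm c x) ↔ Bdry c x :=
  (c x.1).isBoundary_φ x.2

theorem center_mem_black (v : t.Nonroot) : PlaneTree.center true v.1 ∈ t.black := by
  rw [PlaneTree.mem_black]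
  rcases PlaneTree.color_cases true v.1 v.2.2 with h | ⟨u, j, h, hu⟩
  · rw [← h, PlaneTree.center_self]; exact ⟨v.2.1, rfl⟩
  · rw [← hu, h, PlaneTree.center_append]; exact ⟨t.parent_mem _ _ (h ▸ v.2.1), rfl⟩

/-- The position of an edge of the tree around its black endpoint. -/
def position (v : List ℕ) : ℕ := if wordColor v = true then 0 else v.getLastD 0

/-- The boundary dart that corresponds to an edge of the tree. -/
def dart (v : t.Nonroot) : Σ u, E u :=
  ⟨⟨PlaneTree.center true v.1, center_mem_black v⟩,
    ((c _).φ⁻¹ ^ position v.1) (c ⟨PlaneTree.center true v.1, center_mem_black v⟩).root⟩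

theorem dart_eq (v : t.Nonroot) (u : t.black) (n : ℕ) (hu : PlaneTree.center true v.1 = u)
    (hn : position v.1 = n) : dart c v = ⟨u, ((c u).φ⁻¹ ^ n) (c u).root⟩ := by
  obtain ⟨u, hub⟩ := u
  change PlaneTree.center true v.1 = u at hu
  subst hu hn
  rfl

theorem dart_black (v : t.Nonroot) (hv : wordColor v.1 = true) :
    dart c v = ⟨⟨v.1, PlaneTree.mem_black.mpr ⟨v.2.1, hv⟩⟩, (c _).root⟩ := by
  rw [dart_eq c v ⟨v.1, PlaneTree.mem_black.mpr ⟨v.2.1, hv⟩⟩ 0]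
  · rfl
  · simp [PlaneTree.center, hv]
  · simp [position, hv]

theorem dart_append (u : List ℕ) (j : ℕ) (hv : u ++ [j] ∈ t.verts ∧ u ++ [j] ≠ [])
    (hu : u ∈ t.black) :
    dart c ⟨u ++ [j], hv⟩ = ⟨⟨u, hu⟩, ((c ⟨u, hu⟩).φ⁻¹ ^ j) (c ⟨u, hu⟩).root⟩ := by
  have hc := (PlaneTree.mem_black.mp hu).2
  refine dart_eq c _ ⟨u, hu⟩ j ?_ ?_
  · rw [← hc, PlaneTree.center_append]
  · simp [position, hc]

theorem bdry_dart (v : t.Nonroot) : Bdry c (dart c v) := by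
  change (c _).IsBoundary _
  rw [CMap.isBoundary_iff, ← Equiv.Perm.sameCycle_inv]
  exact Equiv.Perm.sameCycle_pow_left.mpr (Equiv.Perm.SameCycle.refl _ _)

theorem nonroot_cases (v : t.Nonroot) : wordColor v.1 = true ∨
    ∃ u j, ∃ hv : u ++ [j] ∈ t.verts ∧ u ++ [j] ≠ [], ∃ _ : u ∈ t.black,
      v = ⟨u ++ [j], hv⟩ ∧ 1 ≤ j ∧ j ≤ t.numChildren u := by
  obtain ⟨v, hv⟩ := v
  rcases PlaneTree.color_cases true v hv.2 with h | ⟨u, j, rfl, hu⟩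
  · exact Or.inl h
  · exact Or.inr ⟨u, j, hv, PlaneTree.mem_black.mpr ⟨t.parent_mem _ _ hv.1, hu⟩, rfl,
      (t.append_mem_iff _ _).mp hv.1⟩

/-- The labelling of the boundary of the glued map. -/
def label (ht : [1] ∈ t.verts) (u : List ℕ) : Σ u, E u :=
  if h : u ∈ t.verts ∧ u ≠ [] then dart c ⟨u, h⟩ else dart c ⟨[1], ht, by simp⟩

theorem label_eq (ht : [1] ∈ t.verts) (v : t.Nonroot) : label c ht v.1 = dart c v := by
  rw [label, dif_pos v.2]

theorem label_black (ht : [1] ∈ t.verts) (u : t.black) : label c ht u = ⟨u, (c u).root⟩ := by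
  obtain ⟨u, hu⟩ := u
  obtain ⟨hu1, hu2⟩ := PlaneTree.mem_black.mp hu
  rw [label_eq c ht ⟨u, hu1, CMap.Encodes.ne_nil_of_black hu⟩, dart_black c _ hu2]

variable [∀ u, Finite (E u)]
variable (hp : ∀ u : t.black, (c u).perimeter = t.numChildren u + 1)

include hp in
theorem minimalPeriod_root (u : t.black) :
    Function.minimalPeriod ((c u).φ⁻¹ : Equiv.Perm (E u)) (c u).root = t.numChildren u + 1 := by
  rw [minimalPeriod_inv, CMap.minimalPeriod_φ_root, hp]

include hp in
theorem dart_injective : Function.Injective (dart c) := by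
  intro v w h
  rcases nonroot_cases v with hv | ⟨u, j, hv, hu, rfl, hj⟩ <;>
    rcases nonroot_cases w with hw | ⟨u', j', hw, hu', rfl, hj'⟩
  · rw [dart_black c v hv, dart_black c w hw] at h
    exact Subtype.ext (congrArg (fun x => x.1.1) h)
  · rw [dart_black c v hv, dart_append c u' j' hw hu'] at h
    have h1 := (Sigma.mk.inj h).1
    have hvu : v.1 = u' := congrArg Subtype.val h1
    subst hvu
    have h2 := eq_of_heq (Sigma.mk.inj h).2
    refine absurd h2.symm (pow_apply_ne _ _ hj'.1 ?_)
    rw [minimalPeriod_root c hp]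
    exact Nat.lt_succ_of_le hj'.2
  · rw [dart_black c w hw, dart_append c u j hv hu] at h
    have h1 := (Sigma.mk.inj h).1
    have hvu : u = w.1 := congrArg Subtype.val h1
    subst hvu
    have h2 := eq_of_heq (Sigma.mk.inj h).2
    refine absurd h2 (pow_apply_ne _ _ hj.1 ?_)
    rw [minimalPeriod_root c hp]
    exact Nat.lt_succ_of_le hj.2
  · rw [dart_append c u j hv hu, dart_append c u' j' hw hu'] at h
    have h1 := (Sigma.mk.inj h).1
    have hvu : u = u' := congrArg Subtype.val h1
    subst hvu
    have h2 := eq_of_heq (Sigma.mk.inj h).2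
    have h3 := pow_apply_inj _ _ (by rw [minimalPeriod_root c hp]; exact Nat.lt_succ_of_le hj.2)
      (by rw [minimalPeriod_root c hp]; exact Nat.lt_succ_of_le hj'.2) h2
    subst h3
    rfl

include hp in
theorem exists_dart (x : Σ u, E u) (hx : Bdry c x) : ∃ v, dart c v = x := by
  obtain ⟨⟨u, hu⟩, d⟩ := x
  have hx' : (c ⟨u, hu⟩).IsBoundary d := hx
  rw [CMap.isBoundary_iff, ← Equiv.Perm.sameCycle_inv, Equiv.Perm.sameCycle_comm] at hx'
  obtain ⟨j, hj, rfl⟩ := exists_pow_lt_minimalPeriod hx'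
  rw [minimalPeriod_root c hp] at hj
  obtain ⟨hu1, hu2⟩ := PlaneTree.mem_black.mp hu
  rcases Nat.eq_zero_or_pos j with h0 | h0
  · subst h0
    exact ⟨⟨u, hu1, CMap.Encodes.ne_nil_of_black hu⟩, dart_black c _ hu2⟩
  · exact ⟨⟨u ++ [j], (t.append_mem_iff _ _).mpr ⟨h0, Nat.le_of_lt_succ hj⟩, by simp⟩,
      dart_append c u j _ hu⟩

/-- The correspondence between the edges of the tree and the boundary darts. -/
def dartEquiv : t.Nonroot ≃ {x // Bdry c x} :=
  Equiv.ofBijective (fun v => ⟨dart c v, bdry_dart c v⟩)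
    ⟨fun _ _ h => dart_injective c hp (congrArg Subtype.val h), fun x => by
      obtain ⟨v, hv⟩ := exists_dart c hp x.1 x.2
      exact ⟨v, Subtype.ext hv⟩⟩

/-- The rotation of the boundary darts around the vertices of the glued map. -/
def cwPerm : Equiv.Perm (Σ u, E u) := (t.rotPerm false).extendDomain (dartEquiv c hp)

theorem cwPerm_dart (v : t.Nonroot) : cwPerm c hp (dart c v) = dart c (t.rotPerm false v) :=
  Equiv.Perm.extendDomain_apply_image (t.rotPerm false) (dartEquiv c hp) v

theorem cwPerm_of_not (x : Σ u, E u) (hx : ¬ Bdry c x) : cwPerm c hp x = x :=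
  Equiv.Perm.extendDomain_apply_not_subtype (t.rotPerm false) (dartEquiv c hp) hx

theorem bdry_cwPerm (x : Σ u, E u) : Bdry c (cwPerm c hp x) ↔ Bdry c x := by
  by_cases hx : Bdry c x
  · obtain ⟨v, rfl⟩ := exists_dart c hp x hx
    rw [cwPerm_dart]
    exact iff_of_true (bdry_dart _ _) hx
  · rw [cwPerm_of_not c hp x hx]

theorem bdry_cwPerm_inv (x : Σ u, E u) : Bdry c ((cwPerm c hp)⁻¹ x) ↔ Bdry c x := by
  rw [← bdry_cwPerm c hp]
  exact iff_of_eq (congrArg (Bdry c) (Equiv.apply_symm_apply (cwPerm c hp) x))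

theorem cwPerm_inv_of_not (x : Σ u, E u) (hx : ¬ Bdry c x) : (cwPerm c hp)⁻¹ x = x := by
  conv_lhs => rw [← cwPerm_of_not c hp x hx]
  exact Equiv.symm_apply_apply _ _

-- Turning clockwise around a black vertex is going backwards along the contour of its component.
-- The two close up together because the perimeter is the number of children plus one.
include hp in
theorem facePerm_inv_dart (v : t.Nonroot) :
    (facePerm c)⁻¹ (dart c v) = dart c (t.rotPerm true v) := by
  have hinv : ∀ u (d : E u), (facePerm c)⁻¹ ⟨u, d⟩ = ⟨u, (c u).φ⁻¹ d⟩ := fun u d => rfl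
  rcases nonroot_cases v with hv | ⟨u, j, hv, hu, rfl, hj⟩
  · rw [dart_black c v hv, hinv]
    have hvb : v.1 ∈ t.black := PlaneTree.mem_black.mpr ⟨v.2.1, hv⟩
    by_cases h : 1 ≤ t.numChildren v.1
    · have e : t.rotPerm true v = ⟨v.1 ++ [1], (t.append_mem_iff _ _).mpr ⟨le_rfl, h⟩, by simp⟩ := by
        apply Subtype.ext
        rw [PlaneTree.rotPerm_apply]
        conv_lhs => rw [← hv]
        rw [PlaneTree.rotWord_self, if_pos h]
      rw [e, dart_append c v.1 1 _ hvb, pow_one]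
    · have e : t.rotPerm true v = v := by
        apply Subtype.ext
        rw [PlaneTree.rotPerm_apply]
        conv_lhs => rw [← hv]
        rw [PlaneTree.rotWord_self, if_neg h]
      rw [e, dart_black c v hv]
      have h1 := minimalPeriod_root c hp ⟨v.1, hvb⟩
      have h2 := pow_minimalPeriod_apply ((c ⟨v.1, hvb⟩).φ⁻¹) (c ⟨v.1, hvb⟩).root
      have h3 : t.numChildren v.1 = 0 := by omega
      rw [h1, h3, zero_add, pow_one] at h2
      rw [h2]
  · have hc := (PlaneTree.mem_black.mp hu).2
    rw [dart_append c u j hv hu, hinv, ← Equiv.Perm.mul_apply, ← pow_succ']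
    by_cases h : j < t.numChildren u
    · have e : t.rotPerm true ⟨u ++ [j], hv⟩ =
          ⟨u ++ [j + 1], (t.append_mem_iff _ _).mpr ⟨by omega, h⟩, by simp⟩ := by
        apply Subtype.ext
        rw [PlaneTree.rotPerm_apply, ← hc, PlaneTree.rotWord_append, if_pos h]
      rw [e, dart_append c u (j + 1) _ hu]
    · have hu' := CMap.Encodes.ne_nil_of_black hu
      have e : t.rotPerm true ⟨u ++ [j], hv⟩ = ⟨u, t.parent_mem _ _ hv.1, hu'⟩ := by
        apply Subtype.ext
        rw [PlaneTree.rotPerm_apply, ← hc, PlaneTree.rotWord_append, if_neg h, if_neg hu']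
      rw [e, dart_black c _ hc]
      have h1 := minimalPeriod_root c hp ⟨u, hu⟩
      have h2 := pow_minimalPeriod_apply ((c ⟨u, hu⟩).φ⁻¹) (c ⟨u, hu⟩).root
      rw [h1] at h2
      have h4 : j + 1 = t.numChildren u + 1 := by omega
      have h5 : ((c ⟨u, hu⟩).φ⁻¹ ^ (j + 1)) (c ⟨u, hu⟩).root = (c ⟨u, hu⟩).root := by
        rw [h4]; exact h2
      rw [h5]

include hp in
theorem facePerm_dart (v : t.Nonroot) :
    facePerm c (dart c v) = dart c ((t.rotPerm true)⁻¹ v) := by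
  have h := facePerm_inv_dart c hp ((t.rotPerm true)⁻¹ v)
  rw [show t.rotPerm true ((t.rotPerm true)⁻¹ v) = v from Equiv.apply_symm_apply _ _] at h
  rw [← h]
  exact Equiv.apply_symm_apply _ _

theorem contour_dart (v : t.Nonroot) :
    ((cwPerm c hp)⁻¹ * facePerm c) (dart c v) =
      dart c (((t.rotPerm false)⁻¹ * (t.rotPerm true)⁻¹) v) := by
  rw [Equiv.Perm.mul_apply, facePerm_dart c hp, Equiv.Perm.mul_apply]
  apply (cwPerm c hp).injective
  rw [cwPerm_dart]
  exact (Equiv.apply_symm_apply _ _).trans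
    (congrArg (dart c) (Equiv.apply_symm_apply _ _).symm)

theorem contour_pow_dart (n : ℕ) (v : t.Nonroot) :
    (((cwPerm c hp)⁻¹ * facePerm c) ^ n) (dart c v) =
      dart c ((((t.rotPerm false)⁻¹ * (t.rotPerm true)⁻¹) ^ n) v) := by
  induction n with
  | zero => rfl
  | succ n ih =>
    rw [pow_succ', Equiv.Perm.mul_apply, ih, contour_dart, pow_succ']
    rfl

variable (ht : [1] ∈ t.verts)

-- On boundary darts the face permutation of the glued map is the contour of the tree, which is a
-- single cycle: the boundaries of all components merge into one face.
include ht in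
theorem sameCycle_contour (x y : Σ u, E u) (hx : Bdry c x) (hy : Bdry c y) :
    ((cwPerm c hp)⁻¹ * facePerm c).SameCycle x y := by
  obtain ⟨v, rfl⟩ := exists_dart c hp x hx
  obtain ⟨w, rfl⟩ := exists_dart c hp y hy
  obtain ⟨n, rfl⟩ := (t.contour_sameCycle ht v w).exists_nat_pow_eq
  rw [← contour_pow_dart c hp]
  exact Equiv.Perm.sameCycle_pow_right.mpr (Equiv.Perm.SameCycle.refl _ _)

/-- The map obtained by gluing the components along the tree. -/
def glue : CMap (Σ u, E u) where
  σ := (cwPerm c hp)⁻¹ * vertPerm c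
  α := edgePerm c
  root := dart c ⟨[1], ht, by simp⟩
  involutive x := by
    obtain ⟨u, d⟩ := x
    exact congrArg (Sigma.mk u) ((c u).involutive d)
  ne_self x := by
    obtain ⟨u, d⟩ := x
    intro h
    exact (c u).ne_self d (eq_of_heq (Sigma.mk.inj h).2)
  connected := by
    set R := Relation.EqvGen (Step ((cwPerm c hp)⁻¹ * vertPerm c) (edgePerm c)) with hR
    have hσ : ∀ x, R x (((cwPerm c hp)⁻¹ * vertPerm c) x) := fun x =>
      Relation.EqvGen.rel _ _ (Or.inl rfl)
    have hα : ∀ x, R x (edgePerm c x) := fun x => Relation.EqvGen.rel _ _ (Or.inr rfl)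
    have trans : ∀ {x y z}, R x y → R y z → R x z := fun h h' => Relation.EqvGen.trans _ _ _ h h'
    have symm : ∀ {x y}, R x y → R y x := fun h => Relation.EqvGen.symm _ _ h
    -- Boundary darts of all the components are joined along the merged face.
    have h1 : ∀ x y, Bdry c x → Bdry c y → R x y := by
      intro x y hx hy
      have := sameCycle_invariant (v := fun z => R x z) (fun z => ?_)
        (sameCycle_contour c hp ht x y hx hy)
      · exact this.mp (Relation.EqvGen.refl _)
      · have h2 : R z (((cwPerm c hp)⁻¹ * facePerm c) z) := trans (hα z) (hσ (edgePerm c z))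
        exact propext ⟨fun h => trans h (symm h2), fun h => trans h h2⟩
    -- Inside a component the glued rotation deviates from the original one only upon reaching a
    -- boundary dart.
    have h2 : ∀ x, ∃ b, Bdry c b ∧ R x b := by
      rintro ⟨u, d⟩
      have := eqvGen_invariant (v := fun d : E u => ∃ b, Bdry c b ∧ R ⟨u, d⟩ b)
        (fun d => ?_) (fun d => ?_) ((c u).connected (c u).root d)
      · exact this.mp ⟨⟨u, (c u).root⟩, (c u).isBoundary_root, Relation.EqvGen.refl _⟩
      · refine propext ?_
        have e : vertPerm c ⟨u, d⟩ = ⟨u, (c u).σ d⟩ := rfl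
        have h3 := hσ ⟨u, d⟩
        rw [Equiv.Perm.mul_apply, e] at h3
        by_cases hd : Bdry c ⟨u, (c u).σ d⟩
        · exact iff_of_true ⟨_, hd, Relation.EqvGen.refl _⟩
            ⟨_, (bdry_cwPerm_inv c hp _).mpr hd, h3⟩
        · rw [cwPerm_inv_of_not c hp _ hd] at h3
          exact ⟨fun ⟨b, hb, hr⟩ => ⟨b, hb, trans h3 hr⟩,
            fun ⟨b, hb, hr⟩ => ⟨b, hb, trans (symm h3) hr⟩⟩
      · have h3 : R ⟨u, d⟩ ⟨u, (c u).α d⟩ := hα ⟨u, d⟩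
        exact propext ⟨fun ⟨b, hb, hr⟩ => ⟨b, hb, trans h3 hr⟩,
          fun ⟨b, hb, hr⟩ => ⟨b, hb, trans (symm h3) hr⟩⟩
    intro x y
    obtain ⟨b, hb, hxb⟩ := h2 x
    obtain ⟨b', hb', hyb⟩ := h2 y
    exact trans hxb (trans (h1 b b' hb hb') (symm hyb))

theorem glue_φ : (glue c hp ht).φ = (cwPerm c hp)⁻¹ * facePerm c := rfl

theorem glue_isBoundary (x : Σ u, E u) : (glue c hp ht).IsBoundary x ↔ Bdry c x := by
  rw [CMap.isBoundary_iff, glue_φ]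
  have hr : Bdry c (glue c hp ht).root := bdry_dart c _
  constructor
  · intro h
    refine (iff_of_eq (sameCycle_invariant (v := Bdry c) (fun z => propext ?_) h)).mpr hr
    rw [Equiv.Perm.mul_apply, bdry_cwPerm_inv, bdry_facePerm]
  · intro h
    exact sameCycle_contour c hp ht _ _ h hr

variable (hs : ∀ u, (c u).HasSimpleBoundary)

-- Simplicity of the boundaries is what makes gluing reversible: a vertex of a component carries at
-- most one boundary dart, as `firstReturn_of_cut` requires.
include hs in
theorem glue_cw : (glue c hp ht).cw = cwPerm c hp := by
  have hB : (glue c hp ht).IsBoundary = Bdry c := funext fun x => propext (glue_isBoundary c hp ht x)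
  rw [CMap.cw, hB]
  refine firstReturn_of_cut (bdry_cwPerm c hp) (cwPerm_of_not c hp) ?_
  rintro ⟨u, d⟩ ⟨v, d'⟩ hx hy h
  have huv : u = v := fst_eq_of_sameCycle_sigma (fun u => (c u).σ) h
  subst huv
  have h' := (sameCycle_sigma (fun u => (c u).σ) _ _ _).mp h
  rw [hs u d d' hx hy (((c u).origin_eq_origin d d').mpr h')]

include hs in
theorem glue_splitσ : (glue c hp ht).splitσ = vertPerm c := by
  rw [CMap.splitσ, glue_cw c hp ht hs]
  exact mul_inv_cancel_left _ _

include hs in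
theorem glue_splitφ : (glue c hp ht).splitφ = facePerm c := by
  rw [CMap.splitφ, glue_splitσ c hp ht hs]
  rfl

include hs in
theorem glue_encodes : (glue c hp ht).Encodes t (label c ht) := by
  refine ⟨ht, label_eq c ht ⟨[1], ht, by simp⟩, ?_, ?_, ?_⟩
  · intro u v hu hu' hv hv' e
    rw [label_eq c ht ⟨u, hu, hu'⟩, label_eq c ht ⟨v, hv, hv'⟩] at e
    exact congrArg Subtype.val (dart_injective c hp e)
  · intro d
    rw [glue_isBoundary]
    constructor
    · intro h
      obtain ⟨v, rfl⟩ := exists_dart c hp d h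
      exact ⟨v.1, v.2.1, v.2.2, label_eq c ht v⟩
    · rintro ⟨u, hu, hu', rfl⟩
      rw [label_eq c ht ⟨u, hu, hu'⟩]
      exact bdry_dart c _
  · intro b u hu hu'
    rw [label_eq c ht ⟨u, hu, hu'⟩]
    have key : label c ht (t.rotWord b u) = dart c (t.rotPerm b ⟨u, hu, hu'⟩) :=
      label_eq c ht (t.rotPerm b ⟨u, hu, hu'⟩)
    rw [key]
    cases b
    · change (glue c hp ht).cw _ = _
      rw [glue_cw c hp ht hs, cwPerm_dart]
    · change (glue c hp ht).splitφ⁻¹ _ = _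
      rw [glue_splitφ c hp ht hs, facePerm_inv_dart c hp]

-- After splitting, the permutations act inside each summand, and each summand is connected.
include hs in
theorem glue_component_iso (u : t.black) :
    (c u).Iso ((glue c hp ht).component (label c ht u)) := by
  rw [label_black]
  have hσ := glue_splitσ c hp ht hs
  have hcomp : ∀ d : E u, (glue c hp ht).SameComponent ⟨u, (c u).root⟩ ⟨u, d⟩ := by
    intro d
    have := eqvGen_invariant
      (v := fun d : E u => (glue c hp ht).SameComponent ⟨u, (c u).root⟩ ⟨u, d⟩)
      (fun d => ?_) (fun d => ?_) ((c u).connected (c u).root d)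
    · exact this.mp (Relation.EqvGen.refl _)
    · have e : (⟨u, (c u).σ d⟩ : Σ u, E u) = (glue c hp ht).splitσ ⟨u, d⟩ := by rw [hσ]; rfl
      rw [e, CMap.sameComponent_splitσ]
    · have e : (⟨u, (c u).α d⟩ : Σ u, E u) = (glue c hp ht).α ⟨u, d⟩ := rfl
      rw [e, CMap.sameComponent_α]
  have hfst : ∀ x, (glue c hp ht).SameComponent ⟨u, (c u).root⟩ x → u = x.1 := by
    intro x hx
    exact eqvGen_invariant (v := fun x : Σ u, E u => x.1) (fun x => by rw [hσ]; rfl)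
      (fun x => rfl) hx
  refine ⟨Equiv.ofBijective (fun d => ⟨⟨u, d⟩, hcomp d⟩) ⟨?_, ?_⟩, ?_, ?_, ?_⟩
  · intro d d' h
    exact eq_of_heq (Sigma.mk.inj (congrArg Subtype.val h)).2
  · rintro ⟨⟨v, d⟩, h⟩
    obtain rfl : u = v := hfst _ h
    exact ⟨d, rfl⟩
  · intro d
    apply Subtype.ext
    change (⟨u, (c u).σ d⟩ : Σ u, E u) = (glue c hp ht).splitσ ⟨u, d⟩
    rw [hσ]; rfl
  · intro d; rfl
  · rfl

-- Only the lower bound in Euler's formula is needed. Vertices are bounded below by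
-- `cyc_add_cyc_le`; faces are those of the components, with the contours merged into one. Planarity
-- of the components, the vertex count of the tree, and the genus inequality on the boundary for the
-- number of contours complete the sum.
include hs in
theorem glue_isPlanar (hpl : ∀ u, (c u).IsPlanar) : (glue c hp ht).IsPlanar := by
  set m := glue c hp ht with hm
  rw [CMap.isPlanar_iff]
  have hle := m.euler_le
  set p := Nat.card {d // m.IsBoundary d} with hpdef
  -- the tree
  have hcardp : Nat.card t.Nonroot = p :=
    Nat.card_congr ((dartEquiv c hp).trans
      (Equiv.subtypeEquivRight fun x => (glue_isBoundary c hp ht x).symm))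
  have h1 := t.card_nonroot
  have h2 := t.card_white_add_card_black
  -- rotations
  have hwhite : t.white.card ≤ cyc m.bdryCw := by
    refine (t.card_colored_le_cyc ht false t.white (fun u => PlaneTree.mem_white)).trans ?_
    refine Nat.card_le_card_of_surjective
      (Quotient.map' (s₁ := Equiv.Perm.SameCycle.setoid m.bdryCw)
        (s₂ := Equiv.Perm.SameCycle.setoid (t.rotPerm false))
        (fun x => (dartEquiv c hp).symm ⟨x.1, (glue_isBoundary c hp ht x.1).mp x.2⟩) ?_) ?_
    · intro x y hxy
      refine (iff_of_eq (sameCycle_invariant (v := fun z : {d // m.IsBoundary d} =>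
        (t.rotPerm false).SameCycle
          ((dartEquiv c hp).symm ⟨x.1, (glue_isBoundary c hp ht x.1).mp x.2⟩)
          ((dartEquiv c hp).symm ⟨z.1, (glue_isBoundary c hp ht z.1).mp z.2⟩))
        (fun z => propext ?_) hxy)).mp (Equiv.Perm.SameCycle.refl _ _)
      obtain ⟨v, hv⟩ := exists_dart c hp z.1 ((glue_isBoundary c hp ht z.1).mp z.2)
      have e1 : (dartEquiv c hp).symm ⟨z.1, (glue_isBoundary c hp ht z.1).mp z.2⟩ = v := by
        rw [Equiv.symm_apply_eq]; exact Subtype.ext hv.symm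
      have e2 : (dartEquiv c hp).symm ⟨(m.bdryCw z).1,
          (glue_isBoundary c hp ht (m.bdryCw z).1).mp (m.bdryCw z).2⟩ = t.rotPerm false v := by
        rw [Equiv.symm_apply_eq]
        apply Subtype.ext
        change m.cw z.1 = dart c (t.rotPerm false v)
        have e3 : m.cw = cwPerm c hp := glue_cw c hp ht hs
        rw [e3, ← hv, cwPerm_dart]
      rw [e1, e2, Equiv.Perm.sameCycle_apply_right]
    · intro q
      induction q using Quotient.inductionOn with
      | h v =>
        refine ⟨Quotient.mk _ ⟨dart c v, (glue_isBoundary c hp ht _).mpr (bdry_dart c v)⟩, ?_⟩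
        exact congrArg (Quotient.mk _) ((dartEquiv c hp).symm_apply_apply v)
  have hg := genus_le m.bdryCw m.bdryφ
  rw [← CMap.bdrySplit_eq, CMap.cyc_bdryφ, CMap.orb_bdry] at hg
  have hf := m.cyc_splitφ
  -- vertices
  have hv := cyc_add_cyc_le (cwPerm c hp)⁻¹ (vertPerm c)
  have e3 : cwPerm c hp = m.cw := (glue_cw c hp ht hs).symm
  have hcw := cyc_eq_add m.cw m.IsBoundary m.isBoundary_cw
  have hid : cyc (m.cw.subtypePerm (p := fun x => ¬ m.IsBoundary x)
      (fun x => not_congr (m.isBoundary_cw x))) = Nat.card {d // ¬ m.IsBoundary d} := by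
    have e : m.cw.subtypePerm (p := fun x => ¬ m.IsBoundary x)
      (fun x => not_congr (m.isBoundary_cw x)) = 1 := by
      refine Equiv.ext fun x => Subtype.ext ?_
      exact m.cw_of_not x.2
    rw [e]
    refine le_antisymm (Nat.card_le_card_of_surjective (Quotient.mk _) Quotient.mk_surjective) ?_
    exact card_le_cyc _ id (fun _ => rfl) Function.surjective_id
  have hn : Nat.card (Σ u, E u) = p + Nat.card {d // ¬ m.IsBoundary d} := by
    rw [hpdef, ← Nat.card_sum]
    exact Nat.card_congr (Equiv.sumCompl _).symm
  have hsum : cyc (vertPerm c) + cyc (edgePerm c) + cyc (facePerm c) =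
      Nat.card (Σ u, E u) + 2 * t.black.card := by
    rw [vertPerm, edgePerm, facePerm, cyc_sigma, cyc_sigma, cyc_sigma, ← Finset.sum_add_distrib,
      ← Finset.sum_add_distrib, Nat.card_sigma]
    rw [Finset.sum_congr rfl fun u _ => (CMap.isPlanar_iff (c u)).mp (hpl u),
      Finset.sum_add_distrib]
    simp [mul_comm]
  rw [glue_splitφ c hp ht hs] at hf
  have hα : m.α = edgePerm c := rfl
  have hσ : m.σ = (cwPerm c hp)⁻¹ * vertPerm c := rfl
  have hb : cyc m.bdryCw = cyc (m.cw.subtypePerm m.isBoundary_cw) := rfl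
  rw [← hσ, cyc_inv, e3] at hv
  rw [hα] at hle ⊢
  rw [hid] at hcw
  omega

end Glue

/-! ### Transport along isomorphisms -/

section Conj

variable {D D' : Type}

theorem conj_pow {e : D ≃ D'} {f : Equiv.Perm D} {f' : Equiv.Perm D'}
    (h : ∀ x, e (f x) = f' (e x)) (n : ℕ) (x : D) : e ((f ^ n) x) = (f' ^ n) (e x) := by
  induction n with
  | zero => rfl
  | succ n ih => rw [pow_succ', Equiv.Perm.mul_apply, h, ih, pow_succ', Equiv.Perm.mul_apply]

theorem conj_inv {e : D ≃ D'} {f : Equiv.Perm D} {f' : Equiv.Perm D'}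
    (h : ∀ x, e (f x) = f' (e x)) (x : D) : e (f⁻¹ x) = f'⁻¹ (e x) := by
  apply f'.injective
  rw [← h]
  exact (congrArg e (Equiv.apply_symm_apply f x)).trans (Equiv.apply_symm_apply f' (e x)).symm

variable [Finite D] [Finite D']

theorem conj_sameCycle {e : D ≃ D'} {f : Equiv.Perm D} {f' : Equiv.Perm D'}
    (h : ∀ x, e (f x) = f' (e x)) (x y : D) : f'.SameCycle (e x) (e y) ↔ f.SameCycle x y := by
  constructor
  · intro hs
    obtain ⟨n, hn⟩ := hs.exists_nat_pow_eq
    rw [← conj_pow h, e.injective.eq_iff] at hn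
    exact ⟨n, hn⟩
  · intro hs
    obtain ⟨n, rfl⟩ := hs.exists_nat_pow_eq
    exact ⟨n, (conj_pow h n x).symm⟩

theorem conj_minimalPeriod {e : D ≃ D'} {f : Equiv.Perm D} {f' : Equiv.Perm D'}
    (h : ∀ x, e (f x) = f' (e x)) (x : D) :
    Function.minimalPeriod f' (e x) = Function.minimalPeriod f x := by
  rw [← card_sameCycle, ← card_sameCycle]
  exact (Nat.card_congr (e.subtypeEquiv fun y => (conj_sameCycle h x y).symm)).symm

theorem conj_cyc {e : D ≃ D'} {f : Equiv.Perm D} {f' : Equiv.Perm D'}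
    (h : ∀ x, e (f x) = f' (e x)) : cyc f = cyc f' :=
  Nat.card_congr (Quotient.congr e fun x y => (conj_sameCycle h x y).symm)

theorem conj_firstReturn {e : D ≃ D'} {f : Equiv.Perm D} {f' : Equiv.Perm D'}
    (h : ∀ x, e (f x) = f' (e x)) {B : D → Prop} {B' : D' → Prop} (hB : ∀ x, B' (e x) ↔ B x)
    (x : D) : e (firstReturn f B x) = firstReturn f' B' (e x) := by
  by_cases hx : B x
  · obtain ⟨n, hn, e1, e2, e3⟩ := firstReturn_spec f hx
    rw [e1, firstReturn_eq ((hB x).mpr hx) hn, conj_pow h]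
    · rw [← conj_pow h, hB]; exact e2
    · intro i h1 h2
      rw [← conj_pow h, hB]; exact e3 i h1 h2
  · rw [firstReturn_of_not hx, firstReturn_of_not (fun h' => hx ((hB x).mp h'))]

end Conj

namespace CMap

variable {D D' : Type}

/-- The relabelling `e` is an isomorphism from `m` to `m'`. -/
structure IsIso (e : D ≃ D') (m : CMap D) (m' : CMap D') : Prop where
  σ : ∀ d, e (m.σ d) = m'.σ (e d)
  α : ∀ d, e (m.α d) = m'.α (e d)
  root : e m.root = m'.root

theorem iso_iff {m : CMap D} {m' : CMap D'} : m.Iso m' ↔ ∃ e, IsIso e m m' :=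
  ⟨fun ⟨e, h1, h2, h3⟩ => ⟨e, h1, h2, h3⟩, fun ⟨e, h1, h2, h3⟩ => ⟨e, h1, h2, h3⟩⟩

section Classifier

variable {Y : Type} {m : CMap D} {g : D → Y}

/-- The faces of a map in terms of a function with the faces as fibres. -/
def faceEquiv (hg : ∀ x y, g x = g y ↔ m.φ.SameCycle x y) (hs : Function.Surjective g) :
    m.Face ≃ Y :=
  Equiv.ofBijective (Quotient.lift g fun x y h => (hg x y).mpr h)
    ⟨fun a b => Quotient.inductionOn₂ a b fun x y h => Quotient.sound ((hg x y).mp h),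
      fun y => by
        obtain ⟨x, rfl⟩ := hs y
        exact ⟨Quotient.mk _ x, rfl⟩⟩

theorem faceEquiv_face (hg : ∀ x y, g x = g y ↔ m.φ.SameCycle x y) (hs : Function.Surjective g)
    (d : D) : faceEquiv hg hs (m.face d) = g d := rfl

theorem deg_eq_card_fiber (hg : ∀ x y, g x = g y ↔ m.φ.SameCycle x y)
    (hs : Function.Surjective g) (f : m.Face) :
    m.deg f = Nat.card {d // g d = faceEquiv hg hs f} := by
  refine Nat.card_congr (Equiv.subtypeEquivRight fun d => ?_)
  rw [← faceEquiv_face hg hs, (faceEquiv hg hs).injective.eq_iff]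

/-- The faces of glued maps, of the edge map and of maps with a chord are known through an explicit
classifying function; this avoids handling their quotients directly. -/
theorem weight_eq_prod [Finite D] [Fintype Y] (q : ℕ → ℝ≥0) (hg : ∀ x y, g x = g y ↔ m.φ.SameCycle x y)
    (hs : Function.Surjective g) : m.weight q =
      ∏ y : Y, if y = g m.root then 1 else (q (Nat.card {d // g d = y} / 2) : ℝ≥0∞) := by
  refine Fintype.prod_equiv (faceEquiv hg hs) _ _ fun f => ?_
  rw [deg_eq_card_fiber hg hs, ← faceEquiv_face hg hs m.root, (faceEquiv hg hs).injective.eq_iff]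
  by_cases hf : f = m.rootFace
  · rw [if_pos hf, if_pos (show f = m.face m.root from hf)]
  · rw [if_neg hf, if_neg (show ¬ f = m.face m.root from hf)]

theorem isBipartite_iff_fiber (hg : ∀ x y, g x = g y ↔ m.φ.SameCycle x y)
    (hs : Function.Surjective g) : m.IsBipartite ↔ ∀ y, Even (Nat.card {d // g d = y}) := by
  constructor
  · intro h y
    have := h ((faceEquiv hg hs).symm y)
    rwa [deg_eq_card_fiber hg hs, Equiv.apply_symm_apply] at this
  · intro h f
    rw [deg_eq_card_fiber hg hs]
    exact h _

theorem perimeter_eq_card_fiber (hg : ∀ x y, g x = g y ↔ m.φ.SameCycle x y)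
    (hs : Function.Surjective g) : m.perimeter = Nat.card {d // g d = g m.root} :=
  deg_eq_card_fiber hg hs m.rootFace

end Classifier

theorem face_surjective (m : CMap D) : Function.Surjective m.face := Quotient.mk_surjective

namespace IsIso

variable {m : CMap D} {m' : CMap D'} {e : D ≃ D'}

theorem φ (h : IsIso e m m') (d : D) : e (m.φ d) = m'.φ (e d) := by
  change e (m.σ (m.α d)) = m'.σ (m'.α (e d))
  rw [h.σ, h.α]

variable [Finite D] [Finite D']

theorem face_iff (h : IsIso e m m') (x y : D) :
    m'.face (e x) = m'.face (e y) ↔ m.φ.SameCycle x y := by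
  rw [face_eq_face, conj_sameCycle h.φ]

omit [Finite D] [Finite D'] in
theorem face_surj (_h : IsIso e m m') : Function.Surjective fun d => m'.face (e d) :=
  m'.face_surjective.comp e.surjective

omit [Finite D] [Finite D'] in
theorem card_fiber (_h : IsIso e m m') (f : m'.Face) :
    Nat.card {d // m'.face (e d) = f} = m'.deg f :=
  Nat.card_congr (e.subtypeEquiv fun _ => Iff.rfl)

theorem weight (h : IsIso e m m') (q : ℕ → ℝ≥0) : m.weight q = m'.weight q := by
  rw [weight_eq_prod q h.face_iff h.face_surj, CMap.weight]
  refine Finset.prod_congr rfl fun f _ => ?_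
  rw [h.card_fiber, h.root]
  by_cases hf : f = m'.rootFace
  · rw [if_pos hf, if_pos (show f = m'.face m'.root from hf)]
  · rw [if_neg hf, if_neg (show ¬ f = m'.face m'.root from hf)]

theorem isBipartite (h : IsIso e m m') : m.IsBipartite ↔ m'.IsBipartite := by
  rw [isBipartite_iff_fiber h.face_iff h.face_surj]
  exact forall_congr' fun f => by rw [h.card_fiber]

theorem perimeter (h : IsIso e m m') : m.perimeter = m'.perimeter := by
  rw [perimeter_eq_card_fiber h.face_iff h.face_surj, h.card_fiber, h.root]
  rfl

theorem isPlanar (h : IsIso e m m') : m.IsPlanar ↔ m'.IsPlanar := by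
  rw [isPlanar_iff, isPlanar_iff, conj_cyc h.σ, conj_cyc h.α, conj_cyc h.φ, Nat.card_congr e]

theorem isBoundary (h : IsIso e m m') (d : D) : m'.IsBoundary (e d) ↔ m.IsBoundary d := by
  rw [isBoundary_iff, isBoundary_iff, ← h.root, conj_sameCycle h.φ]

theorem hasSimpleBoundary (h : IsIso e m m') (hm : m.HasSimpleBoundary) :
    m'.HasSimpleBoundary := by
  intro d d' hd hd' ho
  obtain ⟨x, rfl⟩ := e.surjective d
  obtain ⟨y, rfl⟩ := e.surjective d'
  rw [h.isBoundary] at hd hd'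
  rw [origin_eq_origin, conj_sameCycle h.σ] at ho
  rw [hm x y hd hd' ((m.origin_eq_origin x y).mpr ho)]

theorem cw (h : IsIso e m m') (d : D) : e (m.cw d) = m'.cw (e d) :=
  conj_firstReturn (conj_inv h.σ) h.isBoundary d

theorem splitσ (h : IsIso e m m') (d : D) : e (m.splitσ d) = m'.splitσ (e d) := by
  change e (m.cw (m.σ d)) = m'.cw (m'.σ (e d))
  rw [h.cw, h.σ]

theorem splitφ (h : IsIso e m m') (d : D) : e (m.splitφ d) = m'.splitφ (e d) := by
  change e (m.splitσ (m.α d)) = m'.splitσ (m'.α (e d))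
  rw [h.splitσ, h.α]

theorem rot (h : IsIso e m m') (c : Bool) (d : D) : e (m.rot c d) = m'.rot c (e d) := by
  cases c
  · exact h.cw d
  · exact conj_inv h.splitφ d

theorem dartAt (h : IsIso e m m') (u : List ℕ) : m'.dartAt u = (m.dartAt u).map e := by
  induction u using List.reverseRecOn with
  | nil => simp [CMap.dartAt, h.root]
  | append_singleton u j ih =>
    by_cases hu : u = []
    · subst hu
      rw [List.nil_append, dartAt_singleton, dartAt_singleton, ← h.root, conj_minimalPeriod h.cw]
      split_ifs
      · rw [Option.map_some, conj_pow h.cw]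
      · rfl
    · rw [dartAt_append _ _ hu, dartAt_append _ _ hu, ih]
      cases m.dartAt u with
      | none => rfl
      | some d =>
        simp only [Option.map_some, Option.bind_some, explore, conj_minimalPeriod (h.rot _)]
        split_ifs
        · rw [Option.map_some, conj_pow (h.rot _)]
        · rfl

theorem treeVertices (h : IsIso e m m') : m'.treeVertices = m.treeVertices := by
  ext u
  simp only [CMap.treeVertices, Set.mem_ofPred_eq, h.dartAt, Option.isSome_map]

theorem sameComponent (h : IsIso e m m') (x y : D) (hxy : m.SameComponent x y) :
    m'.SameComponent (e x) (e y) :=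
  (iff_of_eq (eqvGen_invariant (v := fun z => m'.SameComponent (e x) (e z))
    (fun z => by rw [h.splitσ, sameComponent_splitσ])
    (fun z => by rw [h.α, sameComponent_α]) hxy)).mp (Relation.EqvGen.refl _)

omit [Finite D] [Finite D'] in
theorem symm (h : IsIso e m m') : IsIso e.symm m' m := by
  refine ⟨fun d => ?_, fun d => ?_, ?_⟩
  · apply e.injective; simp [h.σ]
  · apply e.injective; simp [h.α]
  · rw [← h.root, e.symm_apply_apply]

theorem component (h : IsIso e m m') (d : D) :
    (m.component d).Iso (m'.component (e d)) := by
  refine ⟨e.subtypeEquiv fun x => ⟨h.sameComponent d x, fun hx => ?_⟩, ?_, ?_, ?_⟩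
  · simpa using h.symm.sameComponent _ _ hx
  · exact fun x => Subtype.ext (h.splitσ x.1)
  · exact fun x => Subtype.ext (h.α x.1)
  · rfl

end IsIso

/-! ### Invariants of isomorphism classes, computed on any model -/

variable [Finite D] [Finite D']

omit [Finite D] [Finite D'] in
theorem relabel_isIso (m : CMap D) (e : D ≃ D') : IsIso e m (m.relabel e) :=
  ⟨fun d => by simp [relabel, Equiv.permCongr_apply],
    fun d => by simp [relabel, Equiv.permCongr_apply], rfl⟩

theorem toRMap_eq_iff (m : CMap D) (m' : CMap D') : m.toRMap = m'.toRMap ↔ m.Iso m' := by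
  have h1 : m.Iso (m.relabel (Finite.equivFin D)) := iso_iff.mpr ⟨_, m.relabel_isIso _⟩
  have h2 : m'.Iso (m'.relabel (Finite.equivFin D')) := iso_iff.mpr ⟨_, m'.relabel_isIso _⟩
  constructor
  · intro h
    have h3 : (m.relabel (Finite.equivFin D)).Iso (m'.relabel (Finite.equivFin D')) :=
      Quotient.exact (Option.some.inj h)
    exact h1.trans' (h3.trans' h2.symm')
  · intro h
    exact congrArg some (Quotient.sound (h1.symm'.trans' (h.trans' h2)))

theorem rep_iso (m : CMap D) :
    ∃ x : EdgeMap, m.toRMap = some x ∧ m.Iso x.rep := by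
  refine ⟨_, rfl, ?_⟩
  have h1 : m.Iso (m.relabel (Finite.equivFin D)) := iso_iff.mpr ⟨_, m.relabel_isIso _⟩
  refine h1.trans' ?_
  have h2 := Quotient.mk_out (s := mapSetoid)
    (⟨Nat.card D, m.relabel (Finite.equivFin D)⟩ : Σ n : ℕ, CMap (Fin n))
  exact CMap.Iso.symm' h2

theorem toRMap_rep (x : EdgeMap) : x.rep.toRMap = some x := by
  obtain ⟨y, hy, hi⟩ := x.rep.rep_iso
  rw [hy]
  have : x = y := by
    rw [← Quotient.out_eq x, ← Quotient.out_eq y]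
    exact Quotient.sound hi
  rw [this]

theorem toRMap_mem_maps (m : CMap D) : m.toRMap ∈ maps ↔ m.IsPlanar ∧ m.IsBipartite := by
  obtain ⟨x, hx, hi⟩ := m.rep_iso
  obtain ⟨e, he⟩ := iso_iff.mp hi
  rw [hx, he.isPlanar, he.isBipartite]
  constructor
  · intro h; exact h x rfl
  · rintro h y hy; cases hy; exact h

theorem toRMap_mem_simpleMaps (m : CMap D) :
    m.toRMap ∈ simpleMaps ↔ (m.IsPlanar ∧ m.IsBipartite) ∧ m.HasSimpleBoundary := by
  have h0 : m.toRMap ∈ simpleMaps ↔ m.toRMap ∈ maps ∧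
      ∀ e : EdgeMap, m.toRMap = some e → e.rep.HasSimpleBoundary := Iff.rfl
  rw [h0, toRMap_mem_maps]
  refine and_congr_right fun _ => ?_
  obtain ⟨x, hx, hi⟩ := m.rep_iso
  obtain ⟨e, he⟩ := iso_iff.mp hi
  rw [hx]
  constructor
  · intro h; exact he.symm.hasSimpleBoundary (h x rfl)
  · rintro h y hy; cases hy; exact he.hasSimpleBoundary h

theorem perimeter_toRMap (m : CMap D) : m.toRMap.perimeter = m.perimeter := by
  obtain ⟨x, hx, hi⟩ := m.rep_iso
  obtain ⟨e, he⟩ := iso_iff.mp hi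
  rw [hx]
  exact he.perimeter.symm

theorem weight_toRMap (q : ℕ → ℝ≥0) (m : CMap D) : m.toRMap.weight q = m.weight q := by
  obtain ⟨x, hx, hi⟩ := m.rep_iso
  obtain ⟨e, he⟩ := iso_iff.mp hi
  rw [hx]
  exact (he.weight q).symm

theorem treeVertices_toRMap (m : CMap D) : m.toRMap.treeVertices = m.treeVertices := by
  obtain ⟨x, hx, hi⟩ := m.rep_iso
  obtain ⟨e, he⟩ := iso_iff.mp hi
  rw [hx]
  exact he.treeVertices

theorem tree_toRMap (m : CMap D) {t : PlaneTree} (h : m.treeVertices = t.verts) :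
    m.toRMap.tree = t := by
  have h2 := m.treeVertices_toRMap
  obtain ⟨x, hx, hi⟩ := m.rep_iso
  rw [hx] at h2 ⊢
  have h3 : (EdgeMap.rep x).treeVertices = t.verts := h2.trans h
  have h4 : (EdgeMap.rep x).treeVertices.Finite := by rw [h3]; exact t.verts.finite_toSet
  apply PlaneTree.ext_verts
  simp only [RMap.tree, dif_pos h4]
  apply Finset.coe_injective
  rw [Set.Finite.coe_toFinset, h3]

theorem component_toRMap (m : CMap D) {u : List ℕ} {d : D} (h : m.dartAt u = some d) :
    m.toRMap.component u = (m.component d).toRMap := by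
  obtain ⟨x, hx, hi⟩ := m.rep_iso
  obtain ⟨e, he⟩ := iso_iff.mp hi
  rw [hx]
  have h1 : (EdgeMap.rep x).dartAt u = some (e d) := by rw [he.dartAt, h]; rfl
  simp only [RMap.component, h1]
  exact (toRMap_eq_iff _ _).mpr (he.component d).symm'

end CMap

/-! ### Faces, perimeter and weight of the glued map -/

namespace Glue

variable {t : PlaneTree} {E : t.black → Type} [∀ u, Finite (E u)] (c : ∀ u, CMap (E u))
  (hp : ∀ u : t.black, (c u).perimeter = t.numChildren u + 1) (ht : [1] ∈ t.verts)
  (hs : ∀ u, (c u).HasSimpleBoundary)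

/-- The faces of the glued map: its root face, and the internal faces of the components. -/
abbrev FaceIndex : Type := Option (Σ u, {f : (c u).Face // f ≠ (c u).rootFace})

def faceIndex (x : Σ u, E u) : FaceIndex c :=
  if h : (c x.1).face x.2 = (c x.1).rootFace then none else some ⟨x.1, (c x.1).face x.2, h⟩

-- Boundary darts form the merged root face. Off the boundary the face permutation agrees with the
-- split one, whose cycles are faces of the components.
include hs in
theorem faceIndex_iff (x y : Σ u, E u) :
    faceIndex c x = faceIndex c y ↔ (glue c hp ht).φ.SameCycle x y := by
  have hB := glue_isBoundary c hp ht
  by_cases hx : Bdry c x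
  · have hx' : faceIndex c x = none := dif_pos hx
    rw [hx']
    have h1 := ((glue c hp ht).isBoundary_iff x).mp ((hB x).mpr hx)
    have h2 : faceIndex c y = none ↔ Bdry c y := by
      unfold faceIndex
      split_ifs with h
      · exact iff_of_true rfl h
      · exact iff_of_false (by simp) h
    rw [eq_comm, h2, ← hB, CMap.isBoundary_iff]
    exact ⟨fun h => h1.trans h.symm, fun h => h.symm.trans h1⟩
  · rw [← CMap.sameCycle_splitφ_iff _ (fun h => hx ((hB x).mp h)), glue_splitφ c hp ht hs]
    have hx' : faceIndex c x = some ⟨x.1, (c x.1).face x.2, hx⟩ := dif_neg hx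
    rw [hx']
    obtain ⟨u, d⟩ := x
    obtain ⟨v, d'⟩ := y
    constructor
    · intro h
      unfold faceIndex at h
      split_ifs at h with hy
      rw [Option.some.injEq] at h
      obtain ⟨h1, h2⟩ := Sigma.mk.inj h
      have h1' : u = v := h1
      subst h1'
      have h3 : (c u).face d = (c u).face d' := congrArg Subtype.val (eq_of_heq h2)
      exact (sameCycle_sigma (fun u => (c u).φ) u d d').mpr (((c u).face_eq_face d d').mp h3)
    · intro h
      have huv : u = v := fst_eq_of_sameCycle_sigma (fun u => (c u).φ) h
      subst huv
      have h3 := ((c u).face_eq_face d d').mpr ((sameCycle_sigma (fun u => (c u).φ) u d d').mp h)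
      unfold faceIndex
      simp only [← h3]
      rw [dif_neg (show ¬ (c u).face d = (c u).rootFace from hx)]

omit [∀ u, Finite (E u)] in
include ht in
theorem faceIndex_surjective : Function.Surjective (faceIndex c) := by
  rintro (_ | ⟨u, f, hf⟩)
  · exact ⟨dart c ⟨[1], ht, by simp⟩, dif_pos (bdry_dart c _)⟩
  · obtain ⟨d, rfl⟩ := (c u).face_surjective f
    exact ⟨⟨u, d⟩, dif_neg hf⟩

theorem faceIndex_root : faceIndex c (glue c hp ht).root = none := dif_pos (bdry_dart c _)

theorem card_fiber_none : Nat.card {x // faceIndex c x = none} = ∑ u, (c u).perimeter := by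
  have : ∀ u, (c u).perimeter = Nat.card {d // (c u).face d = (c u).rootFace} := fun _ => rfl
  simp only [this]
  rw [← Nat.card_sigma]
  refine Nat.card_congr ⟨fun x => ⟨x.1.1, x.1.2, ?_⟩, fun y => ⟨⟨y.1, y.2.1⟩, dif_pos y.2.2⟩,
    fun x => rfl, fun y => rfl⟩
  by_contra h
  have := x.2
  unfold faceIndex at this
  rw [dif_neg h] at this
  simp at this

omit [∀ u, Finite (E u)] in
theorem card_fiber_some (u : t.black) (f : {f : (c u).Face // f ≠ (c u).rootFace}) :
    Nat.card {x // faceIndex c x = some ⟨u, f⟩} = (c u).deg f.1 := by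
  obtain ⟨f, hf⟩ := f
  refine (Nat.card_congr (Equiv.ofBijective (fun d : {d // (c u).face d = f} =>
    (⟨⟨u, d.1⟩, ?_⟩ : {x // faceIndex c x = some ⟨u, f, hf⟩})) ⟨?_, ?_⟩)).symm
  · obtain ⟨d, rfl⟩ := d
    exact dif_neg hf
  · intro d d' h
    exact Subtype.ext (eq_of_heq (Sigma.mk.inj (congrArg Subtype.val h)).2)
  · rintro ⟨⟨v, d⟩, h⟩
    have h' := h
    unfold faceIndex at h'
    split_ifs at h' with hd
    rw [Option.some.injEq] at h'
    obtain ⟨h1, h2⟩ := Sigma.mk.inj h'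
    have h1' : v = u := h1
    subst h1'
    exact ⟨⟨d, congrArg Subtype.val (eq_of_heq h2)⟩, rfl⟩

instance : Fintype (FaceIndex c) := inferInstance

include hs in
theorem glue_isBipartite (hb : ∀ u, (c u).IsBipartite) : (glue c hp ht).IsBipartite := by
  rw [CMap.isBipartite_iff_fiber (faceIndex_iff c hp ht hs) (faceIndex_surjective c ht)]
  rintro (_ | ⟨u, f⟩)
  · rw [card_fiber_none]
    exact Finset.even_sum _ fun u _ => hb u _
  · rw [card_fiber_some]
    exact hb u _

include hs in
theorem glue_perimeter : (glue c hp ht).perimeter = ∑ u, (c u).perimeter := by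
  rw [CMap.perimeter_eq_card_fiber (faceIndex_iff c hp ht hs) (faceIndex_surjective c ht),
    faceIndex_root, card_fiber_none]

-- The contours have merged into the root face, which carries no weight, and no other face has
-- changed.
include hs in
theorem glue_weight (q : ℕ → ℝ≥0) : (glue c hp ht).weight q = ∏ u, (c u).weight q := by
  rw [CMap.weight_eq_prod q (faceIndex_iff c hp ht hs) (faceIndex_surjective c ht),
    faceIndex_root, Fintype.prod_option, if_pos rfl, one_mul, Fintype.prod_sigma]
  refine Finset.prod_congr rfl fun u _ => ?_
  rw [CMap.weight, ← Fintype.prod_subtype_mul_prod_subtype (fun f => f = (c u).rootFace)]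
  rw [Finset.prod_eq_one (fun f _ => if_pos f.2), one_mul]
  refine Finset.prod_congr rfl fun f _ => ?_
  rw [if_neg (by simp), card_fiber_some, if_neg f.2]

end Glue

/-! ### The decomposition of a map into its tree and its components -/

theorem mem_maps_some {e : EdgeMap} (h : some e ∈ maps) : e.rep.IsPlanar ∧ e.rep.IsBipartite :=
  h e rfl

theorem none_mem_maps : (none : RMap) ∈ maps := by
  intro e h
  cases h

theorem even_perimeter {m : RMap} (hm : m ∈ maps) : Even m.perimeter := by
  cases m with
  | none => exact ⟨0, rfl⟩
  | some e => exact (mem_maps_some hm).2 _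

theorem treeVertices_finite {m : RMap} (hm : m ∈ maps) : m.treeVertices.Finite := by
  cases m with
  | none => exact Set.finite_singleton _
  | some e => exact e.rep.treeVertices_finite (mem_maps_some hm).1

/-- A planar map is encoded by its tree of components. -/
theorem exists_encodes {e : EdgeMap} (h : some e ∈ maps) :
    ∃ i, e.rep.Encodes (RMap.tree (some e)) i ∧
      ∀ u ∈ (RMap.tree (some e)).black,
        RMap.component (some e) u = (e.rep.component (i u)).toRMap := by
  have hp := (mem_maps_some h).1
  have hf := e.rep.treeVertices_finite hp
  have ht : RMap.tree (some e) = e.rep.toTree hf := by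
    simp only [RMap.tree, dif_pos hf]
    rfl
  rw [ht]
  have he := e.rep.encodes_toTree hp hf
  refine ⟨_, he, fun u hu => ?_⟩
  obtain ⟨hu1, -⟩ := PlaneTree.mem_black.mp hu
  have hd := he.dartAt_eq u (CMap.Encodes.ne_nil_of_black hu)
  rw [if_pos hu1] at hd
  conv_lhs => rw [← CMap.toRMap_rep e]
  exact CMap.component_toRMap _ hd

theorem component_spec {m : RMap} (hm : m ∈ maps) {u : List ℕ} (hu : u ∈ m.tree.black) :
    m.component u ∈ simpleMaps ∧ (m.component u).perimeter = m.tree.degree u := by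
  cases m with
  | none =>
    obtain ⟨h1, h2⟩ := PlaneTree.mem_black.mp hu
    simp only [RMap.tree, PlaneTree.single, Finset.mem_singleton] at h1
    subst h1
    simp at h2
  | some e =>
    obtain ⟨i, hi, hc⟩ := exists_encodes hm
    obtain ⟨hp, hb⟩ := mem_maps_some hm
    obtain ⟨h1, h2⟩ := PlaneTree.mem_black.mp hu
    have hu' := CMap.Encodes.ne_nil_of_black hu
    have hbd := hi.isBoundary h1 hu'
    rw [hc u hu]
    refine ⟨(CMap.toRMap_mem_simpleMaps _).mpr ⟨⟨e.rep.component_isPlanar hp _,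
      e.rep.component_isBipartite hp hb hbd⟩, e.rep.component_hasSimpleBoundary hp hbd⟩, ?_⟩
    rw [CMap.perimeter_toRMap, CMap.component_perimeter]
    have h3 := hi.minimalPeriod_rot h1 hu'
    rw [h2] at h3
    rw [← minimalPeriod_inv]
    exact h3

/-- Injectivity of the decomposition. The vertex map is told apart by its tree, as any map with an
edge has the vertex `[1]` in its tree. -/
theorem eq_of_tree_of_component {m m' : RMap} (hm : m ∈ maps) (hm' : m' ∈ maps)
    (ht : m.tree = m'.tree) (hc : ∀ u ∈ m.tree.black, m.component u = m'.component u) :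
    m = m' := by
  have hne : ∀ e : EdgeMap, some e ∈ maps → RMap.tree (some e) ≠ PlaneTree.single := by
    intro e he h
    obtain ⟨i, hi, -⟩ := exists_encodes he
    have := hi.one_mem
    rw [h] at this
    simp [PlaneTree.single] at this
  cases m with
  | none =>
    cases m' with
    | none => rfl
    | some e' => exact absurd ht.symm (hne e' hm')
  | some e =>
    cases m' with
    | none => exact absurd ht (hne e hm)
    | some e' =>
      obtain ⟨i, hi, hci⟩ := exists_encodes hm
      obtain ⟨i', hi', hci'⟩ := exists_encodes hm'
      rw [← ht] at hi' hci'
      rw [← CMap.toRMap_rep e, ← CMap.toRMap_rep e', CMap.toRMap_eq_iff]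
      refine hi.iso_of_components (mem_maps_some hm).1 hi' (mem_maps_some hm').1 fun u => ?_
      rw [← CMap.toRMap_eq_iff, ← hci u u.2, ← hci' u u.2]
      exact hc u u.2

namespace PlaneTree

theorem eq_single {t : PlaneTree} (h : [1] ∉ t.verts) : t = single := by
  apply ext_verts
  have h0 : t.numChildren [] = 0 := by
    by_contra hne
    exact h ((t.append_mem_iff [] 1).mpr ⟨le_rfl, by omega⟩)
  have key : ∀ n (u : List ℕ), u.length = n → u ∈ t.verts → u = [] := by
    intro n
    induction n with
    | zero => intro u hu _; exact List.eq_nil_of_length_eq_zero hu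
    | succ n ih =>
      intro u hu hut
      obtain ⟨v, j, rfl⟩ := exists_append u (by rintro rfl; simp at hu)
      have hv := ih v (by simpa using hu) (t.parent_mem _ _ hut)
      subst hv
      have := (t.append_mem_iff [] j).mp hut
      omega
  ext u
  simp only [single, Finset.mem_singleton]
  exact ⟨key _ u rfl, fun h => h ▸ t.nil_mem⟩

theorem black_single : single.black = ∅ := by
  rw [Finset.eq_empty_iff_forall_notMem]
  intro u hu
  obtain ⟨h1, h2⟩ := mem_black.mp hu
  simp only [single, Finset.mem_singleton] at h1
  subst h1
  simp at h2

end PlaneTree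

/-- Gluing prescribed components along a prescribed tree. -/
theorem exists_of_tree_of_component (q : ℕ → ℝ≥0) (t : PlaneTree) (c : t.black → RMap)
    (hc : ∀ u, c u ∈ simpleMaps ∧ (c u).perimeter = t.degree u) :
    ∃ m ∈ maps, m.tree = t ∧ (∀ u : t.black, m.component u = c u) ∧
      m.weight q = ∏ u, (c u).weight q ∧ m.perimeter = ∑ u : t.black, t.degree u := by
  by_cases ht : [1] ∈ t.verts
  · have hsome : ∀ u, ∃ e : EdgeMap, c u = some e := by
      intro u
      cases h : c u with
      | none =>
        have := (hc u).2
        rw [h] at this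
        simp [RMap.perimeter, PlaneTree.degree] at this
      | some e => exact ⟨e, rfl⟩
    choose e he using hsome
    let M : ∀ u : t.black, CMap (Fin (Quotient.out (e u)).1) := fun u => (e u).rep
    have hM : ∀ u, (M u).toRMap = c u := fun u => (CMap.toRMap_rep (e u)).trans (he u).symm
    have hsm : ∀ u, ((M u).IsPlanar ∧ (M u).IsBipartite) ∧ (M u).HasSimpleBoundary := fun u =>
      (CMap.toRMap_mem_simpleMaps _).mp ((hM u).symm ▸ (hc u).1)
    have hp : ∀ u : t.black, (M u).perimeter = t.numChildren u + 1 := fun u => by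
      rw [← CMap.perimeter_toRMap, hM u]; exact (hc u).2
    have hs := fun u => (hsm u).2
    have henc := Glue.glue_encodes M hp ht hs
    refine ⟨(Glue.glue M hp ht).toRMap, ?_, ?_, ?_, ?_, ?_⟩
    · exact (CMap.toRMap_mem_maps _).mpr ⟨Glue.glue_isPlanar M hp ht hs fun u => (hsm u).1.1,
        Glue.glue_isBipartite M hp ht hs fun u => (hsm u).1.2⟩
    · exact CMap.tree_toRMap _ henc.treeVertices_eq
    · intro u
      obtain ⟨h1, -⟩ := PlaneTree.mem_black.mp u.2
      have hd := henc.dartAt_eq u (CMap.Encodes.ne_nil_of_black u.2)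
      rw [if_pos h1] at hd
      rw [CMap.component_toRMap _ hd, ← hM u]
      exact ((CMap.toRMap_eq_iff _ _).mpr (Glue.glue_component_iso M hp ht hs u)).symm
    · rw [CMap.weight_toRMap, Glue.glue_weight M hp ht hs]
      refine Finset.prod_congr rfl fun u _ => ?_
      rw [← hM u, CMap.weight_toRMap]
    · rw [CMap.perimeter_toRMap, Glue.glue_perimeter M hp ht hs]
      exact Finset.sum_congr rfl fun u _ => hp u
  · have hts := PlaneTree.eq_single ht
    subst hts
    have hemp : IsEmpty PlaneTree.single.black := by
      rw [PlaneTree.black_single]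
      infer_instance
    exact ⟨none, none_mem_maps, rfl, fun u => hemp.elim u, by simp [RMap.weight],
      by simp [RMap.perimeter]⟩

/-! ### Sums over maps -/

/-- Distributivity of a finite product over infinite sums, by induction on the index type; terms are
in `ℝ≥0∞`, so summability is free. -/
theorem tsum_pi_prod {ι : Type} [Fintype ι] {α : Type} (g : ι → α → ℝ≥0∞) :
    ∑' c : ι → α, ∏ i, g i (c i) = ∏ i, ∑' a, g i a := by
  refine Finite.induction_empty_option (P := fun ι => ∀ [Fintype ι] (g : ι → α → ℝ≥0∞),
    ∑' c : ι → α, ∏ i, g i (c i) = ∏ i, ∑' a, g i a) ?_ ?_ ?_ ι g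
  · intro ι κ e ih _ g
    have : Fintype ι := Fintype.ofEquiv κ e.symm
    rw [← Equiv.prod_comp e, ← ih fun i => g (e i), ← (e.arrowCongr (Equiv.refl α)).tsum_eq]
    refine tsum_congr fun c => ?_
    rw [← Equiv.prod_comp e]
    simp
  · intro _ g
    rw [tsum_eq_single (fun i => i.elim) (fun b hb => absurd (Subsingleton.elim _ _) hb)]
    simp
  · intro ι _ ih _ g
    have h : ∀ s : Option ι → ℝ≥0∞, ∀ inst : Fintype (Option ι),
        (@Finset.univ _ inst).prod s = s none * ∏ i, s (some i) := by
      intro s inst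
      rw [Subsingleton.elim inst instFintypeOption, Fintype.prod_option]
    rw [← Equiv.tsum_eq (Equiv.piOptionEquivProd (β := fun _ => α)).symm, ENNReal.tsum_prod',
      h, ← ENNReal.tsum_mul_right, ← ih]
    refine tsum_congr fun a => ?_
    rw [← ENNReal.tsum_mul_left]
    refine tsum_congr fun c => ?_
    rw [h]
    rfl

/-- The Boltzmann weight of a map, with weight `x` per half of the perimeter. -/
def bw (q : ℕ → ℝ≥0) (x : ℝ≥0∞) (m : RMap) : ℝ≥0∞ :=
  maps.indicator (fun m => x ^ (m.perimeter / 2) * m.weight q) m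

theorem tsum_bw (q : ℕ → ℝ≥0) (x : ℝ≥0∞) : ∑' m, bw q x m = F q x := by
  have h1 : ∀ k, Fcoef q k * x ^ k =
      ∑' m : RMap, if m.perimeter / 2 = k then bw q x m else 0 := by
    intro k
    have : Fcoef q k = ∑' m : {m : RMap | m ∈ maps ∧ m.perimeter = 2 * k}, m.1.weight q := rfl
    rw [this, tsum_subtype {m : RMap | m ∈ maps ∧ m.perimeter = 2 * k} (fun m => m.weight q),
      ← ENNReal.tsum_mul_right]
    refine tsum_congr fun m => ?_
    by_cases hm : m ∈ maps
    · have he := even_perimeter hm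
      by_cases hk : m.perimeter = 2 * k
      · have hk' : m.perimeter / 2 = k := by omega
        rw [Set.indicator_of_mem (show m ∈ {m : RMap | m ∈ maps ∧ m.perimeter = 2 * k} from
          ⟨hm, hk⟩), if_pos hk', bw, Set.indicator_of_mem hm, hk', mul_comm]
      · have hk' : ¬ m.perimeter / 2 = k := by
          obtain ⟨r, hr⟩ := he
          omega
        rw [Set.indicator_of_notMem (fun h => hk h.2), if_neg hk', zero_mul]
    · rw [Set.indicator_of_notMem (fun h => hm h.1), zero_mul, bw, Set.indicator_of_notMem hm]
      simp
  rw [F]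
  simp_rw [h1]
  rw [ENNReal.tsum_comm]
  refine tsum_congr fun m => ?_
  rw [tsum_ite_eq' (m.perimeter / 2) (fun _ => bw q x m)]

/-- The weight of a component at a vertex of the tree. -/
def componentWeight (q : ℕ → ℝ≥0) (x : ℝ≥0∞) (n : ℕ) (r : RMap) : ℝ≥0∞ :=
  if r ∈ simpleMaps ∧ r.perimeter = n then x ^ (n / 2) * r.weight q else 0

/-- The generating weight of a black vertex with `n` children. -/
def blackWeight (q : ℕ → ℝ≥0) (x : ℝ≥0∞) (n : ℕ) : ℝ≥0∞ :=
  if Odd n then x ^ (n / 2 + 1) * FcoefHat q (n / 2 + 1) else 0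

theorem tsum_componentWeight (q : ℕ → ℝ≥0) (x : ℝ≥0∞) (n : ℕ) :
    ∑' r, componentWeight q x (n + 1) r = blackWeight q x n := by
  unfold blackWeight
  split_ifs with h
  · obtain ⟨k, rfl⟩ := h
    have e1 : (2 * k + 1) / 2 + 1 = k + 1 := by omega
    have e2 : (2 * k + 1 + 1) / 2 = k + 1 := by omega
    have e3 : 2 * k + 1 + 1 = 2 * (k + 1) := by ring
    have : FcoefHat q (k + 1) =
        ∑' m : {m : RMap | m ∈ simpleMaps ∧ m.perimeter = 2 * (k + 1)}, m.1.weight q := rfl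
    rw [e1, this, tsum_subtype {m : RMap | m ∈ simpleMaps ∧ m.perimeter = 2 * (k + 1)}
      (fun m => m.weight q), ← ENNReal.tsum_mul_left]
    refine tsum_congr fun m => ?_
    rw [componentWeight, e2, e3, Set.indicator_apply]
    simp only [Set.mem_ofPred_eq, mul_ite, mul_zero]
  · rw [ENNReal.tsum_eq_zero]
    intro r
    refine if_neg ?_
    rintro ⟨h1, h2⟩
    have := even_perimeter h1.1
    rw [h2, Nat.even_add_one] at this
    exact this (Nat.not_odd_iff_even.mp h)

theorem sum_degree_even {t : PlaneTree} (h : ∀ u : t.black, Even (t.degree u)) :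
    (∑ u : t.black, t.degree u) / 2 = ∑ u : t.black, t.degree u / 2 := by
  have : ∑ u : t.black, t.degree u = 2 * ∑ u : t.black, t.degree u / 2 := by
    rw [Finset.mul_sum]
    exact Finset.sum_congr rfl fun u _ => (Nat.two_mul_div_two_of_even (h u)).symm
  omega

/-- The bijection in terms of sums. If every `c u` has a simple boundary of the right perimeter,
exactly one map contributes, namely the glued one. Otherwise none does, and a factor on the right
vanishes. -/
theorem tsum_bw_tree_component (q : ℕ → ℝ≥0) (x : ℝ≥0∞) (t : PlaneTree) (c : t.black → RMap) :
    (∑' m : RMap, if m.tree = t ∧ (fun u : t.black => m.component u) = c then bw q x m else 0) =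
      ∏ u : t.black, componentWeight q x (t.degree u) (c u) := by
  by_cases hc : ∀ u, c u ∈ simpleMaps ∧ (c u).perimeter = t.degree u
  · obtain ⟨m, hm, ht, hcm, hw, hper⟩ := exists_of_tree_of_component q t c hc
    rw [tsum_eq_single m, if_pos ⟨ht, funext hcm⟩, bw, Set.indicator_of_mem hm, hw, hper,
      sum_degree_even fun u => (hc u).2 ▸ even_perimeter (hc u).1.1, ← Finset.prod_pow_eq_pow_sum,
      ← Finset.prod_mul_distrib]
    · exact Finset.prod_congr rfl fun u _ => (if_pos (hc u)).symm
    · intro m' hne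
      by_cases hm' : m' ∈ maps
      · refine if_neg fun h => hne ?_
        obtain ⟨h1, h2⟩ := h
        refine eq_of_tree_of_component hm' hm (h1.trans ht.symm) fun u hu => ?_
        rw [h1] at hu
        exact (congrFun h2 ⟨u, hu⟩).trans (hcm ⟨u, hu⟩).symm
      · rw [bw, Set.indicator_of_notMem hm', ite_self]
  · obtain ⟨u, hu⟩ := not_forall.mp hc
    rw [Finset.prod_eq_zero (Finset.mem_univ u) (if_neg hu), ENNReal.tsum_eq_zero]
    intro m
    by_cases hm : m ∈ maps
    · refine if_neg fun h => hu ?_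
      obtain ⟨h1, h2⟩ := h
      have hub : (u : List ℕ) ∈ m.tree.black := by rw [h1]; exact u.2
      have := component_spec hm hub
      rw [h1] at this
      rw [← h2]
      exact this
    · rw [bw, Set.indicator_of_notMem hm, ite_self]

/-- The components range independently, so the sum over families is a product of sums. -/
theorem tsum_bw_tree (q : ℕ → ℝ≥0) (x : ℝ≥0∞) (t : PlaneTree) :
    (∑' m : RMap, if m.tree = t then bw q x m else 0) =
      ∏ u ∈ t.black, blackWeight q x (t.numChildren u) := by
  have h : ∀ m : RMap, (if m.tree = t then bw q x m else 0) = ∑' c : t.black → RMap,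
      if m.tree = t ∧ (fun u : t.black => m.component u) = c then bw q x m else 0 := by
    intro m
    by_cases ht : m.tree = t
    · simp only [ht, true_and, if_true]
      rw [tsum_ite_eq' (fun u : t.black => m.component u) (fun _ => bw q x m)]
    · simp [ht]
  simp_rw [h]
  rw [ENNReal.tsum_comm]
  simp_rw [tsum_bw_tree_component]
  rw [tsum_pi_prod (fun (u : t.black) r => componentWeight q x (t.degree u) r),
    ← Finset.prod_coe_sort t.black]
  exact Finset.prod_congr rfl fun u _ => tsum_componentWeight q x _

theorem F_eq_tsum_tree (q : ℕ → ℝ≥0) (x : ℝ≥0∞) :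
    F q x = ∑' t : PlaneTree, ∏ u ∈ t.black, blackWeight q x (t.numChildren u) := by
  rw [← tsum_bw]
  simp_rw [← tsum_bw_tree]
  rw [ENNReal.tsum_comm]
  refine tsum_congr fun m => ?_
  rw [tsum_ite_eq' m.tree (fun _ => bw q x m)]

/-! ### Recursion on plane trees -/

namespace PlaneTree

/-- The plane tree whose root has the given subtrees. -/
def node (n : ℕ) (f : Fin n → PlaneTree) : PlaneTree where
  verts := insert [] (Finset.univ.biUnion fun i : Fin n =>
    (f i).verts.image (List.cons ((i : ℕ) + 1)))
  nil_mem := Finset.mem_insert_self _ _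
  parent_mem u j h := by
    cases u with
    | nil => exact Finset.mem_insert_self _ _
    | cons a v =>
      simp only [List.cons_append, Finset.mem_insert, reduceCtorEq, Finset.mem_biUnion,
        Finset.mem_univ, true_and, Finset.mem_image, List.cons.injEq, false_or] at h ⊢
      obtain ⟨i, w, hw, h1, rfl⟩ := h
      exact ⟨i, v, (f i).parent_mem _ _ hw, h1, rfl⟩
  children u h := by
    cases u with
    | nil =>
      refine ⟨n, fun j => ?_⟩
      simp only [List.nil_append, Finset.mem_insert, reduceCtorEq, Finset.mem_biUnion,
        Finset.mem_univ, true_and, Finset.mem_image, List.cons.injEq, false_or]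
      constructor
      · rintro ⟨i, w, -, h1, -⟩
        have := i.2
        omega
      · rintro ⟨h1, h2⟩
        exact ⟨⟨j - 1, by omega⟩, [], (f _).nil_mem, by simp; omega, rfl⟩
    | cons a v =>
      simp only [Finset.mem_insert, reduceCtorEq, Finset.mem_biUnion,
        Finset.mem_univ, true_and, Finset.mem_image, List.cons.injEq, false_or] at h
      obtain ⟨i, w, hw, rfl, rfl⟩ := h
      obtain ⟨k, hk⟩ := (f i).children w hw
      refine ⟨k, fun j => ?_⟩
      rw [← hk]
      simp only [List.cons_append, Finset.mem_insert, reduceCtorEq, Finset.mem_biUnion,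
        Finset.mem_univ, true_and, Finset.mem_image, List.cons.injEq, false_or]
      constructor
      · rintro ⟨i', w', hw', h1, rfl⟩
        have : i' = i := Fin.ext (by omega)
        rwa [← this]
      · intro h
        exact ⟨i, _, h, rfl, rfl⟩

theorem cons_mem_node {n : ℕ} {f : Fin n → PlaneTree} {j : ℕ} {u : List ℕ} :
    j :: u ∈ (node n f).verts ↔ ∃ i : Fin n, j = i + 1 ∧ u ∈ (f i).verts := by
  simp only [node, Finset.mem_insert, reduceCtorEq, Finset.mem_biUnion,
    Finset.mem_univ, true_and, Finset.mem_image, List.cons.injEq, false_or]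
  constructor
  · rintro ⟨i, w, hw, h1, rfl⟩
    exact ⟨i, h1.symm, hw⟩
  · rintro ⟨i, h1, hw⟩
    exact ⟨i, u, hw, h1.symm, rfl⟩

theorem succ_cons_mem_node {n : ℕ} {f : Fin n → PlaneTree} (i : Fin n) {u : List ℕ} :
    ((i : ℕ) + 1) :: u ∈ (node n f).verts ↔ u ∈ (f i).verts := by
  rw [cons_mem_node]
  constructor
  · rintro ⟨i', h, hu⟩
    have : i = i' := Fin.ext (by omega)
    rwa [this]
  · intro h
    exact ⟨i, rfl, h⟩

theorem numChildren_node_nil (n : ℕ) (f : Fin n → PlaneTree) : (node n f).numChildren [] = n := by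
  refine numChildren_eq fun j => ?_
  rw [List.nil_append, cons_mem_node]
  constructor
  · rintro ⟨i, rfl, -⟩
    have := i.2
    omega
  · rintro ⟨h1, h2⟩
    exact ⟨⟨j - 1, by omega⟩, by simp; omega, (f _).nil_mem⟩

theorem numChildren_node_cons (n : ℕ) (f : Fin n → PlaneTree) (i : Fin n) (u : List ℕ) :
    (node n f).numChildren (((i : ℕ) + 1) :: u) = (f i).numChildren u := by
  refine numChildren_eq fun j => ?_
  rw [List.cons_append, succ_cons_mem_node, append_mem_iff]

theorem node_bijective :
    Function.Bijective fun z : Σ n, (Fin n → PlaneTree) => node z.1 z.2 := by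
  constructor
  · rintro ⟨n, f⟩ ⟨n', f'⟩ h
    have h' : node n f = node n' f' := h
    have hn : n = n' := by
      rw [← numChildren_node_nil n f, h', numChildren_node_nil]
    subst hn
    congr 1
    funext i
    apply ext_verts
    ext u
    rw [← succ_cons_mem_node (f := f), h', succ_cons_mem_node]
  · intro t
    have hmem : ∀ i : Fin (t.numChildren []), [] ++ [(i : ℕ) + 1] ∈ t.verts := fun i =>
      (t.append_mem_iff _ _).mpr ⟨by omega, i.2⟩
    have hinj : ∀ j : ℕ, Function.Injective (List.cons j : List ℕ → List ℕ) := fun j a b h =>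
      (List.cons.inj h).2
    let f : Fin (t.numChildren []) → PlaneTree := fun i =>
      { verts := t.verts.preimage (List.cons ((i : ℕ) + 1)) (hinj _).injOn
        nil_mem := by rw [Finset.mem_preimage]; exact hmem i
        parent_mem := fun u j h => by
          rw [Finset.mem_preimage] at h ⊢
          exact t.parent_mem _ j h
        children := fun u hu => by
          rw [Finset.mem_preimage] at hu
          obtain ⟨k, hk⟩ := t.children _ hu
          exact ⟨k, fun j => by rw [Finset.mem_preimage]; exact hk j⟩ }
    have hroot : ∀ (u : List ℕ) j, j :: u ∈ t.verts → [] ++ [j] ∈ t.verts := by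
      intro u
      induction u using List.reverseRecOn with
      | nil => intro j h; exact h
      | append_singleton u i ih => intro j h; exact ih j (t.parent_mem _ i h)
    refine ⟨⟨_, f⟩, ext_verts ?_⟩
    ext u
    cases u with
    | nil => exact iff_of_true (node _ f).nil_mem t.nil_mem
    | cons j u =>
      change j :: u ∈ (node _ f).verts ↔ _
      rw [cons_mem_node]
      constructor
      · rintro ⟨i, rfl, hu⟩
        exact (Finset.mem_preimage (hf := (hinj _).injOn)).mp hu
      · intro h
        have hj := (t.append_mem_iff _ _).mp (hroot u j h)
        refine ⟨⟨j - 1, by omega⟩, by simp; omega, ?_⟩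
        refine (Finset.mem_preimage (hf := (hinj _).injOn)).mpr ?_
        change (j - 1 + 1) :: u ∈ t.verts
        rwa [Nat.sub_add_cancel hj.1]

theorem prod_node {M : Type*} [CommMonoid M] (n : ℕ) (f : Fin n → PlaneTree) (w : List ℕ → M) :
    ∏ u ∈ (node n f).verts, w u = w [] * ∏ i, ∏ u ∈ (f i).verts, w (((i : ℕ) + 1) :: u) := by
  have h : (node n f).verts = insert [] (Finset.univ.biUnion fun i : Fin n =>
    (f i).verts.image (List.cons ((i : ℕ) + 1))) := rfl
  rw [h, Finset.prod_insert, Finset.prod_biUnion]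
  · congr 1
    refine Finset.prod_congr rfl fun i _ => ?_
    rw [Finset.prod_image]
    intro a _ b _ hab
    exact (List.cons.inj hab).2
  · intro i _ j _ hij
    rw [Function.onFun, Finset.disjoint_left]
    intro u hu hu'
    obtain ⟨v, _, rfl⟩ := Finset.mem_image.mp hu
    obtain ⟨v', _, h'⟩ := Finset.mem_image.mp hu'
    exact hij (Fin.ext (by have := (List.cons.inj h').1; omega))
  · simp

/-! ### Weighted sums over plane trees -/

/-- The multiplicative weight of a tree with weights depending on the colour and the number of
children of the vertices. -/
def wt (g : Bool → ℕ → ℝ≥0∞) (t : PlaneTree) : ℝ≥0∞ :=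
  ∏ u ∈ t.verts, g (wordColor u) (t.numChildren u)

theorem wt_node (g : Bool → ℕ → ℝ≥0∞) (n : ℕ) (f : Fin n → PlaneTree) :
    wt g (node n f) = g false n * ∏ i, wt (fun c => g (!c)) (f i) := by
  rw [wt, prod_node, numChildren_node_nil, wordColor_nil]
  congr 1
  refine Finset.prod_congr rfl fun i _ => Finset.prod_congr rfl fun u _ => ?_
  rw [numChildren_node_cons, wordColor_cons]

theorem wt_eq (g : Bool → ℕ → ℝ≥0∞) (t : PlaneTree) : wt g t =
    (∏ u ∈ t.white, g false (t.numChildren u)) * ∏ u ∈ t.black, g true (t.numChildren u) := by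
  have hw : t.white = t.verts.filter fun u => wordColor u = false := by
    ext u; rw [mem_white, Finset.mem_filter]
  have hb : t.black = t.verts.filter fun u => ¬ wordColor u = false := by
    ext u; rw [mem_black, Finset.mem_filter, Bool.not_eq_false]
  rw [wt, ← Finset.prod_filter_mul_prod_filter_not t.verts (fun u => wordColor u = false), ← hw,
    ← hb]
  congr 1
  · exact Finset.prod_congr rfl fun u hu => by rw [(mem_white.mp hu).2]
  · exact Finset.prod_congr rfl fun u hu => by rw [(mem_black.mp hu).2]

theorem card_node (n : ℕ) (f : Fin n → PlaneTree) :
    (node n f).verts.card = 1 + ∑ i, (f i).verts.card := by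
  have h := prod_node n f (M := Multiplicative ℕ) (fun _ => Multiplicative.ofAdd 1)
  simp only [Finset.prod_const, ← ofAdd_nsmul, ← ofAdd_sum, ← ofAdd_add, smul_eq_mul, mul_one] at h
  exact h

theorem tsum_node (w : PlaneTree → ℝ≥0∞) :
    ∑' t, w t = ∑' n, ∑' f : Fin n → PlaneTree, w (node n f) := by
  rw [← (Equiv.ofBijective _ node_bijective).tsum_eq, ENNReal.tsum_sigma']
  rfl

/-- Cutting at the root; the subtrees are counted with exchanged colours because their roots have
odd height. -/
theorem tsum_wt (g : Bool → ℕ → ℝ≥0∞) :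
    ∑' t, wt g t = ∑' n, g false n * (∑' t, wt (fun c => g (!c)) t) ^ n := by
  rw [tsum_node]
  refine tsum_congr fun n => ?_
  simp_rw [wt_node]
  rw [ENNReal.tsum_mul_left, tsum_pi_prod (fun (_ : Fin n) t => wt (fun c => g (!c)) t),
    Finset.prod_const, Finset.card_univ, Fintype.card_fin]

/-- The sum over trees with at most `N` vertices. -/
def wtSum (g : Bool → ℕ → ℝ≥0∞) (N : ℕ) : ℝ≥0∞ :=
  ∑' t : PlaneTree, if t.verts.card ≤ N then wt g t else 0

theorem wtSum_zero (g : Bool → ℕ → ℝ≥0∞) : wtSum g 0 = 0 := by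
  rw [wtSum, ENNReal.tsum_eq_zero]
  intro t
  refine if_neg ?_
  have := Finset.card_pos.mpr ⟨_, t.nil_mem⟩
  omega

/-- In `ℝ≥0∞` the functional equation alone gives no upper bound. With a bound on the number of
vertices it becomes a recursion on which one can argue by induction. -/
theorem wtSum_succ_le (g : Bool → ℕ → ℝ≥0∞) (N : ℕ) :
    wtSum g (N + 1) ≤ ∑' n, g false n * wtSum (fun c => g (!c)) N ^ n := by
  rw [wtSum, tsum_node]
  refine ENNReal.tsum_le_tsum fun n => ?_
  have h := tsum_pi_prod (fun (_ : Fin n) (t : PlaneTree) =>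
    if t.verts.card ≤ N then wt (fun c => g (!c)) t else 0)
  rw [Finset.prod_const, Finset.card_univ, Fintype.card_fin] at h
  rw [wtSum, ← h, ← ENNReal.tsum_mul_left]
  refine ENNReal.tsum_le_tsum fun f => ?_
  split_ifs with hc
  · rw [wt_node]
    gcongr with i
    rw [card_node] at hc
    have := Finset.single_le_sum (f := fun i => (f i).verts.card) (fun i _ => Nat.zero_le _)
      (Finset.mem_univ i)
    rw [if_pos (by omega)]
  · exact bot_le

theorem tsum_wt_le (g : Bool → ℕ → ℝ≥0∞) (b : ℝ≥0∞) (h : ∀ N, wtSum g N ≤ b) :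
    ∑' t, wt g t ≤ b := by
  rw [ENNReal.tsum_eq_iSup_sum]
  refine iSup_le fun s => ?_
  refine le_trans ?_ (h (s.sup fun t => t.verts.card))
  refine le_trans ?_ (ENNReal.sum_le_tsum s)
  refine Finset.sum_le_sum fun t ht => ?_
  rw [if_pos (Finset.le_sup (f := fun t : PlaneTree => t.verts.card) ht)]

/-! #### Counting vertices -/

/-- Each vertex other than the root is counted once, by its parent, which has the opposite colour.
-/
theorem sum_numChildren (t : PlaneTree) (c : Bool) :
    ∑ u ∈ t.verts.filter (fun u => wordColor u = c), t.numChildren u =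
      ((t.verts.erase []).filter fun u => wordColor u = !c).card := by
  rw [Finset.card_eq_sum_card_fiberwise (f := List.dropLast)
    (t := t.verts.filter fun u => wordColor u = c)]
  · refine Finset.sum_congr rfl fun u hu => ?_
    obtain ⟨hu1, rfl⟩ := Finset.mem_filter.mp hu
    have : (Finset.filter (fun a => a.dropLast = u)
        ((t.verts.erase []).filter fun v => wordColor v = !wordColor u)) =
        (Finset.Icc 1 (t.numChildren u)).image fun j => u ++ [j] := by
      ext v
      simp only [Finset.mem_filter, Finset.mem_erase, Finset.mem_image, Finset.mem_Icc]
      constructor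
      · rintro ⟨⟨⟨h1, h2⟩, -⟩, h3⟩
        obtain ⟨w, j, rfl⟩ := exists_append v h1
        have hw : w = u := by simpa using h3
        subst hw
        exact ⟨j, (t.append_mem_iff _ _).mp h2, rfl⟩
      · rintro ⟨j, hj, rfl⟩
        exact ⟨⟨⟨by simp, (t.append_mem_iff _ _).mpr hj⟩, by simp⟩, by simp⟩
    rw [this, Finset.card_image_of_injective _ (fun a b h => by simpa using h), Nat.card_Icc]
    omega
  · intro v hv
    simp only [Finset.coe_filter, Set.mem_ofPred_eq, Finset.mem_erase] at hv ⊢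
    obtain ⟨⟨h1, h2⟩, h3⟩ := hv
    obtain ⟨w, j, rfl⟩ := exists_append v h1
    rw [List.dropLast_concat]
    refine ⟨t.parent_mem _ _ h2, ?_⟩
    rw [wordColor_append] at h3
    exact Bool.not_inj h3

theorem sum_numChildren_white (t : PlaneTree) :
    ∑ u ∈ t.white, t.numChildren u = t.black.card := by
  have h := t.sum_numChildren false
  have hw : t.white = t.verts.filter fun u => wordColor u = false := by
    ext u; rw [mem_white, Finset.mem_filter]
  have hb : t.black = (t.verts.erase []).filter fun u => wordColor u = !false := by
    ext u
    rw [mem_black, Finset.mem_filter, Finset.mem_erase, Bool.not_false]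
    constructor
    · rintro ⟨h1, h2⟩
      exact ⟨⟨by rintro rfl; simp at h2, h1⟩, h2⟩
    · rintro ⟨⟨-, h1⟩, h2⟩
      exact ⟨h1, h2⟩
  rw [hw, hb, h]

theorem sum_numChildren_black (t : PlaneTree) :
    ∑ u ∈ t.black, t.numChildren u + 1 = t.white.card := by
  have h := t.sum_numChildren true
  have hb : t.black = t.verts.filter fun u => wordColor u = true := by
    ext u; rw [mem_black, Finset.mem_filter]
  have hw : t.white.erase [] = (t.verts.erase []).filter fun u => wordColor u = !true := by
    ext u
    rw [Finset.mem_erase, mem_white, Finset.mem_filter, Finset.mem_erase, Bool.not_true]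
    tauto
  rw [hb, h, ← hw, Finset.card_erase_add_one]
  exact mem_white.mpr ⟨t.nil_mem, wordColor_nil⟩

theorem sum_degree (t : PlaneTree) : ∑ u ∈ t.black, t.degree u + 1 = t.verts.card := by
  have h1 := t.sum_numChildren_black
  have h2 := t.card_white_add_card_black
  simp only [degree, Finset.sum_add_distrib, Finset.sum_const, smul_eq_mul, mul_one]
  omega

end PlaneTree

/-! ### The functional equation -/

/-- The weights of the vertices of the tree of components. -/
def treeWeight (q : ℕ → ℝ≥0) (x : ℝ≥0∞) : Bool → ℕ → ℝ≥0∞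
  | false => fun _ => 1
  | true => blackWeight q x

theorem wt_treeWeight (q : ℕ → ℝ≥0) (x : ℝ≥0∞) (t : PlaneTree) :
    t.wt (treeWeight q x) = ∏ u ∈ t.black, blackWeight q x (t.numChildren u) := by
  rw [PlaneTree.wt_eq]
  simp [treeWeight]

theorem F_eq_tsum_wt (q : ℕ → ℝ≥0) (x : ℝ≥0∞) :
    F q x = ∑' t : PlaneTree, t.wt (treeWeight q x) := by
  rw [F_eq_tsum_tree]
  exact tsum_congr fun t => (wt_treeWeight q x t).symm

/-- Let `C` be the total weight of trees with a black root. A white root gives `F = ∑ C ^ n`, hence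
`F = 1 + C * F`, and a black root gives `C` as a series in `F`. -/
theorem F_eq (q : ℕ → ℝ≥0) (x : ℝ≥0∞) :
    F q x = 1 + ∑' n, blackWeight q x n * F q x ^ (n + 1) := by
  set C := ∑' t : PlaneTree, t.wt (fun c => treeWeight q x (!c)) with hC
  have h1 : F q x = ∑' n, C ^ n := by
    rw [F_eq_tsum_wt, PlaneTree.tsum_wt]
    exact tsum_congr fun n => by rw [treeWeight, one_mul]
  have h2 : C = ∑' n, blackWeight q x n * F q x ^ n := by
    rw [hC, PlaneTree.tsum_wt]
    have h : (fun c => treeWeight q x (!(!c))) = treeWeight q x :=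
      funext fun c => by rw [Bool.not_not]
    rw [h, ← F_eq_tsum_wt]
    rfl
  have h3 : F q x = 1 + C * F q x := by
    conv_lhs => rw [h1, tsum_eq_zero_add' ENNReal.summable]
    rw [pow_zero, h1, ← ENNReal.tsum_mul_left]
    simp_rw [pow_succ']
  conv_lhs => rw [h3, h2, ← ENNReal.tsum_mul_right]
  congr 1
  exact tsum_congr fun n => by rw [pow_succ, mul_assoc]

/-- The map is the gluing of its own components, for which the perimeter is known; the weight
sequence is irrelevant here and is taken to be zero. -/
theorem perimeter_eq_sum_degree {m : RMap} (hm : m ∈ maps) :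
    m.perimeter + 1 = m.tree.verts.card := by
  obtain ⟨m', hm', h1, h2, -, h4⟩ := exists_of_tree_of_component 0 m.tree
    (fun u => m.component u) (fun u => component_spec hm u.2)
  have h : m = m' := eq_of_tree_of_component hm hm' h1.symm fun u hu => (h2 ⟨u, hu⟩).symm
  rw [← PlaneTree.sum_degree, ← Finset.sum_coe_sort, ← h4, ← h]

/-- The perimeter depends only on the size of the tree, so `F_k` is a sum over trees with `2 * k +
1` vertices, with the variable set to one. -/
theorem Fcoef_eq (q : ℕ → ℝ≥0) (k : ℕ) :
    Fcoef q k = ∑' t : PlaneTree, if t.verts.card = 2 * k + 1 then t.wt (treeWeight q 1) else 0 := by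
  have h0 : Fcoef q k = ∑' m : {m : RMap | m ∈ maps ∧ m.perimeter = 2 * k}, m.1.weight q := rfl
  rw [h0, tsum_subtype {m : RMap | m ∈ maps ∧ m.perimeter = 2 * k} (fun m => m.weight q)]
  have h1 : ∀ t : PlaneTree, (if t.verts.card = 2 * k + 1 then t.wt (treeWeight q 1) else 0) =
      ∑' m : RMap, if m.tree = t then
        (if t.verts.card = 2 * k + 1 then bw q 1 m else 0) else 0 := by
    intro t
    split_ifs with h
    · rw [wt_treeWeight, tsum_bw_tree]
    · simp
  simp_rw [h1]
  rw [ENNReal.tsum_comm]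
  refine tsum_congr fun m => ?_
  rw [tsum_ite_eq' m.tree (fun t => if t.verts.card = 2 * k + 1 then bw q 1 m else 0)]
  by_cases hm : m ∈ maps
  · have hp := perimeter_eq_sum_degree hm
    by_cases hk : m.perimeter = 2 * k
    · rw [Set.indicator_of_mem (show m ∈ {m : RMap | m ∈ maps ∧ m.perimeter = 2 * k} from
        ⟨hm, hk⟩), if_pos (by omega), bw, Set.indicator_of_mem hm, one_pow, one_mul]
    · rw [Set.indicator_of_notMem (fun h => hk h.2), if_neg (by omega)]
  · rw [Set.indicator_of_notMem (fun h => hm h.1), bw, Set.indicator_of_notMem hm, ite_self]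

/-! ### The map with a single edge -/

namespace CMap

/-- The map with a single edge. -/
def edge : CMap Bool where
  σ := 1
  α := Equiv.boolNot
  root := false
  involutive := by decide
  ne_self := by decide
  connected d d' := by
    by_cases h : d = d'
    · rw [h]; exact Relation.EqvGen.refl _
    · exact Relation.EqvGen.rel _ _ (Or.inr (by revert d d'; decide))

theorem sameCycle_edge (x y : Bool) : edge.φ.SameCycle x y := by
  by_cases h : x = y
  · rw [h]
  · refine ⟨1, ?_⟩
    have : (edge.φ ^ (1 : ℤ)) x = !x := by simp [φ, edge]
    rw [this]
    revert x y; decide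

theorem edge_iff (x y : Bool) :
    (fun _ : Bool => ()) x = (fun _ : Bool => ()) y ↔ edge.φ.SameCycle x y :=
  iff_of_true rfl (sameCycle_edge x y)

theorem edge_surjective : Function.Surjective fun _ : Bool => () := fun _ => ⟨false, rfl⟩

theorem perimeter_edge : edge.perimeter = 2 := by
  rw [perimeter_eq_card_fiber edge_iff edge_surjective]
  simp

theorem weight_edge (q : ℕ → ℝ≥0) : edge.weight q = 1 := by
  rw [weight_eq_prod q edge_iff edge_surjective]
  simp

theorem isPlanar_edge : edge.IsPlanar := by
  have h1 : Nat.card edge.Face = 1 := by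
    rw [Nat.card_congr (faceEquiv edge_iff edge_surjective)]; simp
  have h2 : Nat.card edge.Vertex = 2 := by
    have : Function.Bijective edge.origin := by
      refine ⟨fun x y h => ?_, Quotient.mk_surjective⟩
      have := (edge.origin_eq_origin x y).mp h
      change Equiv.Perm.SameCycle 1 x y at this
      simpa using this
    rw [← Nat.card_congr (Equiv.ofBijective _ this)]; simp
  rw [IsPlanar, h1, h2]; simp

theorem edge_mem_simpleMaps : edge.toRMap ∈ simpleMaps := by
  rw [toRMap_mem_simpleMaps]
  refine ⟨⟨isPlanar_edge, ?_⟩, ?_⟩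
  · rw [isBipartite_iff_fiber edge_iff edge_surjective]
    intro y
    simp
  · intro d d' _ _ h
    have := (edge.origin_eq_origin d d').mp h
    change Equiv.Perm.SameCycle 1 d d' at this
    simpa using this

end CMap

/-! ### First bounds on the partition functions -/

theorem one_le_FcoefHat_one (q : ℕ → ℝ≥0) : 1 ≤ FcoefHat q 1 := by
  have h := ENNReal.le_tsum (f := fun m : {m : RMap // m ∈ simpleMaps ∧ m.perimeter = 2 * 1} =>
    m.1.weight q) ⟨CMap.edge.toRMap, CMap.edge_mem_simpleMaps, by
      rw [CMap.perimeter_toRMap, CMap.perimeter_edge]⟩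
  rwa [CMap.weight_toRMap, CMap.weight_edge] at h

theorem FcoefHat_le (q : ℕ → ℝ≥0) (k : ℕ) : FcoefHat q k ≤ Fcoef q k :=
  ENNReal.tsum_comp_le_tsum_of_injective
    (f := fun m : {m : RMap // m ∈ simpleMaps ∧ m.perimeter = 2 * k} =>
      (⟨m.1, m.2.1.1, m.2.2⟩ : {m : RMap // m ∈ maps ∧ m.perimeter = 2 * k}))
    (fun _ _ h => Subtype.ext (congrArg (fun x => x.1) h)) fun m => m.1.weight q

/-- Grafting at the root a first child with a single child of its own is injective on trees and adds
two vertices. The new black vertex has weight at least one, thanks to the single-edge map. -/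
theorem Fcoef_le_succ (q : ℕ → ℝ≥0) (k : ℕ) : Fcoef q k ≤ Fcoef q (k + 1) := by
  let leaf : PlaneTree := PlaneTree.node 0 Fin.elim0
  let twig : PlaneTree := PlaneTree.node 1 fun _ => leaf
  have hleaf : leaf.verts.card = 1 := by rw [PlaneTree.card_node]; simp
  have htwig : twig.verts.card = 2 := by rw [PlaneTree.card_node]; simp [hleaf]
  let E := Equiv.ofBijective _ PlaneTree.node_bijective
  let j : (Σ n, (Fin n → PlaneTree)) → PlaneTree := fun z =>
    PlaneTree.node (z.1 + 1) (Fin.cons twig z.2)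
  have hj : Function.Injective j := by
    rintro ⟨n, f⟩ ⟨n', f'⟩ h
    have h' := PlaneTree.node_bijective.1
      (a₁ := ⟨n + 1, Fin.cons twig f⟩) (a₂ := ⟨n' + 1, Fin.cons twig f'⟩) h
    obtain ⟨h1, h2⟩ := Sigma.mk.inj h'
    have hn : n = n' := by omega
    subst hn
    have h4 := eq_of_heq h2
    have : f = f' := by
      funext i
      have := congrFun h4 i.succ
      simpa using this
    rw [this]
  rw [Fcoef_eq, Fcoef_eq]
  refine le_trans ?_ (ENNReal.tsum_comp_le_tsum_of_injective (f := fun t => j (E.symm t))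
    (hj.comp E.symm.injective) _)
  refine ENNReal.tsum_le_tsum fun t => ?_
  obtain ⟨⟨n, f⟩, rfl⟩ := E.surjective t
  rw [Equiv.symm_apply_apply]
  have h1 : (E ⟨n, f⟩) = PlaneTree.node n f := rfl
  have h2 : j ⟨n, f⟩ = PlaneTree.node (n + 1) (Fin.cons twig f) := rfl
  have h3 : (j ⟨n, f⟩).verts.card = (PlaneTree.node n f).verts.card + 2 := by
    rw [h2, PlaneTree.card_node, PlaneTree.card_node, Fin.sum_univ_succ]
    simp only [Fin.cons_zero, Fin.cons_succ, htwig]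
    ring
  rw [h1]
  by_cases hc : (PlaneTree.node n f).verts.card = 2 * k + 1
  · rw [if_pos hc, if_pos (by rw [h3]; omega), h2, PlaneTree.wt_node, PlaneTree.wt_node,
      Fin.prod_univ_succ]
    simp only [Fin.cons_zero, Fin.cons_succ]
    have hle : 1 ≤ PlaneTree.wt (fun c => treeWeight q 1 (!c)) twig := by
      rw [PlaneTree.wt_node, Finset.prod_eq_one, mul_one]
      · change 1 ≤ blackWeight q 1 1
        rw [blackWeight, if_pos (by decide), one_pow, one_mul]
        exact one_le_FcoefHat_one q
      · intro i _
        rw [PlaneTree.wt_node]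
        simp [treeWeight]
    exact mul_le_mul_right (le_mul_of_one_le_left bot_le hle) 1
  · rw [if_neg hc]; exact bot_le

/-! ### Planar maps with even faces are bipartite graphs -/

section Colouring

variable {D : Type}

/-- The function is the parity of the distance along the cycle from a chosen representative, well
defined as the period is even. -/
theorem exists_alternating [Finite D] (f : Equiv.Perm D)
    (h : ∀ x, Even (Function.minimalPeriod f x)) : ∃ v : DartFun D, ∀ x, v (f x) = v x + 1 := by
  let r : D → D := fun x => (Quotient.mk (Equiv.Perm.SameCycle.setoid f) x).out
  have hr : ∀ x, ∃ n : ℕ, (f ^ n) (r x) = x := fun x =>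
    (show f.SameCycle (r x) x from Quotient.mk_out (s := Equiv.Perm.SameCycle.setoid f) x).exists_nat_pow_eq
  choose n hn using hr
  have key : ∀ (x : D) (a b : ℕ), a ≤ b → (f ^ a) x = (f ^ b) x → (a : ZMod 2) = b := by
    intro x a b hab hx
    obtain ⟨c, rfl⟩ := Nat.exists_eq_add_of_le hab
    rw [pow_add, Equiv.Perm.mul_apply] at hx
    have hc : (f ^ c) x = x := ((f ^ a).injective hx).symm
    have hd : Function.minimalPeriod f x ∣ c := by
      apply Function.IsPeriodicPt.minimalPeriod_dvd
      rw [Function.IsPeriodicPt, Function.IsFixedPt, ← Equiv.Perm.coe_pow]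
      exact hc
    have he : (c : ZMod 2) = 0 :=
      (ZMod.natCast_eq_zero_iff_even).mpr ((h x).trans_dvd hd)
    rw [Nat.cast_add, he, add_zero]
  refine ⟨fun x => n x, fun x => ?_⟩
  have hrx : r (f x) = r x := by
    have : Quotient.mk (Equiv.Perm.SameCycle.setoid f) (f x) = Quotient.mk _ x :=
      Quotient.sound (Equiv.Perm.sameCycle_apply_left.mpr (Equiv.Perm.SameCycle.refl f x))
    change (Quotient.mk (Equiv.Perm.SameCycle.setoid f) (f x)).out = _
    rw [this]
  have h1 : (f ^ n (f x)) (r x) = (f ^ (n x + 1)) (r x) := by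
    rw [pow_succ', Equiv.Perm.mul_apply, hn x]
    conv_lhs => rw [← hrx]
    exact hn (f x)
  have h2 : ((n (f x) : ℕ) : ZMod 2) = ((n x + 1 : ℕ) : ZMod 2) := by
    rcases le_total (n (f x)) (n x + 1) with hle | hle
    · exact key _ _ _ hle h1
    · exact (key _ _ _ hle h1.symm).symm
  change ((n (f x) : ℕ) : ZMod 2) = n x + 1
  rw [h2, Nat.cast_add, Nat.cast_one]

namespace CMap

/-- Genus zero is used through the exactness in `ker_recombine_le_range`. The pair `z` prescribes no
change around vertices and a change along edges; it recombines to the constant one, as does the pair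
of a function `g` that alternates along the even faces. Their difference comes from a function `w`,
and `w + g` is the colouring. -/
theorem exists_colouring [Finite D] (m : CMap D) (hm : m.IsPlanar) (hb : m.IsBipartite) :
    ∃ v : DartFun D, (∀ d, v (m.σ d) = v d) ∧ ∀ d, v (m.α d) = v d + 1 := by
  obtain ⟨g, hg⟩ := exists_alternating m.φ fun x => by
    have h := hb (m.face x)
    rw [deg] at h
    rw [← card_sameCycle]
    rwa [Nat.card_congr (Equiv.subtypeEquivRight fun d => by
      rw [face_eq_face, Equiv.Perm.sameCycle_comm])] at h
  obtain ⟨a, ha⟩ := exists_alternating m.α fun x => by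
    have hd : Function.minimalPeriod m.α x ∣ 2 :=
      Function.IsPeriodicPt.minimalPeriod_dvd (m.involutive x)
    rcases (Nat.dvd_prime Nat.prime_two).mp hd with h | h
    · exact absurd (Function.minimalPeriod_eq_one_iff_isFixedPt.mp h) (m.ne_self x)
    · rw [h]; exact even_two
  have ha' : cobdry m.α a = fun _ => 1 := by funext x; simp [ha]
  let z : LinearMap.range (cobdry m.σ) × LinearMap.range (cobdry m.α) :=
    (0, (cobdry m.α).rangeRestrict a)
  have hz : recombine m.σ m.α z = fun _ => 1 := by
    funext x
    change (0 : ZMod 2) + cobdry m.α a x = 1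
    rw [ha', zero_add]
  have hk : z - pairCobdry m.σ m.α g ∈ LinearMap.ker (recombine m.σ m.α) := by
    rw [LinearMap.mem_ker, map_sub, recombine_pairCobdry, hz, sub_eq_zero]
    funext x
    change (1 : ZMod 2) = g (m.φ x) - g x
    rw [hg]; ring
  have hpl := m.isPlanar_iff.mp hm
  obtain ⟨w, hw⟩ := ker_recombine_le_range m.σ m.α (by rw [m.orb_eq_one]; exact hpl) hk
  have hv : pairCobdry m.σ m.α (w + g) = z := by rw [map_add, hw, sub_add_cancel]
  refine ⟨w + g, fun d => ?_, fun d => ?_⟩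
  · have := congrFun (congrArg Subtype.val (congrArg Prod.fst hv)) d
    exact sub_eq_zero.mp this
  · have := congrFun (congrArg Subtype.val (congrArg Prod.snd hv)) d
    change (w + g) (m.α d) - (w + g) d = cobdry m.α a d at this
    rw [ha'] at this
    exact sub_eq_iff_eq_add'.mp this

/-- The two ends of the root edge have different colours, so the root edge is not a loop and its end
is at distance one from its origin. -/
theorem origin_mem_positiveVertices [Finite D] (m : CMap D) (hm : m.IsPlanar)
    (hb : m.IsBipartite) : m.origin m.root ∈ m.positiveVertices := by
  have hne : m.origin (m.α m.root) ≠ m.origin m.root := by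
    intro h
    obtain ⟨v, h1, h2⟩ := m.exists_colouring hm hb
    have := sameCycle_invariant h1 ((m.origin_eq_origin _ _).mp h)
    rw [h2] at this
    simp at this
  change m.graph.dist _ _ = m.graph.dist _ _ + 1
  rw [SimpleGraph.dist_self, zero_add, SimpleGraph.dist_eq_one_iff_adj, graph,
    SimpleGraph.fromRel_adj]
  exact ⟨hne, Or.inr ⟨m.root, rfl, rfl⟩⟩

theorem fullWeight_eq [Finite D] (q : ℕ → ℝ≥0) (m : CMap D) :
    m.fullWeight q = q (m.perimeter / 2) * m.weight q := by
  have h : (q (m.perimeter / 2) : ℝ≥0∞) =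
      ∏ f : m.Face, if f = m.rootFace then (q (m.deg f / 2) : ℝ≥0∞) else 1 := by
    rw [Finset.prod_ite_eq' Finset.univ m.rootFace (fun f => (q (m.deg f / 2) : ℝ≥0∞)),
      if_pos (Finset.mem_univ _)]
    rfl
  rw [h, weight, ← Finset.prod_mul_distrib, fullWeight]
  refine Finset.prod_congr rfl fun f _ => ?_
  split_ifs <;> simp

theorem weight_lt_top [Finite D] (q : ℕ → ℝ≥0) (m : CMap D) : m.weight q < ∞ := by
  rw [weight, lt_top_iff_ne_top]
  refine ENNReal.prod_ne_top fun f _ => ?_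
  split_ifs <;> simp

end CMap

end Colouring

theorem exists_edgeMap {m : RMap} (h : m.perimeter ≠ 0) : ∃ e : EdgeMap, m = some e := by
  cases m with
  | none => exact absurd rfl h
  | some e => exact ⟨e, rfl⟩

/-- Each map of perimeter `2 * j`, pointed at the origin of its root edge, contributes to `Z`; there
the root face is weighted too, whence the factor `q j`. -/
theorem mul_Fcoef_le_Z (q : ℕ → ℝ≥0) (j : ℕ) (hj : 1 ≤ j) : q j * Fcoef q j ≤ Z q := by
  refine le_trans ?_ le_add_self
  rw [Fcoef, ← ENNReal.tsum_mul_left]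
  have hE : ∀ m : {m : RMap // m ∈ maps ∧ m.perimeter = 2 * j}, ∃ e : EdgeMap, m.1 = some e :=
    fun m => exists_edgeMap (by rw [m.2.2]; omega)
  choose e he using hE
  refine le_trans ?_ (ENNReal.tsum_comp_le_tsum_of_injective
    (f := fun m => (⟨e m, he m ▸ m.2.1⟩ : {e : EdgeMap // some e ∈ maps}))
    (fun a b h => ?_) _)
  · refine ENNReal.tsum_le_tsum fun m => ?_
    have hmem : some (e m) ∈ maps := he m ▸ m.2.1
    obtain ⟨h1, h2⟩ := mem_maps_some hmem
    refine le_trans (le_of_eq ?_) (ENNReal.le_tsum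
      (⟨_, (e m).rep.origin_mem_positiveVertices h1 h2⟩ : (e m).rep.positiveVertices))
    have hp : (e m).rep.perimeter = 2 * j := by
      have h3 := m.2.2
      rw [he m] at h3
      exact h3
    have hw : m.1.weight q = (e m).rep.weight q := by rw [he m]; rfl
    rw [CMap.fullWeight_eq, hp, hw, Nat.mul_div_cancel_left _ two_pos]
  · have : e a = e b := congrArg Subtype.val h
    exact Subtype.ext (by rw [he a, he b, this])

/-! ### Adding a chord in the root face -/

/-- An invariant with at least as many values as there are cycles separates the cycles. -/
theorem sameCycle_of_eq_of_cyc_le {D Y : Type} [Finite D] {f : Equiv.Perm D} {v : D → Y}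
    (h : ∀ x, v (f x) = v x) (hs : Function.Surjective v) (hc : cyc f ≤ Nat.card Y) (x y : D) :
    v x = v y ↔ f.SameCycle x y := by
  refine ⟨fun hxy => ?_, sameCycle_invariant h⟩
  let u : Quotient (Equiv.Perm.SameCycle.setoid f) → Y :=
    Quotient.lift v fun x y hxy => sameCycle_invariant h hxy
  have hu : Function.Surjective u := fun y => by
    obtain ⟨x, rfl⟩ := hs y
    exact ⟨Quotient.mk _ x, rfl⟩
  have hb := hu.bijective_of_nat_card_le hc
  exact Quotient.exact (hb.1 (a₁ := Quotient.mk _ x) (a₂ := Quotient.mk _ y) hxy)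

section Chord

variable {D : Type} [Finite D]

/-- Insert two new points in a permutation, after `a` and after `b`, and exchange what follows. -/
def chordPermFun (f : Equiv.Perm D) (a b : D) : D ⊕ Bool → D ⊕ Bool
  | Sum.inl d => if d = a then Sum.inr true else if d = b then Sum.inr false else Sum.inl (f d)
  | Sum.inr true => Sum.inl (f b)
  | Sum.inr false => Sum.inl (f a)

omit [Finite D] in
theorem chordPermFun_injective (f : Equiv.Perm D) {a b : D} (hab : a ≠ b) :
    Function.Injective (chordPermFun f a b) := by
  have hf := f.injective
  rintro (x | (_ | _)) (y | (_ | _)) h <;> simp only [chordPermFun] at h <;>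
    (try split_ifs at h) <;> simp_all

/-- The face permutation after the insertion of a chord. -/
def chordPerm (f : Equiv.Perm D) {a b : D} (hab : a ≠ b) : Equiv.Perm (D ⊕ Bool) :=
  Equiv.ofBijective _ (Finite.injective_iff_bijective.mp (chordPermFun_injective f hab))

theorem chordPerm_inl (f : Equiv.Perm D) {a b : D} (hab : a ≠ b) (d : D) :
    chordPerm f hab (Sum.inl d) =
      if d = a then Sum.inr true else if d = b then Sum.inr false else Sum.inl (f d) := rfl

theorem chordPerm_true (f : Equiv.Perm D) {a b : D} (hab : a ≠ b) :
    chordPerm f hab (Sum.inr true) = Sum.inl (f b) := rfl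

theorem chordPerm_false (f : Equiv.Perm D) {a b : D} (hab : a ≠ b) :
    chordPerm f hab (Sum.inr false) = Sum.inl (f a) := rfl

namespace CMap

theorem chord_connected (m : CMap D) {a b : D} (hab : a ≠ b) (x y : D ⊕ Bool) :
    Relation.EqvGen (Step (chordPerm m.φ hab * m.α.sumCongr Equiv.boolNot)
      (m.α.sumCongr Equiv.boolNot)) x y := by
  set A : Equiv.Perm (D ⊕ Bool) := m.α.sumCongr Equiv.boolNot with hA
  set S := chordPerm m.φ hab * A with hS
  have hσ : ∀ x, Relation.EqvGen (Step S A) x (S x) := fun x => .rel _ _ (Or.inl rfl)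
  have hα : ∀ x, Relation.EqvGen (Step S A) x (A x) := fun x => .rel _ _ (Or.inr rfl)
  have hSl : ∀ d, S (Sum.inl d) = chordPerm m.φ hab (Sum.inl (m.α d)) := fun d => rfl
  have hSt : S (Sum.inr true) = Sum.inl (m.φ a) := rfl
  have hSf : S (Sum.inr false) = Sum.inl (m.φ b) := rfl
  have hφ : ∀ d, m.φ (m.α d) = m.σ d := fun d => by
    change m.σ (m.α (m.α d)) = _
    rw [m.involutive]
  have h1 : ∀ d, Relation.EqvGen (Step S A) (Sum.inl d) (Sum.inl (m.σ d)) := by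
    intro d
    have h := hσ (Sum.inl d)
    rw [hSl, chordPerm_inl] at h
    split_ifs at h with ha hb
    · refine h.trans _ _ _ ?_
      rw [← hφ, ha, ← hSt]
      exact hσ _
    · refine h.trans _ _ _ ?_
      rw [← hφ, hb, ← hSf]
      exact hσ _
    · rwa [hφ] at h
  have h2 : ∀ d d', Relation.EqvGen (Step m.σ m.α) d d' →
      Relation.EqvGen (Step S A) (Sum.inl d) (Sum.inl d') := by
    intro d d' h
    induction h with
    | rel x y h =>
      rcases h with rfl | rfl
      · exact h1 x
      · exact hα (Sum.inl x)
    | refl x => exact .refl _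
    | symm x y _ ih => exact ih.symm _ _
    | trans x y z _ _ ih1 ih2 => exact ih1.trans _ _ _ ih2
  have h3 : ∀ x, Relation.EqvGen (Step S A) x (Sum.inl m.root) := by
    rintro (d | (_ | _))
    · exact h2 _ _ (m.connected _ _)
    · exact (hσ _).trans _ _ _ (h2 _ _ (m.connected _ _))
    · exact (hσ _).trans _ _ _ (h2 _ _ (m.connected _ _))
  exact (h3 x).trans _ _ _ ((h3 y).symm _ _)

/-- The map with a chord added between the corners that follow `a` and `b`, rooted at the chord. -/
def chord (m : CMap D) {a b : D} (hab : a ≠ b) : CMap (D ⊕ Bool) where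
  σ := chordPerm m.φ hab * m.α.sumCongr Equiv.boolNot
  α := m.α.sumCongr Equiv.boolNot
  root := Sum.inr false
  involutive d := by
    rcases d with d | d
    · exact congrArg Sum.inl (m.involutive d)
    · exact congrArg Sum.inr (Bool.not_not d)
  ne_self d := by
    rcases d with d | d
    · intro h
      exact m.ne_self d (Sum.inl.inj h)
    · intro h
      exact Bool.not_ne_self d (Sum.inr.inj h)
  connected := m.chord_connected hab

theorem φ_chord (m : CMap D) {a b : D} (hab : a ≠ b) : (m.chord hab).φ = chordPerm m.φ hab := by
  ext1 x
  change chordPerm m.φ hab ((m.chord hab).α ((m.chord hab).α x)) = _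
  rw [(m.chord hab).involutive]

/-- A chord creates no identification of vertices: its two darts start at the origins of `m.φ a` and
`m.φ b`, and all old origins remain invariant. -/
theorem cyc_σ_le_chord (m : CMap D) {a b : D} (hab : a ≠ b) :
    cyc m.σ ≤ cyc (m.chord hab).σ := by
  let v : D ⊕ Bool → m.Vertex := Sum.elim m.origin
    fun c => if c then m.origin (m.φ a) else m.origin (m.φ b)
  have ho : ∀ d, m.origin (m.σ d) = m.origin d := fun d =>
    (m.origin_eq_origin _ _).mpr (Equiv.Perm.sameCycle_apply_left.mpr (Equiv.Perm.SameCycle.refl _ _))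
  have hφ : ∀ d, m.φ (m.α d) = m.σ d := fun d => by
    change m.σ (m.α (m.α d)) = _
    rw [m.involutive]
  refine card_le_cyc (Y := m.Vertex) _ v (fun x => ?_) fun y => ?_
  · rcases x with d | (_ | _)
    · change v (chordPerm m.φ hab (Sum.inl (m.α d))) = m.origin d
      rw [chordPerm_inl]
      split_ifs with h1 h2
      · change m.origin (m.φ a) = _
        rw [← h1, hφ, ho]
      · change m.origin (m.φ b) = _
        rw [← h2, hφ, ho]
      · change m.origin (m.φ (m.α d)) = _
        rw [hφ, ho]
    · rfl
    · rfl
  · obtain ⟨d, rfl⟩ := Quotient.mk_surjective y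
    exact ⟨Sum.inl d, rfl⟩

/-- Reconstruction of the map before the insertion of the chord. -/
theorem iso_of_chord {D' : Type} [Finite D'] (m : CMap D) (m' : CMap D') {a : D} {a' : D'}
    (hab : a ≠ m.φ⁻¹ m.root) (hab' : a' ≠ m'.φ⁻¹ m'.root) (h : (m.chord hab).Iso (m'.chord hab')) :
    m.Iso m' := by
  obtain ⟨e, he⟩ := iso_iff.mp h
  have ef : e (Sum.inr false) = Sum.inr false := he.3
  have hαf : ∀ x, e ((m.chord hab).α x) = (m'.chord hab').α (e x) := he.2
  have et : e (Sum.inr true) = Sum.inr true := by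
    have := hαf (Sum.inr false)
    rw [ef] at this
    exact this
  have hl : ∀ d, ∃ d', e (Sum.inl d) = Sum.inl d' := by
    intro d
    rcases h : e (Sum.inl d) with d' | (_ | _)
    · exact ⟨d', rfl⟩
    · exact absurd (e.injective (h.trans ef.symm)) (by simp)
    · exact absurd (e.injective (h.trans et.symm)) (by simp)
  have hl' : ∀ d', ∃ d, e (Sum.inl d) = Sum.inl d' := by
    intro d'
    obtain ⟨x, hx⟩ := e.surjective (Sum.inl d')
    rcases x with d | (_ | _)
    · exact ⟨d, hx⟩
    · rw [ef] at hx; simp at hx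
    · rw [et] at hx; simp at hx
  choose g hg using hl
  have hgb : Function.Bijective g := by
    constructor
    · intro x y hxy
      have : e (Sum.inl x) = e (Sum.inl y) := by rw [hg, hg, hxy]
      exact Sum.inl.inj (e.injective this)
    · intro d'
      obtain ⟨d, hd⟩ := hl' d'
      exact ⟨d, Sum.inl.inj (by rw [← hg, hd])⟩
  have hφ : ∀ x, e (chordPerm m.φ hab x) = chordPerm m'.φ hab' (e x) := by
    intro x
    have := he.φ x
    rwa [φ_chord, φ_chord] at this
  -- The two sides of the chord are followed by the old root and by `m.φ a`, so an isomorphism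
  -- respecting the chord respects these darts.
  have hb : g m.root = m'.root := by
    have := hφ (Sum.inr true)
    rw [et, chordPerm_true, chordPerm_true, hg] at this
    simpa using this
  have ha : g (m.φ a) = m'.φ a' := by
    have := hφ (Sum.inr false)
    rw [ef, chordPerm_false, chordPerm_false, hg] at this
    simpa using this
  -- The face permutation differs from the old one only at `a` and at the predecessor of the root,
  -- where the preceding identities apply.
  have hgφ : ∀ d, g (m.φ d) = m'.φ (g d) := by
    intro d
    have := hφ (Sum.inl d)
    rw [hg, chordPerm_inl, chordPerm_inl] at this
    by_cases h1 : d = a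
    · rw [if_pos h1, et] at this
      by_cases h2 : g d = a'
      · rw [h1, ha, ← h1, h2]
      · rw [if_neg h2] at this
        split_ifs at this
        simp at this
    · rw [if_neg h1] at this
      by_cases h2 : d = m.φ⁻¹ m.root
      · rw [if_pos h2, ef] at this
        split_ifs at this with h3 h4
        · simp at this
        · rw [h4, h2]
          simpa using hb
      · rw [if_neg h2, hg] at this
        split_ifs at this
        exact Sum.inl.inj this
  have hgα : ∀ d, g (m.α d) = m'.α (g d) := by
    intro d
    have := hαf (Sum.inl d)
    rw [hg] at this
    change e (Sum.inl (m.α d)) = Sum.inl (m'.α (g d)) at this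
    rw [hg] at this
    exact Sum.inl.inj this
  refine iso_iff.mpr ⟨Equiv.ofBijective g hgb, fun d => ?_, hgα, hb⟩
  change g (m.σ d) = m'.σ (g d)
  have h1 : m.σ d = m.φ (m.α d) := by
    change _ = m.σ (m.α (m.α d))
    rw [m.involutive]
  rw [h1, hgφ, hgα]
  change m'.σ (m'.α (m'.α _)) = _
  rw [m'.involutive]

/-! #### The faces of the new map -/

section Faces

variable (m : CMap D) (l : ℕ)

/-- The first `l + 1` darts of the boundary. -/
def Initial (d : D) : Prop := ∃ i ≤ l, (m.φ ^ i) m.root = d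

theorem minimalPeriod_root : Function.minimalPeriod m.φ m.root = m.perimeter := by
  rw [← card_sameCycle, perimeter, deg]
  refine Nat.card_congr (Equiv.subtypeEquivRight fun d => ?_)
  rw [rootFace, face_eq_face, Equiv.Perm.sameCycle_comm]

variable {m l}

omit [Finite D] in
theorem Initial.isBoundary {d : D} (h : m.Initial l d) : m.IsBoundary d := by
  obtain ⟨i, -, rfl⟩ := h
  rw [isBoundary_iff]
  exact Equiv.Perm.sameCycle_pow_left.mpr (Equiv.Perm.SameCycle.refl _ _)

theorem pow_root_inj {i i' : ℕ} (hi : i < m.perimeter) (hi' : i' < m.perimeter)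
    (h : (m.φ ^ i) m.root = (m.φ ^ i') m.root) : i = i' := by
  rw [Equiv.Perm.coe_pow, Equiv.Perm.coe_pow] at h
  rw [← minimalPeriod_root] at hi hi'
  exact Function.iterate_injOn_Iio_minimalPeriod hi hi' h

theorem card_initial (hl : l + 1 < m.perimeter) : Nat.card {d // m.Initial l d} = l + 1 := by
  rw [← Nat.card_fin (l + 1)]
  refine (Nat.card_congr (Equiv.ofBijective (fun i : Fin (l + 1) =>
    (⟨(m.φ ^ (i : ℕ)) m.root, i, by omega, rfl⟩ : {d // m.Initial l d})) ⟨?_, ?_⟩)).symm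
  · intro i j h
    exact Fin.ext (pow_root_inj (by omega) (by omega) (congrArg Subtype.val h))
  · rintro ⟨d, i, hi, rfl⟩
    exact ⟨⟨i, by omega⟩, rfl⟩

theorem not_initial_last (hl : l + 1 < m.perimeter) : ¬ m.Initial l (m.φ⁻¹ m.root) := by
  rintro ⟨i, hi, h⟩
  have h1 : (m.φ ^ (i + 1)) m.root = (m.φ ^ 0) m.root := by
    rw [pow_succ', Equiv.Perm.mul_apply, h]; simp
  have := pow_root_inj (by omega) (by omega) h1
  omega

omit [Finite D] in
theorem initial_pow : m.Initial l ((m.φ ^ l) m.root) := ⟨l, le_rfl, rfl⟩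

theorem chord_ne (hl : l + 1 < m.perimeter) : (m.φ ^ l) m.root ≠ m.φ⁻¹ m.root := fun h =>
  not_initial_last hl (h ▸ initial_pow)

variable (m l) in
/-- The faces of the map with a chord: `none` is the face cut off by the chord. -/
def chordFace : D ⊕ Bool → Option m.Face
  | Sum.inl d => if m.Initial l d then none else some (m.face d)
  | Sum.inr c => if c then none else some m.rootFace

theorem chordFace_invariant (hl : l + 1 < m.perimeter) (x : D ⊕ Bool) :
    m.chordFace l ((m.chord (chord_ne hl)).φ x) = m.chordFace l x := by
  rw [φ_chord]
  have hroot : m.φ (m.φ⁻¹ m.root) = m.root := by simp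
  have hface : ∀ d, m.face (m.φ d) = m.face d := fun d =>
    (m.face_eq_face _ _).mpr (Equiv.Perm.sameCycle_apply_left.mpr (Equiv.Perm.SameCycle.refl _ _))
  rcases x with d | (_ | _)
  · rw [chordPerm_inl]
    split_ifs with h1 h2
    · rw [h1]
      simp [chordFace, initial_pow]
    · rw [h2]
      simp only [chordFace, if_neg (not_initial_last hl)]
      rw [← hface, hroot]
      simp [rootFace]
    · have : m.Initial l (m.φ d) ↔ m.Initial l d := by
        constructor
        · rintro ⟨i, hi, h⟩
          cases i with
          | zero =>
            exact absurd (by rw [pow_zero, Equiv.Perm.one_apply] at h; rw [h]; simp) h2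
          | succ i =>
            rw [pow_succ', Equiv.Perm.mul_apply] at h
            exact ⟨i, by omega, m.φ.injective h⟩
        · rintro ⟨i, hi, rfl⟩
          refine ⟨i + 1, ?_, by rw [pow_succ', Equiv.Perm.mul_apply]⟩
          have : i ≠ l := by rintro rfl; exact h1 rfl
          omega
      simp only [chordFace, this, hface]
  · rw [chordPerm_false]
    have h1 : ¬ m.Initial l (m.φ ((m.φ ^ l) m.root)) := by
      rintro ⟨i, hi, h⟩
      rw [← Equiv.Perm.mul_apply, ← pow_succ'] at h
      have := pow_root_inj (by omega) (by omega) h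
      omega
    have h2 : m.face (m.φ ((m.φ ^ l) m.root)) = m.rootFace := by
      rw [hface]
      exact initial_pow.isBoundary
    simp only [chordFace, if_neg h1, h2]
    rfl
  · rw [chordPerm_true, hroot]
    have : m.Initial l m.root := ⟨0, by omega, rfl⟩
    simp [chordFace, this]

omit [Finite D] in
theorem chordFace_surjective : Function.Surjective (m.chordFace l) := by
  rintro (_ | f)
  · exact ⟨Sum.inr true, rfl⟩
  · by_cases hf : f = m.rootFace
    · exact ⟨Sum.inr false, by rw [hf]; rfl⟩
    · obtain ⟨d, rfl⟩ := m.face_surjective f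
      exact ⟨Sum.inl d, if_neg fun h => hf h.isBoundary⟩

/-- There is one more edge, at least one more face, and no fewer vertices. Starting from equality in
Euler's formula, the genus inequality for the new map must be sharp, so there is exactly one more
face. -/
theorem cyc_chord_eq (hm : m.IsPlanar) (hl : l + 1 < m.perimeter) :
    (m.chord (chord_ne hl)).IsPlanar ∧
      cyc (m.chord (chord_ne hl)).φ ≤ Nat.card (Option m.Face) := by
  have h1 := m.cyc_σ_le_chord (chord_ne hl)
  have h2 := card_le_cyc _ _ (chordFace_invariant hl) chordFace_surjective
  have h3 := (m.chord (chord_ne hl)).euler_le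
  have h4 := (m.chord (chord_ne hl)).card_eq_cyc_α
  have h5 := m.card_eq_cyc_α
  have h6 := m.isPlanar_iff.mp hm
  have h7 : Nat.card (Option m.Face) = cyc m.φ + 1 := Finite.card_option
  have h8 : Nat.card (D ⊕ Bool) = Nat.card D + 2 := by
    rw [Nat.card_sum]; simp
  rw [isPlanar_iff]
  omega

theorem chordFace_iff (hm : m.IsPlanar) (hl : l + 1 < m.perimeter) (x y : D ⊕ Bool) :
    m.chordFace l x = m.chordFace l y ↔ (m.chord (chord_ne hl)).φ.SameCycle x y :=
  sameCycle_of_eq_of_cyc_le (chordFace_invariant hl) chordFace_surjective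
    (cyc_chord_eq hm hl).2 x y

theorem card_chordFace_none (hl : l + 1 < m.perimeter) :
    Nat.card {x // m.chordFace l x = none} = l + 2 := by
  have : {x // m.chordFace l x = none} ≃ {d // m.Initial l d} ⊕ {c : Bool // c = true} :=
    (Equiv.subtypeSum).trans (Equiv.sumCongr
      (Equiv.subtypeEquivRight fun d => by simp [chordFace])
      (Equiv.subtypeEquivRight fun c => by simp [chordFace]))
  rw [Nat.card_congr this, Nat.card_sum, card_initial hl]
  simp

theorem card_chordFace_some {f : m.Face} (hf : f ≠ m.rootFace) :
    Nat.card {x // m.chordFace l x = some f} = m.deg f := by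
  have : {x // m.chordFace l x = some f} ≃ {d // m.face d = f} ⊕ {c : Bool // False} :=
    (Equiv.subtypeSum).trans (Equiv.sumCongr
      (Equiv.subtypeEquivRight fun d => by
        simp only [chordFace]
        split_ifs with h
        · simp only [false_iff]
          rintro rfl
          exact hf h.isBoundary
        · simp)
      (Equiv.subtypeEquivRight fun c => by
        simp only [chordFace]
        split_ifs <;> simp [hf.symm]))
  rw [Nat.card_congr this, Nat.card_sum, deg]
  simp

theorem card_chordFace_root (hl : l + 1 < m.perimeter) :
    Nat.card {x // m.chordFace l x = some m.rootFace} + l = m.perimeter := by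
  have : {x // m.chordFace l x = some m.rootFace} ≃
      {d // m.IsBoundary d ∧ ¬ m.Initial l d} ⊕ {c : Bool // c = false} :=
    (Equiv.subtypeSum).trans (Equiv.sumCongr
      (Equiv.subtypeEquivRight fun d => by
        simp only [chordFace, IsBoundary]
        split_ifs with h <;> simp [h])
      (Equiv.subtypeEquivRight fun c => by
        simp only [chordFace]
        split_ifs <;> simp_all))
  rw [Nat.card_congr this, Nat.card_sum]
  have h1 : Nat.card {d // m.IsBoundary d} =
      Nat.card {d // m.Initial l d} + Nat.card {d // m.IsBoundary d ∧ ¬ m.Initial l d} := by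
    rw [← Nat.card_sum]
    refine Nat.card_congr ((Equiv.sumCompl fun d : {d // m.IsBoundary d} =>
      m.Initial l d.1).symm.trans (Equiv.sumCongr ?_ ?_))
    · exact (Equiv.subtypeSubtypeEquivSubtype (p := m.IsBoundary) (q := m.Initial l)
        fun h => h.isBoundary)
    · exact Equiv.subtypeSubtypeEquivSubtypeInter m.IsBoundary fun d => ¬ m.Initial l d
  rw [card_initial hl] at h1
  have h2 : m.perimeter = Nat.card {d // m.IsBoundary d} := rfl
  rw [h2, h1]
  simp
  omega

end Faces

/-- With `l = 2 * j - 2`, the face cut off has `2 * j - 1` old boundary darts and one side of the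
chord, hence degree `2 * j`. The other side of the chord belongs to the new root face. -/
theorem chord_spec (m : CMap D) (hm : m.IsPlanar) (hb : m.IsBipartite) {j k : ℕ} (hj : 2 ≤ j)
    (hjk : j ≤ k) (hp : m.perimeter = 2 * k) (hl : 2 * j - 2 + 1 < m.perimeter) :
    (m.chord (chord_ne hl)).toRMap ∈ maps ∧
      (m.chord (chord_ne hl)).toRMap.perimeter = 2 * (k + 1 - j) ∧
      ∀ q : ℕ → ℝ≥0, (m.chord (chord_ne hl)).toRMap.weight q = q j * m.weight q := by
  have hg := chordFace_iff hm hl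
  have hs := chordFace_surjective (m := m) (l := 2 * j - 2)
  have hr : m.chordFace (2 * j - 2) (m.chord (chord_ne hl)).root = some m.rootFace := rfl
  have hc := card_chordFace_root hl
  have hn := card_chordFace_none hl
  refine ⟨?_, ?_, fun q => ?_⟩
  · rw [toRMap_mem_maps]
    refine ⟨(cyc_chord_eq hm hl).1, ?_⟩
    rw [isBipartite_iff_fiber hg hs]
    rintro (_ | f)
    · rw [hn]
      exact ⟨j, by omega⟩
    · by_cases hf : f = m.rootFace
      · rw [hf]
        exact ⟨k + 1 - j, by omega⟩
      · rw [card_chordFace_some hf]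
        exact hb f
  · rw [perimeter_toRMap, perimeter_eq_card_fiber hg hs, hr]
    omega
  · rw [weight_toRMap, weight_eq_prod q hg hs, hr, Fintype.prod_option, if_neg (by simp), hn]
    congr 1
    · congr 2
      omega
    · refine Finset.prod_congr rfl fun f _ => ?_
      by_cases hf : f = m.rootFace
      · rw [if_pos hf, if_pos (by rw [hf])]
      · rw [if_neg hf, if_neg (by simpa using hf), card_chordFace_some hf]

end CMap

end Chord

/-- The chord turns part of the root face into an internal face of degree `2 * j`. The operation is
injective because the new map is rooted at the chord, which can therefore be erased. -/
theorem mul_Fcoef_le (q : ℕ → ℝ≥0) {j k : ℕ} (hj : 2 ≤ j) (hjk : j ≤ k) :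
    q j * Fcoef q k ≤ Fcoef q (k + 1 - j) := by
  have hE : ∀ m : {m : RMap // m ∈ maps ∧ m.perimeter = 2 * k}, ∃ e : EdgeMap, m.1 = some e :=
    fun m => exists_edgeMap (by rw [m.2.2]; omega)
  choose e he using hE
  have hmem : ∀ m, some (e m) ∈ maps := fun m => he m ▸ m.2.1
  have hp : ∀ m, (e m).rep.perimeter = 2 * k := by
    intro m
    have h3 := m.2.2
    rw [he m] at h3
    exact h3
  have hl : ∀ m, 2 * j - 2 + 1 < (e m).rep.perimeter := fun m => by rw [hp]; omega
  have hspec := fun m => (e m).rep.chord_spec (mem_maps_some (hmem m)).1 (mem_maps_some (hmem m)).2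
    hj hjk (hp m) (hl m)
  rw [Fcoef, ← ENNReal.tsum_mul_left]
  refine le_trans ?_ (ENNReal.tsum_comp_le_tsum_of_injective
    (f := fun m => (⟨_, (hspec m).1, (hspec m).2.1⟩ :
      {m : RMap // m ∈ maps ∧ m.perimeter = 2 * (k + 1 - j)}))
    (fun a b h => ?_) _)
  · refine ENNReal.tsum_le_tsum fun m => ?_
    rw [(hspec m).2.2]
    have hw : m.1.weight q = (e m).rep.weight q := by rw [he m]; rfl
    rw [hw]
  · have h1 := (CMap.toRMap_eq_iff _ _).mp (congrArg Subtype.val h)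
    have h2 := (CMap.toRMap_eq_iff _ _).mpr (CMap.iso_of_chord _ _ _ _ h1)
    rw [CMap.toRMap_rep, CMap.toRMap_rep, ← he, ← he] at h2
    exact Subtype.ext h2

/-! ### Countability -/

instance CMap.instFinite {D : Type} [Finite D] : Finite (CMap D) :=
  Finite.of_injective (β := Equiv.Perm D × Equiv.Perm D × D) (fun m => (m.σ, m.α, m.root)) (by
    rintro ⟨σ, α, r, _, _, _⟩ ⟨σ', α', r', _, _, _⟩ h
    simp only [Prod.mk.injEq] at h
    obtain ⟨rfl, rfl, rfl⟩ := h
    rfl)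

instance EdgeMap.instCountable : Countable EdgeMap := Quotient.countable

instance RMap.instCountable : Countable RMap :=
  inferInstanceAs (Countable (Option EdgeMap))

instance PlaneTree.instCountable : Countable PlaneTree :=
  Function.Injective.countable (f := PlaneTree.verts) fun _ _ h => PlaneTree.ext_verts h

instance : DiscreteMeasurableSpace RMap := ⟨fun _ => trivial⟩

instance : DiscreteMeasurableSpace PlaneTree := ⟨fun _ => trivial⟩

/-! ### Positivity of the radius of convergence -/

theorem RMap.weight_lt_top (q : ℕ → ℝ≥0) (m : RMap) : m.weight q < ∞ := by
  cases m with
  | none => exact ENNReal.one_lt_top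
  | some e => exact CMap.weight_lt_top q e.rep

theorem Fcoef_lt_top_of_ne_zero {q : ℕ → ℝ≥0} (hq : Admissible q) {j : ℕ} (hj : 1 ≤ j)
    (h : q j ≠ 0) : Fcoef q j < ∞ := by
  have h1 := (mul_Fcoef_le_Z q j hj).trans_lt hq
  rw [lt_top_iff_ne_top] at h1 ⊢
  intro h2
  rw [h2, ENNReal.mul_top (by simpa using h)] at h1
  exact h1 rfl

/-- The chord inequality lowers the index by `j - 1 ≥ 1` at the cost of a factor `1 / q j`. Iterated
until the index is below `j`, where monotonicity bounds `F_k` by `F_j`, it gives geometric growth.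
-/
theorem exists_F_lt_top_of_ne_zero {q : ℕ → ℝ≥0} (hq : Admissible q) {j : ℕ} (hj : 2 ≤ j)
    (h : q j ≠ 0) : ∃ x, 0 < x ∧ F q x < ∞ := by
  have hC := Fcoef_lt_top_of_ne_zero hq (by omega) h
  set C := Fcoef q j
  have hmono : Monotone (Fcoef q) := monotone_nat_of_le_succ (Fcoef_le_succ q)
  -- The maximum with one makes the powers of `A` nondecreasing, so that one factor `A` is absorbed
  -- by each descent.
  set A : ℝ≥0 := max 1 (q j)⁻¹ with hA
  have hA1 : (1 : ℝ≥0∞) ≤ A := by exact_mod_cast le_max_left _ _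
  have hAq : ((q j : ℝ≥0∞))⁻¹ ≤ A := by
    rw [← ENNReal.coe_inv h]; exact_mod_cast le_max_right _ _
  have hq0 : (q j : ℝ≥0∞) ≠ 0 := by simpa using h
  have key : ∀ k, Fcoef q k ≤ C * (A : ℝ≥0∞) ^ k := by
    intro k
    induction k using Nat.strong_induction_on with
    | _ k ih =>
      rcases lt_or_ge k j with hk | hk
      · exact (hmono hk.le).trans (le_mul_of_one_le_right bot_le (one_le_pow₀ hA1))
      · have h1 : Fcoef q k ≤ (q j : ℝ≥0∞)⁻¹ * Fcoef q (k + 1 - j) := by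
          rw [← ENNReal.mul_le_iff_le_inv hq0 ENNReal.coe_ne_top]
          exact mul_Fcoef_le q hj hk
        calc Fcoef q k ≤ (q j : ℝ≥0∞)⁻¹ * Fcoef q (k + 1 - j) := h1
          _ ≤ A * (C * (A : ℝ≥0∞) ^ (k + 1 - j)) := mul_le_mul' hAq (ih _ (by omega))
          _ = C * (A : ℝ≥0∞) ^ (k + 1 - j + 1) := by ring
          _ ≤ C * (A : ℝ≥0∞) ^ k := mul_le_mul_right (pow_le_pow_right' hA1 (by omega)) C
  have hA0 : (A : ℝ≥0∞) ≠ 0 := (zero_lt_one.trans_le hA1).ne'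
  refine ⟨(2 * A : ℝ≥0∞)⁻¹, ?_, ?_⟩
  · rw [ENNReal.inv_pos]
    exact ENNReal.mul_ne_top ENNReal.ofNat_ne_top ENNReal.coe_ne_top
  · have h2 : F q (2 * A : ℝ≥0∞)⁻¹ ≤ ∑' k : ℕ, C * (2⁻¹ : ℝ≥0∞) ^ k := by
      refine ENNReal.tsum_le_tsum fun k => ?_
      calc _ ≤ C * (A : ℝ≥0∞) ^ k * ((2 * A : ℝ≥0∞)⁻¹) ^ k := by gcongr; exact key k
        _ = C * (2⁻¹ : ℝ≥0∞) ^ k := by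
          rw [mul_assoc, ← mul_pow, ENNReal.mul_inv (Or.inl two_ne_zero)
            (Or.inl ENNReal.ofNat_ne_top), mul_comm (2⁻¹ : ℝ≥0∞), ← mul_assoc,
            ENNReal.mul_inv_cancel hA0 ENNReal.coe_ne_top, one_mul]
    refine h2.trans_lt ?_
    rw [ENNReal.tsum_mul_left, ENNReal.tsum_geometric, ENNReal.one_sub_inv_two, inv_inv]
    exact ENNReal.mul_lt_top hC ENNReal.ofNat_lt_top

/-! ### Weight sequences charging only digons -/

namespace CMap

variable {D : Type} [Finite D]

theorem deg_pos (m : CMap D) (f : m.Face) : 0 < m.deg f := by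
  obtain ⟨d, rfl⟩ := m.face_surjective f
  have : Nonempty {x // m.face x = m.face d} := ⟨⟨d, rfl⟩⟩
  exact Nat.card_pos

theorem deg_weight_ne_zero {m : CMap D} {q : ℕ → ℝ≥0} (hw : m.weight q ≠ 0) {f : m.Face}
    (hf : f ≠ m.rootFace) : q (m.deg f / 2) ≠ 0 := by
  rw [weight, Finset.prod_ne_zero_iff] at hw
  have := hw f (Finset.mem_univ _)
  rw [if_neg hf] at this
  simpa using this

theorem card_add_perimeter (m : CMap D) (h : ∀ f, f ≠ m.rootFace → m.deg f = 2) :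
    Nat.card D + 2 = 2 * Nat.card m.Face + m.perimeter := by
  rw [m.card_eq_sum_deg, ← Finset.add_sum_erase _ _ (Finset.mem_univ m.rootFace),
    Finset.sum_congr rfl fun f hf => h f (Finset.ne_of_mem_erase hf), Finset.sum_const,
    Finset.card_erase_of_mem (Finset.mem_univ _), Finset.card_univ, ← Nat.card_eq_fintype_card,
    smul_eq_mul, perimeter]
  have : 0 < Nat.card m.Face := @Nat.card_pos _ ⟨m.rootFace⟩ _
  omega

theorem perimeter_le_card_vertex {m : CMap D} (h : m.HasSimpleBoundary) :
    m.perimeter ≤ Nat.card m.Vertex :=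
  Nat.card_le_card_of_injective (fun d : {d // m.face d = m.rootFace} => m.origin d.1)
    fun d d' hd => Subtype.ext (h _ _ d.2 d'.2 hd)

/-- If the weight is not zero, all internal faces are digons and Euler's formula gives twice the
number of vertices as the perimeter plus two. A simple boundary has as many vertices as darts, so
the perimeter is at most two. -/
theorem weight_eq_zero_of_digons {m : CMap D} (hm : m.IsPlanar) (hb : m.IsBipartite)
    (hs : m.HasSimpleBoundary) {q : ℕ → ℝ≥0} (hq : ∀ j, 2 ≤ j → q j = 0) (hp : 2 < m.perimeter) :
    m.weight q = 0 := by
  by_contra hw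
  have h1 := m.card_add_perimeter fun f hf => by
    have h2 := deg_weight_ne_zero hw hf
    have h3 : ¬ 2 ≤ m.deg f / 2 := fun h => h2 (hq _ h)
    have h4 := m.deg_pos f
    obtain ⟨r, hr⟩ := hb f
    omega
  have h2 := perimeter_le_card_vertex hs
  have h3 : 2 * (Nat.card m.Vertex + Nat.card m.Face) = Nat.card D + 4 := hm
  omega

theorem card_eq_perimeter {m : CMap D} (hb : m.IsBipartite) {q : ℕ → ℝ≥0}
    (hq : ∀ j, 1 ≤ j → q j = 0) (hw : m.weight q ≠ 0) : Nat.card D = m.perimeter := by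
  have h : ∀ f, f = m.rootFace := by
    intro f
    by_contra hf
    refine deg_weight_ne_zero hw hf (hq _ ?_)
    have h4 := m.deg_pos f
    obtain ⟨r, hr⟩ := hb f
    omega
  refine Nat.card_congr ((Equiv.subtypeUnivEquiv fun d => ?_).symm)
  exact h _

end CMap

theorem FcoefHat_eq_zero {q : ℕ → ℝ≥0} (hq : ∀ j, 2 ≤ j → q j = 0) {k : ℕ} (hk : 2 ≤ k) :
    FcoefHat q k = 0 := by
  rw [FcoefHat, ENNReal.tsum_eq_zero]
  rintro ⟨m, hm, hp⟩
  obtain ⟨e, rfl⟩ := exists_edgeMap (m := m) (by omega)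
  obtain ⟨h1, h2⟩ := mem_maps_some hm.1
  exact CMap.weight_eq_zero_of_digons h1 h2 (hm.2 e rfl) hq
    (by change (e.rep).perimeter = _ at hp; omega)

theorem FcoefHat_one_lt_top {q : ℕ → ℝ≥0} (ha : Admissible q) (hq : ∀ j, 2 ≤ j → q j = 0) :
    FcoefHat q 1 < ∞ := by
  by_cases h1 : q 1 = 0
  · have hq' : ∀ j, 1 ≤ j → q j = 0 := fun j hj => by
      rcases hj.eq_or_lt with h | h
      · rw [← h, h1]
      · exact hq j h
    -- When all weights vanish, a map of nonzero weight has only its root face, hence two darts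
    -- here: finitely many maps contribute.
    let g : CMap (Fin 2) → RMap := fun c => some (Quotient.mk _ ⟨2, c⟩)
    have hfin : {m : {m : RMap // m ∈ simpleMaps ∧ m.perimeter = 2 * 1} |
        m.1.weight q ≠ 0}.Finite := by
      refine ((Set.finite_range g).preimage Subtype.val_injective.injOn).subset ?_
      rintro ⟨m, hm, hp⟩ hw
      obtain ⟨e, rfl⟩ := exists_edgeMap (m := m) (by omega)
      have hc := CMap.card_eq_perimeter (mem_maps_some hm.1).2 hq' hw
      have hz : ∀ z : Σ n, CMap (Fin n), z.1 = 2 → ∃ c : CMap (Fin 2), z = ⟨2, c⟩ := by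
        rintro ⟨n, c⟩ rfl
        exact ⟨c, rfl⟩
      obtain ⟨c, hc⟩ := hz (Quotient.out e) (by
        rw [Nat.card_fin] at hc
        rw [hc]
        exact hp)
      exact ⟨c, congrArg some (by rw [← hc]; exact Quotient.out_eq e)⟩
    rw [FcoefHat, tsum_eq_sum (s := hfin.toFinset) fun m hm => by
      by_contra h
      exact hm (hfin.mem_toFinset.mpr h)]
    exact ENNReal.sum_lt_top.mpr fun m _ => m.1.weight_lt_top q
  · exact (FcoefHat_le q 1).trans_lt (Fcoef_lt_top_of_ne_zero ha le_rfl h1)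

/-- Only components of perimeter two remain, so black vertices have exactly one child and the
recursion on trees is explicit. -/
theorem exists_F_lt_top_of_eq_zero {q : ℕ → ℝ≥0} (ha : Admissible q) (hq : ∀ j, 2 ≤ j → q j = 0) :
    ∃ x, 0 < x ∧ F q x < ∞ := by
  have hB := FcoefHat_one_lt_top ha hq
  have hB0 : FcoefHat q 1 ≠ 0 := (zero_lt_one.trans_le (one_le_FcoefHat_one q)).ne'
  set B := FcoefHat q 1 with hBdef
  -- This value gives black vertices the weight `1/4`. The bounds `2` for white roots and `1/2` for
  -- black roots are then preserved by the recursion, as `1 / (1 - 1/2) = 2` and `2 / 4 = 1/2`.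
  refine ⟨(4 * B)⁻¹, ENNReal.inv_pos.mpr (ENNReal.mul_ne_top ENNReal.ofNat_ne_top hB.ne), ?_⟩
  set x := (4 * B)⁻¹ with hx
  have hxB : x * B = 4⁻¹ := by
    rw [hx, ENNReal.mul_inv (Or.inl four_ne_zero) (Or.inl ENNReal.ofNat_ne_top), mul_assoc,
      ENNReal.inv_mul_cancel hB0 hB.ne, mul_one]
  have hbw : ∀ n, n ≠ 1 → blackWeight q x n = 0 := by
    intro n hn
    rw [blackWeight]
    split_ifs with ho
    · obtain ⟨k, rfl⟩ := ho
      rw [FcoefHat_eq_zero hq (by omega), mul_zero]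
    · rfl
  have hb1 : blackWeight q x 1 = 4⁻¹ := by
    rw [blackWeight, if_pos odd_one, ← hxB]
    simp [hBdef]
  have hnot : (fun c => treeWeight q x (!(!c))) = treeWeight q x :=
    funext fun c => by rw [Bool.not_not]
  have key : ∀ N, PlaneTree.wtSum (treeWeight q x) N ≤ 2 ∧
      PlaneTree.wtSum (fun c => treeWeight q x (!c)) N ≤ 2⁻¹ := by
    intro N
    induction N with
    | zero => simp [PlaneTree.wtSum_zero]
    | succ N ih =>
      constructor
      · refine (PlaneTree.wtSum_succ_le _ _).trans ?_
        calc _ ≤ ∑' n : ℕ, (2⁻¹ : ℝ≥0∞) ^ n := by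
              refine ENNReal.tsum_le_tsum fun n => ?_
              change 1 * _ ≤ _
              rw [one_mul]
              exact pow_le_pow_left' ih.2 n
          _ = 2 := by rw [ENNReal.tsum_geometric, ENNReal.one_sub_inv_two, inv_inv]
      · refine (PlaneTree.wtSum_succ_le _ _).trans ?_
        rw [hnot]
        change ∑' n, blackWeight q x n * PlaneTree.wtSum (treeWeight q x) N ^ n ≤ _
        rw [tsum_eq_single 1 fun n hn => by rw [hbw n hn, zero_mul], hb1, pow_one]
        calc (4⁻¹ : ℝ≥0∞) * _ ≤ 4⁻¹ * 2 := by gcongr; exact ih.1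
          _ = 2⁻¹ := by
            rw [show (4 : ℝ≥0∞) = 2 * 2 by norm_num, ENNReal.mul_inv (Or.inl two_ne_zero)
              (Or.inl ENNReal.ofNat_ne_top), mul_assoc,
              ENNReal.inv_mul_cancel two_ne_zero ENNReal.ofNat_ne_top, mul_one]
  rw [F_eq_tsum_wt]
  exact (PlaneTree.tsum_wt_le _ 2 fun N => (key N).1).trans_lt ENNReal.ofNat_lt_top

theorem exists_F_lt_top {q : ℕ → ℝ≥0} (ha : Admissible q) : ∃ x, 0 < x ∧ F q x < ∞ := by
  by_cases h : ∃ j, 2 ≤ j ∧ q j ≠ 0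
  · obtain ⟨j, hj, h⟩ := h
    exact exists_F_lt_top_of_ne_zero ha hj h
  · push Not at h
    exact exists_F_lt_top_of_eq_zero ha h

/-! ### The generating function at its radius of convergence -/

theorem F_mono (q : ℕ → ℝ≥0) : Monotone (F q) := fun x y h =>
  ENNReal.tsum_le_tsum fun k => by gcongr

/-- Only the components of perimeter two are kept in `F_eq`, and the single-edge map ensures that
their partition function is at least one. -/
theorem one_add_le_F (q : ℕ → ℝ≥0) (x : ℝ≥0∞) : 1 + x * F q x ^ 2 ≤ F q x := by
  conv_rhs => rw [F_eq]
  gcongr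
  refine le_trans ?_ (ENNReal.le_tsum 1)
  rw [blackWeight, if_pos odd_one]
  have h : x ≤ x ^ (1 / 2 + 1) * FcoefHat q (1 / 2 + 1) := by
    simpa using le_mul_of_one_le_right (a := x) bot_le (one_le_FcoefHat_one q)
  gcongr

theorem one_le_F (q : ℕ → ℝ≥0) (x : ℝ≥0∞) : 1 ≤ F q x := le_self_add.trans (one_add_le_F q x)

theorem F_le_inv {q : ℕ → ℝ≥0} {x : ℝ≥0∞} (h : F q x < ∞) : F q x ≤ x⁻¹ := by
  have h0 : F q x ≠ 0 := (zero_lt_one.trans_le (one_le_F q x)).ne'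
  have h1 : F q x * x * F q x ≤ 1 * F q x := by
    have := le_add_self.trans (one_add_le_F q x)
    calc _ = x * F q x ^ 2 := by ring
      _ ≤ F q x := this
      _ = _ := (one_mul _).symm
  exact ENNReal.le_inv_iff_mul_le.mpr ((ENNReal.mul_le_mul_iff_left h0 h.ne).mp h1)

theorem F_lt_top_of_lt_rad {q : ℕ → ℝ≥0} {x : ℝ≥0∞} (h : x < rad q) : F q x < ∞ := by
  obtain ⟨y, hy, hxy⟩ := lt_sSup_iff.mp h
  exact (F_mono q hxy.le).trans_lt hy

section Admissible

variable {q : ℕ → ℝ≥0} (ha : Admissible q)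

include ha

theorem rad_pos : 0 < rad q := by
  obtain ⟨x, hx, h⟩ := exists_F_lt_top ha
  exact hx.trans_le (le_sSup h)

theorem Fcoef_lt_top (k : ℕ) : Fcoef q k < ∞ := by
  obtain ⟨x, hx, h⟩ := exists_F_lt_top ha
  have h1 : Fcoef q k * x ^ k < ∞ := (ENNReal.le_tsum k).trans_lt h
  rw [lt_top_iff_ne_top] at h1 ⊢
  intro h2
  rw [h2, ENNReal.top_mul (pow_ne_zero _ hx.ne')] at h1
  exact h1 rfl

/-- Below the radius every partial sum is at most `1 / x`. Partial sums are continuous, so the bound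
passes to the radius, where it is finite because the radius is positive. -/
theorem F_rad_lt_top : F q (rad q) < ∞ := by
  have hr := rad_pos ha
  refine lt_of_le_of_lt ?_ (ENNReal.inv_lt_top.mpr hr)
  rw [F, ENNReal.tsum_eq_iSup_sum]
  refine iSup_le fun s => ?_
  have : (𝓝[<] (rad q)).NeBot := nhdsLT_neBot_of_exists_lt ⟨0, hr⟩
  have h1 : Tendsto (fun x => ∑ k ∈ s, Fcoef q k * x ^ k) (𝓝[<] (rad q))
      (𝓝 (∑ k ∈ s, Fcoef q k * rad q ^ k)) :=
    (tendsto_finsetSum s fun k _ => ENNReal.Tendsto.const_mul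
      ((ENNReal.continuous_pow k).tendsto _) (Or.inr (Fcoef_lt_top ha k).ne)).mono_left
      nhdsWithin_le_nhds
  have h2 : Tendsto (fun x : ℝ≥0∞ => x⁻¹) (𝓝[<] (rad q)) (𝓝 (rad q)⁻¹) :=
    (continuous_inv.tendsto _).mono_left nhdsWithin_le_nhds
  refine le_of_tendsto_of_tendsto h1 h2 ?_
  filter_upwards [self_mem_nhdsWithin] with x hx
  exact (ENNReal.sum_le_tsum s).trans (F_le_inv (F_lt_top_of_lt_rad hx))

theorem one_lt_F_rad : 1 < F q (rad q) := by
  refine lt_of_lt_of_le ?_ (one_add_le_F q (rad q))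
  refine ENNReal.lt_add_right ENNReal.one_ne_top ?_
  exact mul_ne_zero (rad_pos ha).ne'
    (pow_ne_zero _ (zero_lt_one.trans_le (one_le_F q _)).ne')

end Admissible

theorem IsOfType.admissible {q : ℕ → ℝ≥0} {a : ℝ} (h : IsOfType q a) : Admissible q := by
  rcases h with h | h | h
  · exact h.2.1
  · exact h.2.1.1
  · exact h.1.1

/-! ### Laws -/

theorem pointMasses_apply {X : Type} [MeasurableSpace X] [DiscreteMeasurableSpace X]
    (p : X → ℝ≥0∞) (s : Set X) : pointMasses p s = ∑' x, if x ∈ s then p x else 0 := by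
  rw [pointMasses, Measure.sum_apply _ (MeasurableSet.of_discrete)]
  refine tsum_congr fun x => ?_
  rw [Measure.smul_apply, Measure.dirac_apply' _ MeasurableSet.of_discrete, smul_eq_mul,
    Set.indicator_apply]
  split_ifs <;> simp

theorem pointMasses_singleton {X : Type} [MeasurableSpace X] [DiscreteMeasurableSpace X]
    (p : X → ℝ≥0∞) (x : X) : pointMasses p {x} = p x := by
  rw [pointMasses_apply]
  simp only [Set.mem_singleton_iff]
  exact tsum_ite_eq x p

theorem freeBoltzmann_apply (q : ℕ → ℝ≥0) (s : Set RMap) :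
    freeBoltzmann q s = (∑' m, if m ∈ s then bw q (rad q) m else 0) / F q (rad q) := by
  rw [freeBoltzmann, pointMasses_apply, div_eq_mul_inv, ← ENNReal.tsum_mul_right]
  refine tsum_congr fun m => ?_
  split_ifs
  · rw [bw, Set.indicator_apply, Set.indicator_apply]
    split_ifs
    · rw [div_eq_mul_inv]
    · rw [zero_mul]
  · rw [zero_mul]

theorem freeBoltzmann_tree (q : ℕ → ℝ≥0) (t : PlaneTree) :
    freeBoltzmann q (RMap.tree ⁻¹' {t}) =
      (∏ u ∈ t.black, blackWeight q (rad q) (t.numChildren u)) / F q (rad q) := by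
  rw [freeBoltzmann_apply, ← tsum_bw_tree]
  rfl

theorem freeBoltzmann_tree_component (q : ℕ → ℝ≥0) (t : PlaneTree) (c : t.black → RMap) :
    freeBoltzmann q (RMap.tree ⁻¹' {t} ∩ (fun m (u : t.black) => m.component u) ⁻¹' {c}) =
      (∏ u : t.black, componentWeight q (rad q) (t.degree u) (c u)) / F q (rad q) := by
  rw [freeBoltzmann_apply, ← tsum_bw_tree_component]
  congr 1
  refine tsum_congr fun m => ?_
  by_cases h : m.tree = t ∧ (fun u : t.black => m.component u) = c
  · rw [if_pos h]
    exact if_pos h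
  · rw [if_neg h]
    exact if_neg h

theorem simpleBoltzmann_singleton (q : ℕ → ℝ≥0) (k : ℕ) (m : RMap) :
    simpleBoltzmann q k {m} =
      if m ∈ simpleMaps ∧ m.perimeter = 2 * k then m.weight q / FcoefHat q k else 0 := by
  rw [simpleBoltzmann, pointMasses_singleton, Set.indicator_apply]
  rfl

/-- Needed to evaluate product measures at points. The total mass is `F̂_k / F̂_k`, at most one even
when the partition function is zero or infinite. -/
instance (q : ℕ → ℝ≥0) (k : ℕ) : IsFiniteMeasure (simpleBoltzmann q k) := by
  refine ⟨lt_of_le_of_lt ?_ ENNReal.one_lt_top⟩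
  have h : FcoefHat q k =
      ∑' m : {m : RMap | m ∈ simpleMaps ∧ m.perimeter = 2 * k}, m.1.weight q := rfl
  have h1 : simpleBoltzmann q k Set.univ = FcoefHat q k / FcoefHat q k := by
    conv_rhs => rw [div_eq_mul_inv]; lhs; rw [h]
    rw [simpleBoltzmann, pointMasses_apply,
      tsum_subtype {m : RMap | m ∈ simpleMaps ∧ m.perimeter = 2 * k} (fun m => m.weight q),
      ← ENNReal.tsum_mul_right]
    refine tsum_congr fun m => ?_
    rw [if_pos (Set.mem_univ _), Set.indicator_apply, Set.indicator_apply]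
    split_ifs
    · rw [div_eq_mul_inv]
    · rw [zero_mul]
  rw [h1]
  exact ENNReal.div_self_le_one

theorem nuBlack_eq (q : ℕ → ℝ≥0) (n : ℕ) : nuBlack q n =
    (F q (rad q) - 1)⁻¹ * (blackWeight q (rad q) n * F q (rad q) ^ (n + 1)) := by
  rw [nuBlack, blackWeight]
  split_ifs with h
  · obtain ⟨k, rfl⟩ := h
    rw [show (2 * k + 1) / 2 + 1 = k + 1 by omega, mul_pow, ← pow_mul,
      show 2 * (k + 1) = 2 * k + 1 + 1 by ring, one_div]
    ring
  · simp

theorem componentWeight_eq (q : ℕ → ℝ≥0) (x : ℝ≥0∞) (n : ℕ) (m : RMap)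
    (h0 : blackWeight q x n ≠ 0) (ht : FcoefHat q ((n + 1) / 2) ≠ ∞) :
    componentWeight q x (n + 1) m =
      blackWeight q x n * simpleBoltzmann q ((n + 1) / 2) {m} := by
  rw [blackWeight] at h0 ⊢
  split_ifs at h0 ⊢ with h
  · obtain ⟨k, rfl⟩ := h
    have e1 : (2 * k + 1) / 2 + 1 = k + 1 := by omega
    have e2 : (2 * k + 1 + 1) / 2 = k + 1 := by omega
    have e3 : 2 * k + 1 + 1 = 2 * (k + 1) := by ring
    rw [e2] at ht
    rw [e1] at h0 ⊢
    rw [componentWeight, simpleBoltzmann_singleton, e2, e3]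
    split_ifs
    · rw [mul_assoc, ENNReal.mul_div_cancel (right_ne_zero_of_mul h0) ht]
    · rw [mul_zero]
  · exact absurd rfl h0

/-! ### The law of the tree, and the law of the components given the tree -/

section Admissible

variable {q : ℕ → ℝ≥0} (ha : Admissible q)

include ha

theorem isProbabilityMeasure_freeBoltzmann : IsProbabilityMeasure (freeBoltzmann q) := by
  constructor
  rw [freeBoltzmann_apply]
  simp only [Set.mem_univ, if_true]
  rw [tsum_bw]
  exact ENNReal.div_self (zero_lt_one.trans (one_lt_F_rad ha)).ne' (F_rad_lt_top ha).ne

theorem tsum_nuWhite : ∑' k, nuWhite q k = 1 := by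
  have h0 := (zero_lt_one.trans (one_lt_F_rad ha)).ne'
  have h1 : 1 / F q (rad q) ≤ 1 := by
    rw [one_div]; exact ENNReal.inv_le_one.mpr (one_lt_F_rad ha).le
  unfold nuWhite
  rw [ENNReal.tsum_mul_left, ENNReal.tsum_geometric,
    ENNReal.sub_sub_cancel ENNReal.one_ne_top h1, one_div, inv_inv,
    ENNReal.inv_mul_cancel h0 (F_rad_lt_top ha).ne]

/-- This is `F_eq` at the radius of convergence, divided by `F - 1`. -/
theorem tsum_nuBlack : ∑' k, nuBlack q k = 1 := by
  have h1 : F q (rad q) - 1 = ∑' n, blackWeight q (rad q) n * F q (rad q) ^ (n + 1) := by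
    conv_lhs => rw [F_eq]
    exact ENNReal.add_sub_cancel_left ENNReal.one_ne_top
  simp_rw [nuBlack_eq]
  rw [ENNReal.tsum_mul_left, ← h1, ENNReal.inv_mul_cancel]
  · exact (tsub_pos_of_lt (one_lt_F_rad ha)).ne'
  · exact ENNReal.sub_ne_top (F_rad_lt_top ha).ne

/-- The children of white vertices are the black vertices, so the powers of `F - 1` cancel. The
degrees of black vertices sum to the number of vertices minus one, so the powers of `F` leave a
single `1 / F`. -/
theorem prod_nu (t : PlaneTree) :
    (∏ u ∈ t.white, nuWhite q (t.numChildren u)) * ∏ u ∈ t.black, nuBlack q (t.numChildren u) =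
      (∏ u ∈ t.black, blackWeight q (rad q) (t.numChildren u)) / F q (rad q) := by
  have h0 := (zero_lt_one.trans (one_lt_F_rad ha)).ne'
  have ht := (F_rad_lt_top ha).ne
  set f := F q (rad q) with hf
  set P := ∏ u ∈ t.black, blackWeight q (rad q) (t.numChildren u)
  have g0 : f - 1 ≠ 0 := (tsub_pos_of_lt (one_lt_F_rad ha)).ne'
  have gt : f - 1 ≠ ∞ := ENNReal.sub_ne_top ht
  have hsub : 1 - 1 / f = (f - 1) * f⁻¹ := by
    rw [ENNReal.sub_mul fun _ _ => ENNReal.inv_ne_top.mpr h0, ENNReal.mul_inv_cancel h0 ht,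
      one_mul, one_div]
  have hw : ∏ u ∈ t.white, nuWhite q (t.numChildren u) =
      f⁻¹ ^ t.white.card * ((f - 1) * f⁻¹) ^ t.black.card := by
    unfold nuWhite
    rw [Finset.prod_mul_distrib, Finset.prod_const, Finset.prod_pow_eq_pow_sum,
      t.sum_numChildren_white, ← hf, hsub, one_div]
  have hb : ∏ u ∈ t.black, nuBlack q (t.numChildren u) =
      (f - 1)⁻¹ ^ t.black.card * (P * f ^ ∑ u ∈ t.black, t.degree u) := by
    simp_rw [nuBlack_eq]
    rw [Finset.prod_mul_distrib, Finset.prod_mul_distrib, Finset.prod_const,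
      Finset.prod_pow_eq_pow_sum]
    rfl
  have hd : t.white.card + t.black.card = ∑ u ∈ t.black, t.degree u + 1 := by
    rw [t.sum_degree, t.card_white_add_card_black]
  rw [hw, hb]
  calc _ = ((f - 1) * (f - 1)⁻¹) ^ t.black.card * (f⁻¹ ^ (t.white.card + t.black.card) *
        f ^ ∑ u ∈ t.black, t.degree u) * P := by
        rw [mul_pow, mul_pow, pow_add]; ring
    _ = P / f := by
        rw [hd, pow_succ', mul_assoc f⁻¹, ← mul_pow, ENNReal.mul_inv_cancel g0 gt,
          ENNReal.inv_mul_cancel h0 ht, one_pow, one_pow, one_mul, mul_one, mul_comm,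
          div_eq_mul_inv]

theorem map_tree_freeBoltzmann :
    (freeBoltzmann q).map RMap.tree = GW (nuWhite q) (nuBlack q) := by
  refine (Measure.ext_iff_singleton).mpr fun t => ?_
  rw [Measure.map_apply Measurable.of_discrete (measurableSet_singleton t), freeBoltzmann_tree, GW,
    pointMasses_singleton, prod_nu ha]

/-- It suffices to compare point masses, as families of components form a countable set. Positive
probability of `t` makes every black weight nonzero; each component weight is then the black weight
times the normalized law, and the product of black weights cancels with the probability of the tree.
-/
theorem map_component_cond (t : PlaneTree) (ht : freeBoltzmann q (RMap.tree ⁻¹' {t}) ≠ 0) :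
    (ProbabilityTheory.cond (freeBoltzmann q) (RMap.tree ⁻¹' {t})).map
        (fun (m : RMap) (u : t.black) => m.component u) =
      Measure.pi (fun u : t.black => simpleBoltzmann q (t.degree u / 2)) := by
  have := isProbabilityMeasure_freeBoltzmann ha
  refine (Measure.ext_iff_singleton).mpr fun c => ?_
  have hfin := measure_ne_top (freeBoltzmann q) (RMap.tree ⁻¹' {t})
  rw [Measure.map_apply Measurable.of_discrete (measurableSet_singleton c),
    ProbabilityTheory.cond_apply MeasurableSet.of_discrete, freeBoltzmann_tree_component,
    Measure.pi_singleton]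
  rw [freeBoltzmann_tree, ← Finset.prod_coe_sort] at ht hfin ⊢
  have hne : ∀ u : t.black, blackWeight q (rad q) (t.numChildren u) ≠ 0 := by
    intro u hu
    rw [Finset.prod_eq_zero (Finset.mem_univ u) hu, ENNReal.zero_div] at ht
    exact ht rfl
  have hprod : ∏ u : t.black, componentWeight q (rad q) (t.degree u) (c u) =
      (∏ u : t.black, blackWeight q (rad q) (t.numChildren u)) *
        ∏ u : t.black, simpleBoltzmann q (t.degree u / 2) {c u} := by
    rw [← Finset.prod_mul_distrib]
    exact Finset.prod_congr rfl fun u _ => componentWeight_eq q (rad q) (t.numChildren u) (c u)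
      (hne u) ((FcoefHat_le q _).trans_lt (Fcoef_lt_top ha _)).ne
  rw [hprod, ENNReal.mul_div_right_comm, ← mul_assoc, ENNReal.inv_mul_cancel ht hfin, one_mul]

end Admissible

end

end BoltzmannMap

theorem mainTheorem5 (q : ℕ → ℝ≥0) (a : ℝ) (hq : IsOfType q a) :
    -- the tree of components of every map is a finite tree
    (∀ m ∈ maps, (m.treeVertices).Finite) ∧
    -- the free-perimeter Boltzmann measure and the offspring laws are probability measures
    IsProbabilityMeasure (freeBoltzmann q) ∧
    (∑' k, nuWhite q k = 1) ∧ (∑' k, nuBlack q k = 1) ∧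
    -- law of the tree of components
    (freeBoltzmann q).map RMap.tree = GW (nuWhite q) (nuBlack q) ∧
    -- conditional law of the irreducible components given the tree
    (∀ t : PlaneTree, freeBoltzmann q (RMap.tree ⁻¹' {t}) ≠ 0 →
      (ProbabilityTheory.cond (freeBoltzmann q) (RMap.tree ⁻¹' {t})).map
          (fun (m : RMap) (u : t.black) => m.component u)
        = Measure.pi (fun u : t.black => simpleBoltzmann q (t.degree u / 2))) :=
  have ha := hq.admissible
  ⟨fun _ hm => treeVertices_finite hm, isProbabilityMeasure_freeBoltzmann ha, tsum_nuWhite ha,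
    tsum_nuBlack ha, map_tree_freeBoltzmann ha, map_component_cond ha⟩
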